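/- Let $M$ be a finite von Neumann algebra, i.e. a von Neumann algebra on a complex Hilbert space $H$ equipped with a normal faithful tracial state $\tau$. Let $M^{\mathrm{op}}$ be the opposite von Neumann algebra (the algebra of the transposes $x^{\mathrm{op}}\colon f\mapsto f\circ x$, $x\in M$, acting on the dual Hilbert space $H^*$), and let $M\overline{\otimes}M^{\mathrm{op}}$ be the von Neumann algebra tensor product, acting on the Hilbert space tensor product of $H$ and $H^*$. Let $L(\mathbb{F}_2)$ be the von Neumann algebra of the free group $\mathbb{F}_2$ on two generators, i.e. the von Neumann algebra on $\ell^2(\mathbb{F}_2)$ generated by the left regular representation. Then the following are equivalent: 1. $L(\mathbb{F}_2)$ embeds in $M$, i.e. $L(\mathbb{F}_2)$ is $*$-isomorphic to a von Neumann subalgebra of $M$ that contains the unit of $M$; 2. $$\inf_{u_1,u_2\in\mathcal{U}(M)}\Bigl\|\sum_{i=1}^{2}\bigl(u_i\otimes (u_i^{\mathrm{op}})^*+u_i^*\otimes u_i^{\mathrm{op}}\bigr)\Bigr\|_{M\overline{\otimes}M^{\mathrm{op}}}=2\sqrt{3},$$ and this infimum is attained by some pair of unitaries $u_1,u_2$ of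 $M$. -/

import Mathlib

open scoped TensorProduct ComplexOrder ComplexConjugate

noncomputable section

namespace FreeEmbedding

/-! ### The opposite of a von Neumann algebra, acting on the dual Hilbert space -/

section Dual

variable {H : Type*} [NormedAddCommGroup H] [InnerProductSpace ℂ H] [CompleteSpace H]

/-- The dual (equivalently, the conjugate) of a complex Hilbert space, as a Hilbert space: its norm
is the dual norm and, with `v ↦ ⟪v, ·⟫` the antilinear Riesz isomorphism, `⟪⟪v, ·⟫, ⟪w, ·⟫⟫ = ⟪w, v⟫`. -/
instance dualInnerProductSpace : InnerProductSpace ℂ (StrongDual ℂ H) where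
  inner f g :=
    inner ℂ ((InnerProductSpace.toDual ℂ H).symm g) ((InnerProductSpace.toDual ℂ H).symm f)
  norm_sq_eq_re_inner f := by
    rw [inner_self_eq_norm_sq]; simp
  conj_inner_symm f g := inner_conj_symm _ _
  add_left f g h := by
    rw [map_add, inner_add_right]
  smul_left f g r := by
    rw [map_smulₛₗ, inner_smul_right]

/-- The transpose `f ↦ f ∘ x` of a bounded operator, acting on the dual Hilbert space. It is linear
and reverses products, so it represents the opposite algebra. -/
def transpose (x : H →L[ℂ] H) : StrongDual ℂ H →L[ℂ] StrongDual ℂ H :=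
  ContinuousLinearMap.precomp ℂ x

end Dual

/-! ### Von Neumann algebras: generation, opposite, tensor product -/

section Algebras

variable {H K : Type*} [NormedAddCommGroup H] [InnerProductSpace ℂ H] [CompleteSpace H]
  [NormedAddCommGroup K] [InnerProductSpace ℂ K] [CompleteSpace K]

/-- The von Neumann algebra generated by a set of bounded operators: the double commutant of its
star-closure. -/
def generated (S : Set (H →L[ℂ] H)) : VonNeumannAlgebra H where
  toStarSubalgebra := StarSubalgebra.centralizer ℂ (StarSubalgebra.centralizer ℂ S : Set (H →L[ℂ] H))
  centralizer_centralizer' := by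
    simp

theorem subset_generated (S : Set (H →L[ℂ] H)) : S ⊆ (generated S : Set (H →L[ℂ] H)) := by
  intro x hx
  change x ∈ StarSubalgebra.centralizer ℂ (StarSubalgebra.centralizer ℂ S : Set (H →L[ℂ] H))
  exact StarAlgebra.adjoin_le_centralizer_centralizer ℂ S
    (StarAlgebra.subset_adjoin ℂ S hx)

/-- The opposite von Neumann algebra `M^op`: the algebra of the transposes of the elements of `M`,
on the dual Hilbert space. -/
def opposite (M : VonNeumannAlgebra H) : VonNeumannAlgebra (StrongDual ℂ H) :=
  generated (transpose '' (M : Set (H →L[ℂ] H)))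

/-- The element `x^op` of `M^op`. -/
def op {M : VonNeumannAlgebra H} (x : M.toStarSubalgebra) : (opposite M).toStarSubalgebra :=
  ⟨transpose (x : H →L[ℂ] H), subset_generated _ ⟨x, x.2, rfl⟩⟩

variable (H K) in
/-- The tensor product of two Hilbert spaces. -/
abbrev HilbertTensor : Type _ := UniformSpace.Completion (H ⊗[ℂ] K)

/-- The bounded operator `x ⊗ y` on the Hilbert space `H ⊗ K`. -/
def tensorOp (x : H →L[ℂ] H) (y : K →L[ℂ] K) : HilbertTensor H K →L[ℂ] HilbertTensor H K :=
  (TensorProduct.mapL x y).completion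

/-- The (spatial) von Neumann algebra tensor product, generated by the elementary tensors. -/
def vnTensor (M : VonNeumannAlgebra H) (N : VonNeumannAlgebra K) :
    VonNeumannAlgebra (HilbertTensor H K) :=
  generated {z | ∃ x ∈ M, ∃ y ∈ N, z = tensorOp x y}

/-- The elementary tensor `x ⊗ y`, as an element of the von Neumann algebra tensor product. -/
def elemTensor {M : VonNeumannAlgebra H} {N : VonNeumannAlgebra K}
    (x : M.toStarSubalgebra) (y : N.toStarSubalgebra) : (vnTensor M N).toStarSubalgebra :=
  ⟨tensorOp (x : H →L[ℂ] H) (y : K →L[ℂ] K), subset_generated _ ⟨x, x.2, y, y.2, rfl⟩⟩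

/-- The norm in the von Neumann algebra tensor product of `M` and `M^op` of
`∑ i, u i ⊗ ((u i)^op)^* + (u i)^* ⊗ (u i)^op`, for two unitaries `u 0`, `u 1` of `M`. -/
def tensorNorm (M : VonNeumannAlgebra H) (u : Fin 2 → unitary M.toStarSubalgebra) : ℝ :=
  ‖∑ i, (elemTensor (u i : M.toStarSubalgebra) (star (op (u i : M.toStarSubalgebra))) +
    elemTensor (star (u i : M.toStarSubalgebra)) (op (u i : M.toStarSubalgebra)))‖

/-- `τ` is a normal faithful tracial state on `M`. Normality is ultraweak continuity: `τ` is given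
by two square-summable sequences of vectors. -/
structure IsNormalFaithfulTracialState (M : VonNeumannAlgebra H)
    (τ : M.toStarSubalgebra →ₗ[ℂ] ℂ) : Prop where
  map_one : τ 1 = 1
  nonneg : ∀ x, 0 ≤ τ (star x * x)
  faithful : ∀ x, τ (star x * x) = 0 → x = 0
  tracial : ∀ x y, τ (x * y) = τ (y * x)
  normal : ∃ ξ η : ℕ → H, Summable (fun n => ‖ξ n‖ ^ 2) ∧ Summable (fun n => ‖η n‖ ^ 2) ∧
    ∀ x : M.toStarSubalgebra, HasSum (fun n => inner ℂ (ξ n) ((x : H →L[ℂ] H) (η n))) (τ x)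

/-- `N` embeds in `M` (as a von Neumann algebra): `N` is `*`-isomorphic to a von Neumann subalgebra
of `M` with the same unit as `M`. -/
def Embeds (N : VonNeumannAlgebra K) (M : VonNeumannAlgebra H) : Prop :=
  ∃ P : VonNeumannAlgebra H, P ≤ M ∧
    Nonempty (N.toStarSubalgebra ≃⋆ₐ[ℂ] P.toStarSubalgebra)

end Algebras

/-! ### Group von Neumann algebras -/

section Groups

variable (G : Type*) [Group G]

/-- The Hilbert space `ℓ²(G)`. -/
abbrev ellTwo : Type _ := lp (fun _ : G => ℂ) 2

variable {G}

theorem memℓp_translate (g : G) (f : ellTwo G) :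
    Memℓp (fun h => f (g⁻¹ * h) : G → ℂ) 2 := by
  have h2 : (0 : ℝ) < (2 : ENNReal).toReal := by norm_num
  have hf := (memℓp_gen_iff h2).1 f.2
  exact (memℓp_gen_iff h2).2 (hf.comp_injective (mul_right_injective g⁻¹))

/-- The left regular representation: `(λ(g) f)(h) = f(g⁻¹ h)`. -/
def leftRegular (g : G) : ellTwo G →L[ℂ] ellTwo G :=
  LinearMap.mkContinuous
    { toFun := fun f => ⟨fun h => f (g⁻¹ * h), memℓp_translate g f⟩
      map_add' := fun _ _ => rfl
      map_smul' := fun _ _ => rfl } 1 (by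
    intro f
    have h2 : (0 : ℝ) < (2 : ENNReal).toReal := by norm_num
    rw [one_mul, lp.norm_eq_tsum_rpow h2, lp.norm_eq_tsum_rpow h2]
    exact le_of_eq (congrArg (· ^ (1 / (2 : ENNReal).toReal))
      ((Equiv.mulLeft g⁻¹).tsum_eq (fun h => ‖f h‖ ^ (2 : ENNReal).toReal))))

variable (G) in
/-- The group von Neumann algebra `L(G)`, generated by the left regular representation. -/
def groupVN : VonNeumannAlgebra (ellTwo G) := generated (Set.range (leftRegular (G := G)))

end Groups

end FreeEmbedding

end

/-! Two unitaries of M give a representation g ↦ u_g of F₂, and with it π(g) = u_g ⊗ (u_g⁻¹)^op. The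
operator in the theorem is T = Σ π(s) over the four letters s. Normality of τ makes τ ⊗ τ^op a
bounded functional Φ with Φ(π(g)) = f(g) := |τ(u_g)|² ≥ 0 and f(1) = 1. The sum S_n of π over
reduced words of length n is a polynomial p_n(T) of Chebyshev type for [-2√3, 2√3].

Lower bound, for every pair of unitaries (`two_sqrt_three_le_norm`). If ‖T‖ < 2√3, certain
combinations Y_m of S_2, S_4, …, S_{2m} are bounded in norm uniformly in m, whereas f ≥ 0 and f(1) =
1 force Φ(Y_m²) ≥ m.

Embedding gives 2√3. The trace on L(F₂) is unique by Powers averaging, so τ(u_g) = 0 for g ≠ 1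
(`map_eq_zero_of_embedding`). The vectors x of H whose coefficients ⟨u_g x, k⟩ are square summable
are then total, so π has absolutely summable coefficients on a dense subspace. This bounds ⟨ζ, S_n
ζ⟩ uniformly in n, hence |⟨ζ, Tⁿ ζ⟩| by a multiple of (2√3)ⁿ, and log-convexity of n ↦ ‖Tⁿζ‖ yields
‖T‖ ≤ 2√3 (`norm_sphereSum_one_le`).

Attaining 2√3 gives an embedding. Now ‖p_n(T)‖ ≤ 2(n+1)√3ⁿ, so f has sum O(n √3ⁿ) over the sphere of
radius n. Suppose τ(u_w) ≠ 0 with w ≠ 1. A convex combination a of conjugates of u_w with nearly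
minimal 2-norm is almost central, so τ stays away from 0 on products a₁a₂*a₃a₄* of conjugates of a.
Hence f ≥ δ on some product of conjugates, by any prescribed h₁, …, h₄, of elements of one finite
set. Counting quadruples of conjugators produces about N³·3^(4DN) words of length 8DN + O(1) against
an allowed total of about N·3^(4DN), a contradiction (`false_of_le_fourConj`). Three conjugates
would suffice for the count; four make the trace a square, hence bounded below.

So τ(u_g) = 0 for all g ≠ 1. The coefficient maps k ↦ (⟨u_g x, k⟩)_g intertwine u with the left
regular representation. They and their adjoints have total ranges, which identifies the algebra
generated by the u_g with L(F₂) (`nonempty_starAlgEquiv_generated`). -/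

noncomputable section

set_option linter.unusedSectionVars false
set_option linter.style.haveILetI false

namespace FreeEmbedding

/-! ### Reduced words and spherical sums in the free group of rank two -/

/-- The letters of words in the free group on two generators. -/
abbrev Letter := Fin 2 × Bool

/-- The inverse letter. -/
def invLetter (s : Letter) : Letter := (s.1, !s.2)

@[simp] theorem invLetter_invLetter (s : Letter) : invLetter (invLetter s) = s := by
  simp [invLetter]

theorem reduced_step_iff (s t : Letter) : (s.1 = t.1 → s.2 = t.2) ↔ t ≠ invLetter s := by
  revert s t; decide

/-- The reduced words of length `k + 1` with first letter `s`. -/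
def words : ℕ → Letter → Finset (List Letter)
  | 0, s => {[s]}
  | k + 1, s => (Finset.univ.filter (· ≠ invLetter s)).biUnion
      fun t => (words k t).image (List.cons s)

theorem mem_words {k : ℕ} {s : Letter} {L : List Letter} :
    L ∈ words k s ↔ FreeGroup.IsReduced L ∧ L.length = k + 1 ∧ L.head? = some s := by
  induction k generalizing s L with
  | zero =>
    simp only [words, Finset.mem_singleton]
    constructor
    · rintro rfl; simp
    · rintro ⟨-, h1, h2⟩
      obtain ⟨a, rfl⟩ := List.length_eq_one_iff.1 h1
      simpa using h2
  | succ k ih =>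
    simp only [words, Finset.mem_biUnion, Finset.mem_filter, Finset.mem_univ, true_and,
      Finset.mem_image]
    constructor
    · rintro ⟨t, ht, L', hL', rfl⟩
      obtain ⟨h1, h2, h3⟩ := ih.1 hL'
      rcases L' with _ | ⟨a, L'⟩
      · simp at h3
      · simp only [List.head?_cons, Option.some.injEq] at h3
        subst h3
        refine ⟨FreeGroup.isReduced_cons_cons.2 ⟨(reduced_step_iff _ _).2 ht, h1⟩, ?_, rfl⟩
        simpa using h2
    · rintro ⟨h1, h2, h3⟩
      rcases L with _ | ⟨a, _ | ⟨b, L⟩⟩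
      · simp at h2
      · simp at h2
      · simp only [List.head?_cons, Option.some.injEq] at h3
        subst h3
        rw [FreeGroup.isReduced_cons_cons] at h1
        exact ⟨b, (reduced_step_iff _ _).1 h1.1, b :: L, ih.2 ⟨h1.2, by simpa using h2, rfl⟩, rfl⟩

theorem sum_words_succ {A : Type*} [AddCommMonoid A] (F : List Letter → A) (k : ℕ) (s : Letter) :
    ∑ L ∈ words (k + 1) s, F L =
      ∑ t ∈ Finset.univ.filter (· ≠ invLetter s), ∑ L ∈ words k t, F (s :: L) := by
  rw [words, Finset.sum_biUnion]
  · refine Finset.sum_congr rfl fun t _ => ?_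
    rw [Finset.sum_image]
    intro a _ b _ h
    simpa using h
  · intro t _ t' _ htt'
    rw [Function.onFun, Finset.disjoint_left]
    intro L h h'
    obtain ⟨L1, h1, rfl⟩ := Finset.mem_image.1 h
    obtain ⟨L2, h2, h3⟩ := Finset.mem_image.1 h'
    simp only [List.cons.injEq, true_and] at h3
    subst h3
    exact htt' (Option.some.inj ((mem_words.1 h1).2.2.symm.trans (mem_words.1 h2).2.2))

theorem card_filter_ne_invLetter (s : Letter) :
    (Finset.univ.filter (· ≠ invLetter s)).card = 3 := by
  revert s; decide

theorem card_words (k : ℕ) (s : Letter) : (words k s).card = 3 ^ k := by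
  induction k generalizing s with
  | zero => simp [words]
  | succ k ih =>
    rw [Finset.card_eq_sum_ones, sum_words_succ]
    simp only [ih, Finset.sum_const, card_filter_ne_invLetter]
    rw [smul_eq_mul]; ring

/-- The reduced words of length `n`. -/
def sphere : ℕ → Finset (List Letter)
  | 0 => {[]}
  | k + 1 => Finset.univ.biUnion (words k)

theorem mem_sphere {n : ℕ} {L : List Letter} :
    L ∈ sphere n ↔ FreeGroup.IsReduced L ∧ L.length = n := by
  rcases n with _ | k
  · simp only [sphere, Finset.mem_singleton]
    constructor
    · rintro rfl; simp
    · rintro ⟨-, h⟩; simpa using h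
  · simp only [sphere, Finset.mem_biUnion, Finset.mem_univ, true_and, mem_words]
    constructor
    · rintro ⟨s, h1, h2, -⟩; exact ⟨h1, h2⟩
    · rintro ⟨h1, h2⟩
      rcases L with _ | ⟨a, L⟩
      · simp at h2
      · exact ⟨a, h1, h2, rfl⟩

theorem sum_sphere_succ {A : Type*} [AddCommMonoid A] (F : List Letter → A) (k : ℕ) :
    ∑ L ∈ sphere (k + 1), F L = ∑ s, ∑ L ∈ words k s, F L := by
  rw [sphere, Finset.sum_biUnion]
  intro t _ t' _ htt'
  rw [Function.onFun, Finset.disjoint_left]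
  intro L h h'
  exact htt' (Option.some.inj ((mem_words.1 h).2.2.symm.trans (mem_words.1 h').2.2))

theorem card_sphere_succ (k : ℕ) : (sphere (k + 1)).card = 4 * 3 ^ k := by
  rw [Finset.card_eq_sum_ones, sum_sphere_succ]
  simp [card_words]

/-! ### The recursion for spherical sums -/

section Spherical

variable {A : Type*} [Semiring A] (π : FreeGroup (Fin 2) →* A)

/-- The sum of a representation over the reduced words of length `k + 1` with first letter `s`. -/
def coneSum (k : ℕ) (s : Letter) : A := ∑ L ∈ words k s, π (FreeGroup.mk L)

/-- The sum of a representation over the sphere of radius `n`. -/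
def sphereSum (n : ℕ) : A := ∑ L ∈ sphere n, π (FreeGroup.mk L)

theorem sphereSum_zero : sphereSum π 0 = 1 := by
  simp [sphereSum, sphere, ← FreeGroup.one_eq_mk]

theorem sphereSum_succ (k : ℕ) : sphereSum π (k + 1) = ∑ s, coneSum π k s :=
  sum_sphere_succ _ _

theorem coneSum_zero (s : Letter) : coneSum π 0 s = π (FreeGroup.mk [s]) := by
  simp [coneSum, words]

theorem coneSum_succ (k : ℕ) (s : Letter) :
    coneSum π (k + 1) s = π (FreeGroup.mk [s]) *
      ∑ t ∈ Finset.univ.filter (· ≠ invLetter s), coneSum π k t := by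
  rw [coneSum, sum_words_succ, Finset.mul_sum]
  refine Finset.sum_congr rfl fun t _ => ?_
  rw [coneSum, Finset.mul_sum]
  refine Finset.sum_congr rfl fun L _ => ?_
  rw [← map_mul, FreeGroup.mul_mk, List.singleton_append]

theorem map_mk_mul_map_mk_invLetter (s : Letter) :
    π (FreeGroup.mk [s]) * π (FreeGroup.mk [invLetter s]) = 1 := by
  rw [← map_mul]
  have : FreeGroup.mk [invLetter s] = (FreeGroup.mk [s])⁻¹ := by
    rw [FreeGroup.inv_mk]; simp [FreeGroup.invRev, invLetter]
  rw [this, mul_inv_cancel, map_one]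

theorem mul_coneSum_succ_invLetter (k : ℕ) (s : Letter) :
    π (FreeGroup.mk [s]) * coneSum π (k + 1) (invLetter s) =
      ∑ t ∈ Finset.univ.filter (· ≠ s), coneSum π k t := by
  rw [coneSum_succ, ← mul_assoc, map_mk_mul_map_mk_invLetter, one_mul, invLetter_invLetter]

/-- A letter s multiplied onto a reduced word either lengthens it or cancels its first letter s⁻¹.
The second term collects the cancellations. -/
theorem sphereSum_one_mul_eq (k : ℕ) :
    sphereSum π 1 * sphereSum π (k + 1) = sphereSum π (k + 2) +
      ∑ s, π (FreeGroup.mk [s]) * coneSum π k (invLetter s) := by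
  rw [sphereSum_succ, sphereSum_succ, sphereSum_succ, Finset.sum_mul, ← Finset.sum_add_distrib]
  refine Finset.sum_congr rfl fun s _ => ?_
  rw [coneSum_succ, coneSum_zero, ← mul_add, add_comm]
  congr 1
  rw [Finset.filter_ne', Finset.add_sum_erase _ _ (Finset.mem_univ _)]

theorem sphereSum_one_mul_one :
    sphereSum π 1 * sphereSum π 1 = sphereSum π 2 + 4 := by
  rw [sphereSum_one_mul_eq]
  simp [coneSum_zero, map_mk_mul_map_mk_invLetter]

theorem sphereSum_one_mul_add_two (j : ℕ) :
    sphereSum π 1 * sphereSum π (j + 2) = sphereSum π (j + 3) + 3 * sphereSum π (j + 1) := by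
  rw [sphereSum_one_mul_eq]
  congr 1
  simp_rw [mul_coneSum_succ_invLetter]
  rw [sphereSum_succ]
  have : ∀ s : Letter, ∑ t ∈ Finset.univ.filter (· ≠ s), coneSum π j t =
      ∑ t, if t ≠ s then coneSum π j t else 0 := fun s => Finset.sum_filter _ _
  simp_rw [this]
  rw [Finset.sum_comm, Finset.mul_sum]
  refine Finset.sum_congr rfl fun t _ => ?_
  rw [← Finset.sum_filter, Finset.sum_const]
  -- A word starting with t results from a cancellation by s exactly when s ≠ t, so three times.
  have h3 : (Finset.univ.filter (fun s => t ≠ s)).card = 3 := by revert t; decide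
  rw [h3, nsmul_eq_mul]
  norm_num

end Spherical

/-! ### The polynomials expressing the spherical sums, and norm bounds -/

open Polynomial in
/-- The polynomials `p n` with `sphereSum π n = p n (sphereSum π 1)`. -/
def spherePoly : ℕ → ℝ[X]
  | 0 => 1
  | 1 => X
  | 2 => X * X - 4
  | n + 3 => X * spherePoly (n + 2) - 3 * spherePoly (n + 1)

theorem aeval_spherePoly {A : Type*} [Ring A] [Algebra ℝ A] (π : FreeGroup (Fin 2) →* A) :
    ∀ n, Polynomial.aeval (sphereSum π 1) (spherePoly n) = sphereSum π n
  | 0 => by simp [spherePoly, sphereSum_zero]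
  | 1 => by simp [spherePoly]
  | 2 => by
    simp only [spherePoly, map_sub, map_mul, Polynomial.aeval_X, map_ofNat]
    rw [sphereSum_one_mul_one, add_sub_cancel_right]
  | n + 3 => by
    simp only [spherePoly, map_sub, map_mul, Polynomial.aeval_X, map_ofNat,
      aeval_spherePoly π (n + 2), aeval_spherePoly π (n + 1)]
    rw [sphereSum_one_mul_add_two, add_sub_cancel_right]

theorem two_mul_cos_mul_sin (x θ : ℝ) :
    2 * Real.cos θ * Real.sin x = Real.sin (x + θ) + Real.sin (x - θ) := by
  rw [Real.sin_add, Real.sin_sub]; ring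

/-- The three-term recursion becomes 2 cos θ sin x = sin(x+θ) + sin(x-θ) under t = 2√3 cos θ. In
Chebyshev terms p_n = √3ⁿ (U_n - U_{n-2}/3); the correction comes from the 4 in p_2, where the
recursion has a 3 later on. -/
theorem eval_spherePoly_mul_sin (θ : ℝ) :
    ∀ n : ℕ, (spherePoly (n + 1)).eval (2 * √3 * Real.cos θ) * Real.sin θ =
      √3 ^ (n + 1) * (Real.sin ((n + 2) * θ) - Real.sin (n * θ) / 3)
  | 0 => by
    have := two_mul_cos_mul_sin θ θ
    simp only [sub_self, Real.sin_zero, add_zero] at this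
    simp only [spherePoly, Polynomial.eval_X, zero_add, Nat.cast_zero, zero_mul, Real.sin_zero,
      zero_div, sub_zero, pow_one, two_mul θ, ← this]
    ring
  | 1 => by
    have h3 : √3 * √3 = 3 := Real.mul_self_sqrt (by norm_num)
    have h1 := two_mul_cos_mul_sin θ θ
    have h2 := two_mul_cos_mul_sin (2 * θ) θ
    have e1 : 2 * θ + θ = 3 * θ := by ring
    have e2 : 2 * θ - θ = θ := by ring
    rw [sub_self, Real.sin_zero, add_zero, ← two_mul] at h1
    rw [e1, e2] at h2
    have e3 : ((1 : ℕ) + 2 : ℝ) * θ = 3 * θ := by push_cast; ring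
    have e4 : ((1 : ℕ) : ℝ) * θ = θ := by push_cast; ring
    rw [e3, e4]
    simp only [spherePoly, Polynomial.eval_sub, Polynomial.eval_mul, Polynomial.eval_X,
      Polynomial.eval_ofNat]
    linear_combination (4 * Real.cos θ ^ 2 * Real.sin θ - Real.sin (3 * θ)
      + Real.sin θ / 3) * h3 + 3 * h2 + 3 * 2 * Real.cos θ * h1
  | n + 2 => by
    have h3 : √3 * √3 = 3 := Real.mul_self_sqrt (by norm_num)
    have i1 := eval_spherePoly_mul_sin θ (n + 1)
    have i0 := eval_spherePoly_mul_sin θ n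
    have h1 := two_mul_cos_mul_sin ((n + 3) * θ) θ
    have h2 := two_mul_cos_mul_sin ((n + 1) * θ) θ
    have e1 : (n + 3 : ℝ) * θ + θ = (n + 4) * θ := by ring
    have e2 : (n + 3 : ℝ) * θ - θ = (n + 2) * θ := by ring
    have e3 : (n + 1 : ℝ) * θ + θ = (n + 2) * θ := by ring
    have e4 : (n + 1 : ℝ) * θ - θ = n * θ := by ring
    rw [e1, e2] at h1
    rw [e3, e4] at h2
    have e5 : (((n + 1 : ℕ) : ℝ) + 2) = n + 3 := by push_cast; ring
    have e6 : (((n + 2 : ℕ) : ℝ) + 2) = n + 4 := by push_cast; ring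
    rw [e5] at i1
    rw [e6]
    push_cast at i1 ⊢
    simp only [spherePoly, Polynomial.eval_sub, Polynomial.eval_mul, Polynomial.eval_X,
      Polynomial.eval_ofNat]
    have e7 : √3 ^ (n + 2 + 1) = √3 ^ (n + 1) * (√3 * √3) := by ring
    have e8 : √3 ^ (n + 1 + 1) = √3 ^ (n + 1) * √3 := by ring
    rw [e8] at i1
    rw [e7]
    set S := √3 ^ (n + 1)
    set a := Real.sin ((n + 2) * θ)
    set b := Real.sin ((n + 3) * θ)
    set c := Real.sin ((n + 1) * θ)
    set d := Real.sin ((n : ℝ) * θ)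
    set e := Real.sin ((n + 4) * θ)
    linear_combination 2 * √3 * Real.cos θ * i1 - 3 * i0 +
      (S * 2 * Real.cos θ * (b - c / 3) - S * (e - a / 3)) * h3 + 3 * S * h1 - S * h2

theorem abs_sin_nat_mul_le (n : ℕ) (θ : ℝ) : |Real.sin (n * θ)| ≤ n * |Real.sin θ| := by
  induction n with
  | zero => simp
  | succ n ih =>
    push_cast
    rw [add_mul, one_mul, Real.sin_add]
    calc |Real.sin (n * θ) * Real.cos θ + Real.cos (n * θ) * Real.sin θ|
        ≤ |Real.sin (n * θ)| * |Real.cos θ| + |Real.cos (n * θ)| * |Real.sin θ| := by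
          rw [← abs_mul, ← abs_mul]; exact abs_add_le _ _
      _ ≤ |Real.sin (n * θ)| * 1 + 1 * |Real.sin θ| := by
          gcongr
          · exact Real.abs_cos_le_one _
          · exact Real.abs_cos_le_one _
      _ ≤ (n + 1) * |Real.sin θ| := by linarith

theorem exists_eq_two_sqrt_three_mul_cos {t : ℝ} (ht : |t| ≤ 2 * √3) :
    ∃ θ, t = 2 * √3 * Real.cos θ ∧ Real.sin θ ^ 2 = 1 - t ^ 2 / 12 := by
  have h3 : √3 * √3 = 3 := Real.mul_self_sqrt (by norm_num)
  have hs : (0 : ℝ) < 2 * √3 := by positivity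
  have := abs_le.1 ht
  have hc : Real.cos (Real.arccos (t / (2 * √3))) = t / (2 * √3) := by
    apply Real.cos_arccos
    · rw [le_div_iff₀ hs]; linarith
    · rw [div_le_iff₀ hs]; linarith
  have h1 : t = 2 * √3 * Real.cos (Real.arccos (t / (2 * √3))) := by rw [hc]; field_simp
  refine ⟨_, h1, ?_⟩
  rw [Real.sin_sq, hc]
  have : (2 * √3) ^ 2 = 12 := by nlinarith
  rw [div_pow, this]

theorem abs_eval_spherePoly_le (n : ℕ) {t : ℝ} (ht : |t| ≤ 2 * √3) :
    |(spherePoly n).eval t| ≤ 2 * (n + 1) * √3 ^ n := by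
  rcases n with _ | n
  · simp [spherePoly]
  have hs : (0 : ℝ) < 2 * √3 := by positivity
  -- At the end points sin θ = 0 and division is impossible; they are reached by continuity.
  have hcl : t ∈ closure (Set.Ioo (-(2 * √3)) (2 * √3)) := by
    rw [closure_Ioo (by linarith)]; exact abs_le.1 ht
  have hclosed : IsClosed {t : ℝ | |(spherePoly (n + 1)).eval t| ≤
      2 * ((n + 1 : ℕ) + 1) * √3 ^ (n + 1)} :=
    isClosed_le (by fun_prop) continuous_const
  refine closure_minimal (fun t ht => ?_) hclosed hcl
  have h3 : √3 ^ 2 = 3 := Real.sq_sqrt (by norm_num)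
  obtain ⟨θ, hθ, hsin⟩ := exists_eq_two_sqrt_three_mul_cos (abs_le.2 ⟨ht.1.le, ht.2.le⟩)
  have hpos : 0 < |Real.sin θ| := by
    apply abs_pos.2
    intro h
    rw [h] at hsin
    nlinarith [ht.1, ht.2]
  change |(spherePoly (n + 1)).eval t| ≤ _
  refine le_of_mul_le_mul_right ?_ hpos
  rw [← abs_mul, hθ, eval_spherePoly_mul_sin, abs_mul, abs_of_nonneg (by positivity)]
  have h1 := abs_sin_nat_mul_le (n + 2) θ
  have h2 := abs_sin_nat_mul_le n θ
  push_cast at h1 ⊢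
  have : |Real.sin ((n + 2) * θ) - Real.sin (n * θ) / 3| ≤ 2 * (n + 1 + 1) * |Real.sin θ| := by
    refine (abs_sub _ _).trans ?_
    rw [abs_div, abs_of_pos (by norm_num : (0 : ℝ) < 3)]
    have : 0 ≤ (n : ℝ) * |Real.sin θ| := by positivity
    linarith
  calc √3 ^ (n + 1) * |Real.sin ((n + 2) * θ) - Real.sin (n * θ) / 3|
      ≤ √3 ^ (n + 1) * (2 * (n + 1 + 1) * |Real.sin θ|) := by gcongr
    _ = _ := by ring

/-- The telescoping rests on sin²((m+1)θ) - sin²(mθ) = sin θ · sin((2m+1)θ). -/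
theorem sin_mul_sum_sin (θ : ℝ) (m : ℕ) :
    Real.sin θ * ∑ j ∈ Finset.range m, Real.sin ((2 * j + 1) * θ) = Real.sin (m * θ) ^ 2 := by
  induction m with
  | zero => simp
  | succ m ih =>
    rw [Finset.sum_range_succ, mul_add, ih]
    have e1 : (2 * (m : ℝ) + 1) * θ = m * θ + (m + 1) * θ := by ring
    have hs : Real.sin θ = Real.sin ((m + 1) * θ - m * θ) := by ring_nf
    rw [Real.sin_sub] at hs
    push_cast
    rw [e1, Real.sin_add]
    have c1 := Real.sin_sq_add_cos_sq ((m : ℝ) * θ)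
    have c2 := Real.sin_sq_add_cos_sq (((m : ℝ) + 1) * θ)
    set a := Real.sin ((m : ℝ) * θ)
    set b := Real.cos ((m : ℝ) * θ)
    set c := Real.sin (((m : ℝ) + 1) * θ)
    set d := Real.cos (((m : ℝ) + 1) * θ)
    linear_combination (a * d + b * c) * hs + c ^ 2 * c1 - a ^ 2 * c2

/-- A polynomial in the spherical sums of even radius which is bounded away from the end points
of the interval `[-2√3, 2√3]`, uniformly in `m`. -/
def evenPoly (m : ℕ) : Polynomial ℝ :=
  ∑ j ∈ Finset.range m, Polynomial.C ((3 : ℝ)⁻¹ ^ (j + 1)) * spherePoly (2 * j + 2)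

/-- The weight 3^-(j+1) cancels √3^(2j+2). After multiplication by sin²θ the sum telescopes to
squares of sines, bounded independently of m; away from the end points sin²θ is bounded below. -/
theorem abs_eval_evenPoly_le (m : ℕ) {t ρ : ℝ} (hρ : ρ < 2 * √3) (ht : |t| ≤ ρ) :
    |(evenPoly m).eval t| ≤ 2 / (1 - ρ ^ 2 / 12) := by
  have h3 : √3 ^ 2 = 3 := Real.sq_sqrt (by norm_num)
  obtain ⟨θ, hθ, hsin⟩ := exists_eq_two_sqrt_three_mul_cos (ht.trans hρ.le)
  have hρ0 : 0 ≤ ρ := (abs_nonneg _).trans ht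
  have hρ2 : 0 < 1 - ρ ^ 2 / 12 := by nlinarith
  have htρ : 1 - ρ ^ 2 / 12 ≤ Real.sin θ ^ 2 := by
    rw [hsin]
    have := sq_le_sq' (abs_le.1 ht).1 (abs_le.1 ht).2
    linarith
  have key : (evenPoly m).eval t * Real.sin θ ^ 2 =
      Real.sin ((m + 1 : ℕ) * θ) ^ 2 - Real.sin θ ^ 2 - Real.sin (m * θ) ^ 2 / 3 := by
    rw [← sin_mul_sum_sin, ← sin_mul_sum_sin, Finset.sum_range_succ', sq (Real.sin θ), evenPoly,
      Polynomial.eval_finsetSum, Finset.sum_mul, mul_add, Finset.mul_sum, Finset.mul_sum]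
    have : ∀ j ∈ Finset.range m,
        (Polynomial.C ((3 : ℝ)⁻¹ ^ (j + 1)) * spherePoly (2 * j + 2)).eval t *
          (Real.sin θ * Real.sin θ) =
        Real.sin θ * Real.sin ((2 * (j + 1 : ℕ) + 1) * θ) -
          Real.sin θ * Real.sin ((2 * j + 1) * θ) / 3 := by
      intro j _
      have h := eval_spherePoly_mul_sin θ (2 * j + 1)
      rw [← hθ] at h
      rw [Polynomial.eval_mul, Polynomial.eval_C]
      have e : √3 ^ (2 * j + 1 + 1) = 3 ^ (j + 1) := by
        rw [show 2 * j + 1 + 1 = 2 * (j + 1) by ring, pow_mul, h3]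
      rw [e] at h
      have e1 : ((2 * j + 1 : ℕ) : ℝ) + 2 = 2 * (j + 1 : ℕ) + 1 := by push_cast; ring
      rw [e1] at h
      push_cast at h ⊢
      have e2 : (3 : ℝ)⁻¹ ^ (j + 1) * 3 ^ (j + 1) = 1 := by
        rw [← mul_pow]; norm_num
      linear_combination (3 : ℝ)⁻¹ ^ (j + 1) * Real.sin θ * h + (Real.sin θ *
        (Real.sin ((2 * (j + 1) + 1) * θ) - Real.sin ((2 * j + 1) * θ) / 3)) * e2
    rw [Finset.sum_congr rfl this, Finset.sum_sub_distrib, Finset.sum_div]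
    simp
  rw [le_div_iff₀ hρ2]
  calc |(evenPoly m).eval t| * (1 - ρ ^ 2 / 12)
      ≤ |(evenPoly m).eval t| * Real.sin θ ^ 2 := by gcongr
    _ = |(evenPoly m).eval t * Real.sin θ ^ 2| := by rw [abs_mul, abs_of_nonneg (sq_nonneg (Real.sin θ))]
    _ ≤ 2 := by
      rw [key, abs_le]
      have a1 := Real.sin_sq_le_one ((m + 1 : ℕ) * θ)
      have a2 := Real.sin_sq_le_one θ
      have a3 := Real.sin_sq_le_one (m * θ)
      have b1 := sq_nonneg (Real.sin ((m + 1 : ℕ) * θ))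
      have b2 := sq_nonneg (Real.sin θ)
      have b3 := sq_nonneg (Real.sin (m * θ))
      constructor <;> linarith

theorem norm_aeval_le_of_forall {A : Type*} [CStarAlgebra A] {T : A} (hT : IsSelfAdjoint T)
    (p : Polynomial ℝ) {c : ℝ} (hc : 0 ≤ c) (h : ∀ t : ℝ, |t| ≤ ‖T‖ → |p.eval t| ≤ c) :
    ‖Polynomial.aeval T p‖ ≤ c := by
  rcases subsingleton_or_nontrivial A with hA | hA
  · rw [Subsingleton.elim (Polynomial.aeval T p) 0, norm_zero]; exact hc
  rw [← cfc_polynomial p T]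
  refine norm_cfc_le hc fun x hx => ?_
  exact h x (by simpa using spectrum.norm_le_norm_of_mem hx)

/-! ### Consequences for a functional that is nonnegative on the group -/

section Functional

variable {A : Type*} [CStarAlgebra A] (π : FreeGroup (Fin 2) →* A)
  (hπ : ∀ g, star (π g) = π g⁻¹)

include hπ in
theorem isSelfAdjoint_sphereSum_one : IsSelfAdjoint (sphereSum π 1) := by
  rw [IsSelfAdjoint, sphereSum_succ, star_sum]
  simp only [coneSum_zero, hπ, FreeGroup.inv_mk]
  have hinv : Function.Involutive invLetter := invLetter_invLetter
  refine (Finset.sum_congr rfl fun s _ => ?_).trans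
    (Equiv.sum_comp hinv.toPerm fun s => π (FreeGroup.mk [s]))
  simp [FreeGroup.invRev, invLetter, Function.Involutive.toPerm]

variable (Φ : A →L[ℂ] ℂ) (f : FreeGroup (Fin 2) → ℝ) (hf : ∀ g, 0 ≤ f g)
  (hΦ : ∀ g, Φ (π g) = f g)

include hπ hf hΦ in
theorem sum_sphere_le_of_norm_le (hT : ‖sphereSum π 1‖ ≤ 2 * √3) (n : ℕ) :
    ∑ L ∈ sphere n, f (FreeGroup.mk L) ≤ ‖Φ‖ * (2 * (n + 1) * √3 ^ n) := by
  have h1 : ‖sphereSum π n‖ ≤ 2 * (n + 1) * √3 ^ n := by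
    rw [← aeval_spherePoly π n]
    exact norm_aeval_le_of_forall (isSelfAdjoint_sphereSum_one π hπ) _ (by positivity)
      fun t ht => abs_eval_spherePoly_le n (ht.trans hT)
  have h2 : Φ (sphereSum π n) = ((∑ L ∈ sphere n, f (FreeGroup.mk L) : ℝ) : ℂ) := by
    rw [sphereSum, map_sum]; simp [hΦ]
  have h3 : ‖Φ (sphereSum π n)‖ = ∑ L ∈ sphere n, f (FreeGroup.mk L) := by
    rw [h2, Complex.norm_real, Real.norm_of_nonneg (Finset.sum_nonneg fun _ _ => hf _)]
  rw [← h3]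
  exact (Φ.le_opNorm _).trans (by gcongr)

theorem invRev_mem_sphere {n : ℕ} {L : List Letter} (h : L ∈ sphere n) :
    FreeGroup.invRev L ∈ sphere n := by
  rw [mem_sphere] at h ⊢
  refine ⟨?_, by simpa using h.2⟩
  rw [FreeGroup.isReduced_iff_reduce_eq, FreeGroup.reduce_invRev, h.1.reduce_eq]

include hπ hf hΦ in
theorem two_sqrt_three_le_norm (h1 : f 1 = 1) : 2 * √3 ≤ ‖sphereSum π 1‖ := by
  by_contra! hlt
  set T := sphereSum π 1
  set C := 2 / (1 - ‖T‖ ^ 2 / 12)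
  have h3 : √3 ^ 2 = 3 := Real.sq_sqrt (by norm_num)
  have hC : 0 ≤ C := by
    have : 0 < 1 - ‖T‖ ^ 2 / 12 := by nlinarith [norm_nonneg T]
    positivity
  -- The bound C on ‖Y‖ does not depend on m, so m may be chosen after it.
  obtain ⟨m, hm⟩ := exists_nat_gt (‖Φ‖ * (C * C))
  set Y := Polynomial.aeval T (evenPoly m)
  have hY : ‖Y‖ ≤ C := norm_aeval_le_of_forall (isSelfAdjoint_sphereSum_one π hπ) _ hC
    fun t ht => abs_eval_evenPoly_le m hlt ht
  have hYeq : Y = ∑ j ∈ Finset.range m, ∑ L ∈ sphere (2 * j + 2),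
      ((3 : ℝ)⁻¹ ^ (j + 1)) • π (FreeGroup.mk L) := by
    simp only [Y, evenPoly, map_sum, map_mul, Polynomial.aeval_C, T, aeval_spherePoly]
    refine Finset.sum_congr rfl fun j _ => ?_
    rw [← Algebra.smul_def, sphereSum, Finset.smul_sum]
  set F : ℝ := ∑ j ∈ Finset.range m, ∑ L ∈ sphere (2 * j + 2),
    ∑ k ∈ Finset.range m, ∑ L' ∈ sphere (2 * k + 2),
      (3 : ℝ)⁻¹ ^ (j + 1) * (3 : ℝ)⁻¹ ^ (k + 1) * f (FreeGroup.mk L * FreeGroup.mk L')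
  have hΦY : Φ (Y * Y) = (F : ℂ) := by
    rw [hYeq]
    simp only [Finset.sum_mul]
    simp only [Finset.mul_sum, map_sum, F, Complex.ofReal_sum]
    refine Finset.sum_congr rfl fun j _ => Finset.sum_congr rfl fun L _ =>
      Finset.sum_congr rfl fun k _ => Finset.sum_congr rfl fun L' _ => ?_
    rw [smul_mul_smul_comm, ← map_mul]
    rw [← Complex.coe_smul, map_smul, hΦ]
    simp
  -- All terms of F are nonnegative, so it suffices to keep the pairs with L' = L⁻¹, where f = 1.
  -- Radius 2j+2 then contributes 4·3^(2j+1) / 9^(j+1) = 4/3 ≥ 1.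
  have hlow : (m : ℝ) ≤ F := by
    calc (m : ℝ) = ∑ j ∈ Finset.range m, (1 : ℝ) := by simp
      _ ≤ F := by
        refine Finset.sum_le_sum fun j hj => ?_
        calc (1 : ℝ) ≤ ∑ L ∈ sphere (2 * j + 2), (3 : ℝ)⁻¹ ^ (j + 1) * (3 : ℝ)⁻¹ ^ (j + 1) := by
              rw [Finset.sum_const, card_sphere_succ, nsmul_eq_mul, ← pow_add]
              push_cast
              have e : (3 : ℝ)⁻¹ ^ (j + 1 + (j + 1)) * 3 ^ (2 * j + 2) = 1 := by
                rw [show j + 1 + (j + 1) = 2 * j + 2 by ring, ← mul_pow]; norm_num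
              have e' : (3 : ℝ) ^ (2 * j + 2) = 3 * 3 ^ (2 * j + 1) := by ring
              rw [e'] at e
              linarith
          _ ≤ _ := by
              refine Finset.sum_le_sum fun L hL => ?_
              calc (3 : ℝ)⁻¹ ^ (j + 1) * (3 : ℝ)⁻¹ ^ (j + 1)
                  = (3 : ℝ)⁻¹ ^ (j + 1) * (3 : ℝ)⁻¹ ^ (j + 1) *
                    f (FreeGroup.mk L * FreeGroup.mk (FreeGroup.invRev L)) := by
                    rw [← FreeGroup.inv_mk, mul_inv_cancel, h1, mul_one]
                _ ≤ ∑ L' ∈ sphere (2 * j + 2), (3 : ℝ)⁻¹ ^ (j + 1) * (3 : ℝ)⁻¹ ^ (j + 1) *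
                    f (FreeGroup.mk L * FreeGroup.mk L') :=
                    Finset.single_le_sum (f := fun L' => (3 : ℝ)⁻¹ ^ (j + 1) *
                      (3 : ℝ)⁻¹ ^ (j + 1) * f (FreeGroup.mk L * FreeGroup.mk L'))
                      (fun L' _ => mul_nonneg (by positivity) (hf _)) (invRev_mem_sphere hL)
                _ ≤ _ :=
                    Finset.single_le_sum (f := fun k => ∑ L' ∈ sphere (2 * k + 2),
                      (3 : ℝ)⁻¹ ^ (j + 1) * (3 : ℝ)⁻¹ ^ (k + 1) *
                        f (FreeGroup.mk L * FreeGroup.mk L'))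
                      (fun k _ => Finset.sum_nonneg fun L' _ =>
                        mul_nonneg (by positivity) (hf _)) hj
  have hup : F ≤ ‖Φ‖ * (C * C) := by
    calc F ≤ ‖Φ (Y * Y)‖ := by rw [hΦY, Complex.norm_real]; exact le_abs_self F
      _ ≤ ‖Φ‖ * ‖Y * Y‖ := Φ.le_opNorm _
      _ ≤ ‖Φ‖ * (C * C) := by
        gcongr
        exact (norm_mul_le _ _).trans (by gcongr)
  linarith

end Functional

/-! ### Counting products of conjugates -/

theorem isReduced_append {L₁ L₂ : List Letter} :
    FreeGroup.IsReduced (L₁ ++ L₂) ↔ FreeGroup.IsReduced L₁ ∧ FreeGroup.IsReduced L₂ ∧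
      ∀ x ∈ L₁.getLast?, ∀ y ∈ L₂.head?, y ≠ invLetter x := by
  simp only [FreeGroup.IsReduced, List.isChain_append, reduced_step_iff]

theorem isReduced_invRev {L : List Letter} (h : FreeGroup.IsReduced L) :
    FreeGroup.IsReduced (FreeGroup.invRev L) := by
  rw [FreeGroup.isReduced_iff_reduce_eq, FreeGroup.reduce_invRev, h.reduce_eq]

theorem head?_invRev (L : List Letter) :
    (FreeGroup.invRev L).head? = L.getLast?.map invLetter := by
  simp [FreeGroup.invRev, List.head?_reverse]
  rfl

theorem getLast?_invRev (L : List Letter) :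
    (FreeGroup.invRev L).getLast? = L.head?.map invLetter := by
  simp [FreeGroup.invRev, List.getLast?_reverse]
  rfl

theorem card_words_prefix_le (p : List Letter) (hp : p ≠ []) (k : ℕ) (s : Letter)
    (hk : p.length ≤ k + 1) :
    ((words k s).filter (p <+: ·)).card ≤ 3 ^ (k + 1 - p.length) := by
  induction p generalizing k s with
  | nil => exact absurd rfl hp
  | cons a p ih =>
    rcases p with _ | ⟨b, p⟩
    · refine (Finset.card_filter_le _ _).trans ?_
      simp [card_words]
    · rcases k with _ | k
      · simp at hk
      · have hsub : (words (k + 1) s).filter ((a :: b :: p) <+: ·) ⊆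
            ((words k b).filter ((b :: p) <+: ·)).image (List.cons s) := by
          intro L hL
          rw [Finset.mem_filter] at hL
          obtain ⟨h1, h2⟩ := hL
          simp only [words, Finset.mem_biUnion, Finset.mem_filter, Finset.mem_image] at h1
          obtain ⟨t, -, L', hL', rfl⟩ := h1
          rw [List.cons_prefix_cons] at h2
          have hh := (mem_words.1 hL').2.2
          obtain ⟨h2, r, rfl⟩ := h2
          simp only [List.cons_append, List.head?_cons, Option.some.injEq] at hh
          subst hh
          exact Finset.mem_image_of_mem _ (Finset.mem_filter.2 ⟨hL', r, rfl⟩)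
        refine (Finset.card_le_card hsub).trans (Finset.card_image_le.trans ?_)
        refine (ih (by simp) k b (by simpa using hk)).trans ?_
        simp

/-- With a prescribed last letter, deleting that letter is injective. -/
theorem card_words_getLast?_le (k : ℕ) (s c : Letter) :
    ((words (k + 1) s).filter (·.getLast? = some c)).card ≤ 3 ^ k := by
  rw [← card_words k s]
  refine Finset.card_le_card_of_injOn List.dropLast ?_ ?_
  · intro L hL
    obtain ⟨h1, h2⟩ := Finset.mem_filter.1 hL
    obtain ⟨h3, h4, h5⟩ := mem_words.1 h1
    refine mem_words.2 ⟨h3.infix (List.dropLast_prefix L).isInfix, by simp [h4], ?_⟩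
    rcases L with _ | ⟨a, _ | ⟨b, L⟩⟩
    · simp at h4
    · simp at h4
    · simpa using h5
  · intro L hL L' hL' h
    have h2 := (Finset.mem_filter.1 hL).2
    have h2' := (Finset.mem_filter.1 hL').2
    rw [← List.dropLast_append_getLast? _ h2, ← List.dropLast_append_getLast? _ h2', h]

/-! ### Conjugators and unique decoding -/

section Count

variable (V : Finset (List Letter)) (D : ℕ)

/-- `h` has a proper prefix `h'`, of length divisible by `D`, such that `h' v (h')⁻¹` with `v ∈ V`
agrees with `h` as far as both are defined. -/
def HasConjPrefix (h : List Letter) : Prop :=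
  ∃ h' v t, v ∈ V ∧ h = h' ++ v ++ t ∧ D ∣ h'.length ∧ 0 < h'.length ∧ h'.length < h.length ∧
    t.take h'.length = (FreeGroup.invRev h').take t.length

variable {V D} in
/-- Unique decoding of a leading conjugate. -/
theorem conj_append_inj_aux {h h' v r r' : List Letter} (hv : v ∈ V) (hvD : v.length < D)
    (hh : ¬ HasConjPrefix V D h) (hD : D ∣ h.length) (hD' : D ∣ h'.length)
    (h0' : 0 < h'.length)
    (heq : h ++ v ++ FreeGroup.invRev h ++ r = h' ++ v ++ FreeGroup.invRev h' ++ r')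
    (hle : h'.length ≤ h.length) : h = h' ∧ r = r' := by
  have main : h = h' := by
    rcases hle.lt_or_eq with hlt | heq'
    · exfalso
      apply hh
      have h1 : h ++ (v ++ FreeGroup.invRev h ++ r) = h' ++ (v ++ FreeGroup.invRev h' ++ r') := by
        simpa using heq
      obtain ⟨t, rfl⟩ : h' <+: h := List.prefix_of_prefix_length_le
        (⟨_, rfl⟩ : h' <+: h' ++ (v ++ FreeGroup.invRev h' ++ r')) (h1 ▸ ⟨_, rfl⟩) hle
      rw [List.append_assoc, List.append_cancel_left_eq] at h1
      -- Lengths are multiples of D and v is shorter than D, so all of v fits inside h after h'.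
      -- What remains of h must then agree with the inverse of h', which is the excluded pattern.
      have htD : D ≤ t.length := by
        have : D ∣ t.length := by
          rw [List.length_append] at hD; exact (Nat.dvd_add_right hD').1 hD
        refine Nat.le_of_dvd ?_ this
        simpa using hlt
      have h1' : t ++ (v ++ FreeGroup.invRev (h' ++ t) ++ r) =
        v ++ (FreeGroup.invRev h' ++ r') := by simpa using h1
      obtain ⟨t', rfl⟩ : v <+: t := List.prefix_of_prefix_length_le
        (⟨_, rfl⟩ : v <+: v ++ (FreeGroup.invRev h' ++ r')) (h1' ▸ ⟨_, rfl⟩) (by omega)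
      rw [List.append_assoc, List.append_cancel_left_eq] at h1'
      refine ⟨h', v, t', hv, by simp, hD', h0', hlt, ?_⟩
      have h2 := congrArg (List.take (min t'.length h'.length)) h1'
      rw [List.take_append_of_le_length (min_le_left _ _),
        List.take_append_of_le_length (by simp)] at h2
      rcases le_total t'.length h'.length with h3 | h3
      · rw [min_eq_left h3] at h2
        rw [← h2, List.take_of_length_le h3, List.take_length]
      · rw [min_eq_right h3] at h2
        rw [h2, List.take_of_length_le (by simp), List.take_of_length_le (by simpa using h3)]
    · have h1 : h ++ (v ++ FreeGroup.invRev h ++ r) = h' ++ (v ++ FreeGroup.invRev h' ++ r') := by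
        simpa using heq
      exact (List.append_inj h1 heq'.symm).1
  subst main
  exact ⟨rfl, List.append_cancel_left heq⟩

variable {V D} in
theorem conj_append_inj {h h' v r r' : List Letter} (hv : v ∈ V) (hvD : v.length < D)
    (hh : ¬ HasConjPrefix V D h) (hh' : ¬ HasConjPrefix V D h')
    (hD : D ∣ h.length) (hD' : D ∣ h'.length) (h0 : 0 < h.length) (h0' : 0 < h'.length)
    (heq : h ++ v ++ FreeGroup.invRev h ++ r = h' ++ v ++ FreeGroup.invRev h' ++ r') :
    h = h' ∧ r = r' := by
  rcases le_total h'.length h.length with hle | hle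
  · exact conj_append_inj_aux hv hvD hh hD hD' h0' heq hle
  · have := conj_append_inj_aux hv hvD hh' hD' hD h0 heq.symm hle
    exact ⟨this.1.symm, this.2.symm⟩

open Classical in
theorem card_hasConjPrefix_le (hD : 0 < D) (J : ℕ) (s : Letter) :
    (((words (D * (J + 1) - 1) s).filter (HasConjPrefix V D)).card : ℝ) ≤
      V.card * 3 ^ (D * (J + 1) - 1) * (3 * (3 ^ D)⁻¹) := by
  set K := D * (J + 1) with hK
  have hK0 : 0 < K := by positivity
  -- A bad word is grouped by the length D·j of h', by v and by h'. These determine a long prefix of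
  -- it: h', v, and as much of the inverse of h' as fits.
  have hsub : (words (K - 1) s).filter (HasConjPrefix V D) ⊆
      (Finset.Icc 1 J).biUnion fun j => (V.filter (·.length ≤ K - D * j)).biUnion fun v =>
        (words (D * j - 1) s).biUnion fun h' => (words (K - 1) s).filter
          ((h' ++ v ++ (FreeGroup.invRev h').take (K - D * j - v.length)) <+: ·) := by
    intro L hL
    obtain ⟨h1, h', v, t, hv, rfl, ⟨j, hj⟩, h0, hlt, ht⟩ := Finset.mem_filter.1 hL
    obtain ⟨h2, h3, h4⟩ := mem_words.1 h1
    simp only [List.length_append] at h3 hlt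
    have hlen : D * j + v.length + t.length = K := by omega
    have hj0 : 0 < j := by
      rcases Nat.eq_zero_or_pos j with rfl | h
      · simp at hj; simp [hj] at h0
      · exact h
    have hjJ : j < J + 1 := by
      by_contra! hcon
      have : D * (J + 1) ≤ D * j := by gcongr
      omega
    have hDj : 0 < D * j := by positivity
    simp only [Finset.mem_biUnion, Finset.mem_filter, Finset.mem_Icc]
    refine ⟨j, ⟨hj0, by omega⟩, v, ⟨hv, by omega⟩, h', ?_, h1, ?_⟩
    · refine mem_words.2 ⟨h2.infix ⟨[], v ++ t, by simp⟩, by omega, ?_⟩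
      rw [← h4, List.append_assoc, List.head?_append_of_ne_nil]
      rintro rfl; simp at h0
    · have e : K - D * j - v.length = t.length := by omega
      rw [e, ← ht]
      exact ⟨t.drop h'.length, by simp [List.append_assoc]⟩
  have hcard : ∀ j ∈ Finset.Icc 1 J, ∀ v ∈ V.filter (·.length ≤ K - D * j),
      ((((words (D * j - 1) s).biUnion fun h' => (words (K - 1) s).filter
          ((h' ++ v ++ (FreeGroup.invRev h').take (K - D * j - v.length)) <+: ·)).card : ℕ) : ℝ) ≤
      3 ^ (K - 1) * ((3 ^ D)⁻¹ ^ j + (3 ^ D)⁻¹ ^ (J + 1 - j)) := by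
    intro j hj v hv
    rw [Finset.mem_Icc] at hj
    have hvl := (Finset.mem_filter.1 hv).2
    have hDj : 0 < D * j := Nat.mul_pos hD (by omega)
    have hKj : D * j + D * (J + 1 - j) = K := by
      rw [← Nat.mul_add, hK]; congr 1; omega
    have hbound : ((words (D * j - 1) s).biUnion fun h' => (words (K - 1) s).filter
          ((h' ++ v ++ (FreeGroup.invRev h').take (K - D * j - v.length)) <+: ·)).card ≤
        3 ^ (D * j - 1) * 3 ^ (K - (D * j + v.length + min (K - D * j - v.length) (D * j))) := by
      refine Finset.card_biUnion_le.trans ?_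
      rw [← card_words (D * j - 1) s]
      refine (Finset.sum_le_card_nsmul _ _ _ fun h' hh' => ?_).trans_eq (smul_eq_mul _ _)
      have hl : h'.length = D * j := by have := (mem_words.1 hh').2.1; omega
      have hl2 : (h' ++ v ++ (FreeGroup.invRev h').take (K - D * j - v.length)).length =
          D * j + v.length + min (K - D * j - v.length) (D * j) := by
        simp [hl]; ring
      have := card_words_prefix_le
        (h' ++ v ++ (FreeGroup.invRev h').take (K - D * j - v.length))
        (by intro h; rw [h] at hl2; simp at hl2; omega) (K - 1) s (by omega)
      rw [hl2, Nat.sub_add_cancel hK0] at this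
      exact this
    -- Besides v, the inverse of h' fixes D·j further letters, or all remaining ones if these are
    -- fewer. In either case at least min(D·j, K - D·j) letters are lost.
    have hb2 : 3 ^ (D * j - 1) * 3 ^ (K - (D * j + v.length + min (K - D * j - v.length) (D * j)))
        ≤ 3 ^ (K - 1 - min (D * j) (D * (J + 1 - j))) := by
      rw [← pow_add]
      exact Nat.pow_le_pow_right (by norm_num) (by omega)
    refine (Nat.cast_le.2 (hbound.trans hb2)).trans ?_
    push_cast
    have hpow : ∀ i, D * i ≤ K - 1 → (3 : ℝ) ^ (K - 1 - D * i) = 3 ^ (K - 1) * (3 ^ D)⁻¹ ^ i := by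
      intro i hi
      rw [pow_sub₀ _ (by norm_num) hi, inv_pow, pow_mul]
    rw [mul_add]
    have hp : (0 : ℝ) < 3 ^ (K - 1) := by positivity
    have hq : (0 : ℝ) < (3 ^ D)⁻¹ := by positivity
    have hD1 : 0 < D * (J + 1 - j) := Nat.mul_pos hD (by omega)
    rcases le_total (D * j) (D * (J + 1 - j)) with h | h
    · rw [min_eq_left h, hpow _ (by omega)]
      exact le_add_of_nonneg_right (by positivity)
    · rw [min_eq_right h, hpow _ (by omega)]
      exact le_add_of_nonneg_left (by positivity)
  set x : ℝ := (3 ^ D)⁻¹ with hx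
  have hx0 : 0 < x := by positivity
  have hx3 : x ≤ 1 / 3 := by
    rw [hx, ← one_div]
    refine one_div_le_one_div_of_le (by norm_num) ?_
    calc (3 : ℝ) = 3 ^ 1 := by norm_num
      _ ≤ 3 ^ D := pow_le_pow_right₀ (by norm_num) hD
  -- Since x ≤ 1/3, the geometric factor 1/(1 - x) is at most 3/2.
  have hgeo : ∑ j ∈ Finset.Icc 1 J, x ^ j ≤ 3 / 2 * x := by
    rw [show Finset.Icc 1 J = Finset.Ico 1 (J + 1) by ext; simp,
      Finset.sum_Ico_eq_sum_range]
    have : ∑ i ∈ Finset.range (J + 1 - 1), x ^ (1 + i) =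
        x * ∑ i ∈ Finset.range (J + 1 - 1), x ^ i := by
      rw [Finset.mul_sum]; exact Finset.sum_congr rfl fun i _ => by rw [pow_add, pow_one]
    rw [this, mul_comm]
    gcongr
    have h1 := geom_sum_eq (x := x) (by linarith) (J + 1 - 1)
    rw [h1, div_le_iff_of_neg (by linarith)]
    have : 0 ≤ x ^ (J + 1 - 1) := by positivity
    linarith
  have hgeo' : ∑ j ∈ Finset.Icc 1 J, x ^ (J + 1 - j) ≤ 3 / 2 * x := by
    refine le_of_eq_of_le ?_ hgeo
    refine Finset.sum_bij' (fun j _ => J + 1 - j) (fun j _ => J + 1 - j) ?_ ?_ ?_ ?_ ?_ <;>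
      simp only [Finset.mem_Icc] <;> intros <;> first | omega | rfl | trivial
  calc (((words (K - 1) s).filter (HasConjPrefix V D)).card : ℝ)
      ≤ ∑ j ∈ Finset.Icc 1 J, ∑ v ∈ V.filter (·.length ≤ K - D * j),
          3 ^ (K - 1) * (x ^ j + x ^ (J + 1 - j)) := by
        refine (Nat.cast_le.2 (Finset.card_le_card hsub)).trans ?_
        refine (Nat.cast_le.2 Finset.card_biUnion_le).trans ?_
        push_cast
        refine Finset.sum_le_sum fun j hj => ?_
        refine (Nat.cast_le.2 Finset.card_biUnion_le).trans ?_
        push_cast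
        exact Finset.sum_le_sum fun v hv => hcard j hj v hv
    _ ≤ ∑ j ∈ Finset.Icc 1 J, V.card * (3 ^ (K - 1) * (x ^ j + x ^ (J + 1 - j))) := by
        refine Finset.sum_le_sum fun j hj => ?_
        rw [Finset.sum_const, nsmul_eq_mul]
        gcongr
        exact Finset.filter_subset _ _
    _ = V.card * 3 ^ (K - 1) * (∑ j ∈ Finset.Icc 1 J, x ^ j +
          ∑ j ∈ Finset.Icc 1 J, x ^ (J + 1 - j)) := by
        rw [← Finset.sum_add_distrib, Finset.mul_sum]
        exact Finset.sum_congr rfl fun j _ => by ring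
    _ ≤ V.card * 3 ^ (K - 1) * (3 * x) := by
        gcongr
        linarith

open Classical in
/-- The reduced words of length `D * j` with first letter `s`, not ending in `(1, false)`, which can
be used as conjugators. -/
def conjugators (j : ℕ) (s : Letter) : Finset (List Letter) :=
  (words (D * j - 1) s).filter fun h => ¬ HasConjPrefix V D h ∧ h.getLast? ≠ some (1, false)

/-- The words of the excluded pattern make up at most 1/6 of all, by the choice of D, and those
ending in the forbidden letter at most 1/3. -/
theorem half_le_card_conjugators (hD : 2 ≤ D) (hV : 18 * V.card ≤ 3 ^ D) (J : ℕ) (s : Letter) :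
    (3 : ℝ) ^ (D * (J + 1) - 1) / 2 ≤ ((conjugators V D (J + 1) s).card : ℝ) := by
  classical
  set K := D * (J + 1) with hK
  have hK2 : 2 ≤ K := by rw [hK]; nlinarith
  have h1 := card_hasConjPrefix_le V D (by omega) J s
  rw [← hK] at h1
  have h2 := card_words_getLast?_le (K - 2) s (1, false)
  rw [show K - 2 + 1 = K - 1 by omega] at h2
  have hsub : words (K - 1) s ⊆ conjugators V D (J + 1) s ∪
      ((words (K - 1) s).filter (HasConjPrefix V D) ∪
        (words (K - 1) s).filter (·.getLast? = some (1, false))) := by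
    intro L hL
    simp only [conjugators, Finset.mem_union, Finset.mem_filter, ← hK, hL, true_and]
    tauto
  have h3 := (Finset.card_le_card hsub).trans ((Finset.card_union_le _ _).trans
    (Nat.add_le_add_left (Finset.card_union_le _ _) _))
  rw [card_words] at h3
  have h3' : (3 : ℝ) ^ (K - 1) ≤ (conjugators V D (J + 1) s).card +
      (((words (K - 1) s).filter (HasConjPrefix V D)).card +
        ((words (K - 1) s).filter (·.getLast? = some (1, false))).card) := by exact_mod_cast h3
  have h2' : (((words (K - 1) s).filter (·.getLast? = some (1, false))).card : ℝ) ≤ 3 ^ (K - 2) := by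
    exact_mod_cast h2
  have hpow : (3 : ℝ) ^ (K - 1) = 3 * 3 ^ (K - 2) := by
    rw [← pow_succ']; congr 1; omega
  have hV' : (18 * V.card : ℝ) * (3 ^ D)⁻¹ ≤ 1 := by
    rw [← div_eq_mul_inv, div_le_one (by positivity)]; exact_mod_cast hV
  have h4 : V.card * 3 ^ (K - 1) * (3 * (3 ^ D)⁻¹) ≤ (3 : ℝ) ^ (K - 1) / 6 := by
    have hp : (0 : ℝ) < 3 ^ (K - 1) := by positivity
    nlinarith
  linarith

end Count

/-! ### Products of four conjugates -/

section Growth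

/-- The word `h v h⁻¹`. -/
def conjWord (h v : List Letter) : List Letter := h ++ v ++ FreeGroup.invRev h

theorem mk_conjWord (h v : List Letter) : FreeGroup.mk (conjWord h v) =
    FreeGroup.mk h * FreeGroup.mk v * (FreeGroup.mk h)⁻¹ := by
  rw [conjWord, FreeGroup.inv_mk, FreeGroup.mul_mk, FreeGroup.mul_mk]

theorem length_conjWord (h v : List Letter) :
    (conjWord h v).length = 2 * h.length + v.length := by
  simp [conjWord]; ring

/-- A reduced word with first letter `(1, true)` and last letter `(1, false)`. -/
def IsBracket (v : List Letter) : Prop :=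
  FreeGroup.IsReduced v ∧ v.head? = some (1, true) ∧ v.getLast? = some (1, false)

variable {V : Finset (List Letter)} {D : ℕ}

/-- One forbidden last letter of h serves both junctions: the first letter of v is the inverse of
its last letter, so a cancellation at either end of v would require h to end in `(1, false)`. -/
theorem isReduced_conjWord {h v : List Letter} (hv : IsBracket v)
    (hh : FreeGroup.IsReduced h) (hl : h.getLast? ≠ some (1, false)) :
    FreeGroup.IsReduced (conjWord h v) := by
  obtain ⟨h1, h2, h3⟩ := hv
  have hv0 : v ≠ [] := by rintro rfl; simp at h2
  refine isReduced_append.2 ⟨isReduced_append.2 ⟨hh, h1, ?_⟩, isReduced_invRev hh, ?_⟩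
  · intro x hx y hy hxy
    rw [h2, Option.mem_def, Option.some.injEq] at hy
    subst hy
    rw [Option.mem_def] at hx
    apply hl
    rw [hx, ← invLetter_invLetter x, ← hxy]
    rfl
  · intro x hx y hy hxy
    rw [List.getLast?_append_of_ne_nil _ hv0, h3, Option.mem_def, Option.some.injEq] at hx
    rw [head?_invRev] at hy
    subst hx
    rcases hg : h.getLast? with _ | c
    · simp [hg] at hy
    · rw [hg] at hy
      simp only [Option.map_some, Option.mem_def, Option.some.injEq] at hy
      apply hl
      rw [hg, ← invLetter_invLetter c, hy, hxy, invLetter_invLetter]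

theorem mem_conjugators {j : ℕ} (hDj : 0 < D * j) {s : Letter} {h : List Letter}
    (hh : h ∈ conjugators V D j s) :
    FreeGroup.IsReduced h ∧ h.length = D * j ∧ h.head? = some s ∧ ¬ HasConjPrefix V D h ∧
      h.getLast? ≠ some (1, false) := by
  classical
  rw [conjugators, Finset.mem_filter, mem_words] at hh
  obtain ⟨⟨h1, h2, h3⟩, h4, h5⟩ := hh
  exact ⟨h1, by omega, h3, h4, h5⟩

theorem head?_conjWord {h v : List Letter} {s : Letter} (hs : h.head? = some s) :
    (conjWord h v).head? = some s := by
  rcases h with _ | ⟨a, h⟩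
  · simp at hs
  · simpa [conjWord] using hs

theorem getLast?_conjWord {h v : List Letter} {s : Letter} (hs : h.head? = some s) :
    (conjWord h v).getLast? = some (invLetter s) := by
  have h0 : FreeGroup.invRev h ≠ [] := by
    rcases h with _ | ⟨a, h⟩
    · simp at hs
    · simp [FreeGroup.invRev]
  rw [conjWord, List.getLast?_append_of_ne_nil _ h0, getLast?_invRev, hs]
  rfl

theorem isReduced_conjWord_append {h v w : List Letter} {s t : Letter}
    (h1 : FreeGroup.IsReduced (conjWord h v)) (h2 : FreeGroup.IsReduced w)
    (hs : h.head? = some s) (ht : w.head? = some t) (hst : t ≠ s) :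
    FreeGroup.IsReduced (conjWord h v ++ w) := by
  refine isReduced_append.2 ⟨h1, h2, fun x hx y hy => ?_⟩
  rw [getLast?_conjWord hs, Option.mem_def, Option.some.injEq] at hx
  rw [ht, Option.mem_def, Option.some.injEq] at hy
  subst hx hy
  rwa [invLetter_invLetter]

/-- The product of four conjugates, as a word. -/
def fourConj (h₁ h₂ h₃ h₄ v₁ v₂ v₃ v₄ : List Letter) : List Letter :=
  conjWord h₁ v₁ ++ (conjWord h₂ v₂ ++ (conjWord h₃ v₃ ++ conjWord h₄ v₄))

/-- The constant 1/6 is the density 1/2 of conjugators times 1/3, because 3^(D(j+1)) is three times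
the number of words with a given first letter. -/
theorem sum_conjugators_ge (hD : 2 ≤ D) (hV : 18 * V.card ≤ 3 ^ D) (N : ℕ) (s : Letter) :
    (N / 6 : ℝ) ≤ ∑ j ∈ Finset.range N, ((conjugators V D (j + 1) s).card : ℝ) *
      (3 ^ (D * (j + 1)))⁻¹ := by
  calc (N / 6 : ℝ) = ∑ j ∈ Finset.range N, (1 / 6 : ℝ) := by simp; ring
    _ ≤ _ := by
      refine Finset.sum_le_sum fun j _ => ?_
      have h := half_le_card_conjugators V D hD hV j s
      have hK : 0 < D * (j + 1) := by positivity
      have hp : (3 : ℝ) ^ (D * (j + 1)) = 3 * 3 ^ (D * (j + 1) - 1) := by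
        rw [← pow_succ', Nat.sub_add_cancel hK]
      rw [← div_eq_mul_inv, le_div_iff₀ (by positivity), hp]
      linarith

/-- The set of quadruples of conjugators of total length `4 D N`. -/
def quadruples (V : Finset (List Letter)) (D N : ℕ) :
    Finset ((_ : ℕ × ℕ × ℕ) × List Letter × List Letter × List Letter × List Letter) :=
  (Finset.range N ×ˢ Finset.range N ×ˢ Finset.range N).sigma fun j =>
    conjugators V D (j.1 + 1) (0, true) ×ˢ conjugators V D (j.2.1 + 1) (1, true) ×ˢ
      conjugators V D (j.2.2 + 1) (0, true) ×ˢ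
      conjugators V D (4 * N - (j.1 + 1) - (j.2.1 + 1) - (j.2.2 + 1)) (1, true)

theorem sum_mul_sum_mul_sum (s : Finset ℕ) (a b : ℕ → ℝ) (c : ℝ) :
    (∑ j ∈ s, a j) * ((∑ j ∈ s, b j) * ∑ j ∈ s, a j) * c =
      ∑ j₁ ∈ s, ∑ j₂ ∈ s, ∑ j₃ ∈ s, a j₁ * (b j₂ * a j₃) * c := by
  simp only [← Finset.sum_mul, ← Finset.mul_sum]

/-- Each of the three free lengths contributes a factor N/6. The fourth length is forced by the
total 4DN and contributes only a density 1/6. The surplus N³ is what eventually contradicts the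
linear factor in the spherical bound. -/
theorem card_quadruples_ge (hD : 2 ≤ D) (hV : 18 * V.card ≤ 3 ^ D) (N : ℕ) :
    (N / 6 : ℝ) ^ 3 * (3 ^ (4 * D * N) / 6) ≤ ((quadruples V D N).card : ℝ) := by
  have h4 : ∀ j₁ ∈ Finset.range N, ∀ j₂ ∈ Finset.range N, ∀ j₃ ∈ Finset.range N,
      (3 : ℝ) ^ (4 * D * N) / 6 * ((3 ^ (D * (j₁ + 1)))⁻¹ * (3 ^ (D * (j₂ + 1)))⁻¹ *
        (3 ^ (D * (j₃ + 1)))⁻¹) ≤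
      (conjugators V D (4 * N - (j₁ + 1) - (j₂ + 1) - (j₃ + 1)) (1, true)).card := by
    intro j₁ h₁ j₂ h₂ j₃ h₃
    rw [Finset.mem_range] at h₁ h₂ h₃
    -- The three free lengths are at most N each, so the fourth is at least N, in particular
    -- positive.
    obtain ⟨i, hi⟩ : ∃ i, 4 * N - (j₁ + 1) - (j₂ + 1) - (j₃ + 1) = i + 1 :=
      ⟨4 * N - (j₁ + 1) - (j₂ + 1) - (j₃ + 1) - 1, by omega⟩
    rw [hi]
    refine le_trans (le_of_eq ?_) (half_le_card_conjugators V D hD hV i (1, true))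
    have hK : 0 < D * (i + 1) := by positivity
    have hp : (3 : ℝ) ^ (D * (i + 1)) = 3 * 3 ^ (D * (i + 1) - 1) := by
      rw [← pow_succ', Nat.sub_add_cancel hK]
    have hsum : 4 * D * N = D * (i + 1) + D * (j₁ + 1) + D * (j₂ + 1) + D * (j₃ + 1) := by
      rw [← Nat.mul_add, ← Nat.mul_add, ← Nat.mul_add, mul_comm 4 D, mul_assoc]
      congr 1; omega
    rw [hsum, pow_add, pow_add, pow_add, hp]
    field_simp
    norm_num
  have key : (quadruples V D N).card = ∑ j₁ ∈ Finset.range N, ∑ j₂ ∈ Finset.range N,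
      ∑ j₃ ∈ Finset.range N, ((conjugators V D (j₁ + 1) (0, true)).card *
        ((conjugators V D (j₂ + 1) (1, true)).card * ((conjugators V D (j₃ + 1) (0, true)).card *
          (conjugators V D (4 * N - (j₁ + 1) - (j₂ + 1) - (j₃ + 1)) (1, true)).card))) := by
    rw [quadruples, Finset.card_sigma, Finset.sum_product]
    refine Finset.sum_congr rfl fun j₁ _ => ?_
    rw [Finset.sum_product]
    refine Finset.sum_congr rfl fun j₂ _ => Finset.sum_congr rfl fun j₃ _ => ?_
    simp only [Finset.card_product]
  rw [key]
  push_cast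
  have ha := sum_conjugators_ge hD hV N (0, true)
  have hb := sum_conjugators_ge hD hV N (1, true)
  set a : ℕ → ℝ := fun j => ((conjugators V D (j + 1) (0, true)).card : ℝ) *
      (3 ^ (D * (j + 1)))⁻¹ with ha'
  set b : ℕ → ℝ := fun j => ((conjugators V D (j + 1) (1, true)).card : ℝ) *
      (3 ^ (D * (j + 1)))⁻¹ with hb'
  calc (N / 6 : ℝ) ^ 3 * (3 ^ (4 * D * N) / 6)
      = ((N / 6) * ((N / 6) * (N / 6))) * (3 ^ (4 * D * N) / 6) := by ring
    _ ≤ ((∑ j ∈ Finset.range N, a j) * ((∑ j ∈ Finset.range N, b j) *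
          (∑ j ∈ Finset.range N, a j))) * (3 ^ (4 * D * N) / 6) := by
        have h0 : (0 : ℝ) ≤ N / 6 := by positivity
        exact mul_le_mul_of_nonneg_right (mul_le_mul ha (mul_le_mul hb ha h0 (h0.trans hb))
          (mul_nonneg h0 h0) (h0.trans ha)) (by positivity)
    _ = ∑ j₁ ∈ Finset.range N, ∑ j₂ ∈ Finset.range N, ∑ j₃ ∈ Finset.range N,
          a j₁ * (b j₂ * a j₃) * (3 ^ (4 * D * N) / 6) := by
        exact sum_mul_sum_mul_sum _ _ _ _
    _ ≤ _ := by
        refine Finset.sum_le_sum fun j₁ h₁ => Finset.sum_le_sum fun j₂ h₂ =>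
          Finset.sum_le_sum fun j₃ h₃ => ?_
        have := h4 j₁ h₁ j₂ h₂ j₃ h₃
        calc a j₁ * (b j₂ * a j₃) * (3 ^ (4 * D * N) / 6)
            = ((conjugators V D (j₁ + 1) (0, true)).card *
              ((conjugators V D (j₂ + 1) (1, true)).card *
                ((conjugators V D (j₃ + 1) (0, true)).card : ℝ))) *
              ((3 : ℝ) ^ (4 * D * N) / 6 * ((3 ^ (D * (j₁ + 1)))⁻¹ * (3 ^ (D * (j₂ + 1)))⁻¹ *
        (3 ^ (D * (j₃ + 1)))⁻¹)) := by simp only [ha', hb']; ring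
          _ ≤ _ := by
            refine (mul_le_mul_of_nonneg_left this (by positivity)).trans (le_of_eq ?_)
            ring

theorem mem_quadruples {N : ℕ} {j : ℕ × ℕ × ℕ} {h₁ h₂ h₃ h₄ : List Letter}
    (hx : ⟨j, h₁, h₂, h₃, h₄⟩ ∈ quadruples V D N) :
    (j.1 < N ∧ j.2.1 < N ∧ j.2.2 < N) ∧ h₁ ∈ conjugators V D (j.1 + 1) (0, true) ∧
      h₂ ∈ conjugators V D (j.2.1 + 1) (1, true) ∧ h₃ ∈ conjugators V D (j.2.2 + 1) (0, true) ∧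
      h₄ ∈ conjugators V D (4 * N - (j.1 + 1) - (j.2.1 + 1) - (j.2.2 + 1)) (1, true) := by
  simpa [quadruples] using hx

/-- A conjugate by a word starting with s starts with s and ends with s⁻¹. The conjugators start
alternately with `(0, true)` and `(1, true)`, so nothing cancels between consecutive conjugates. -/
theorem fourConj_mem_sphere {N : ℕ} (hD : 0 < D) {j : ℕ × ℕ × ℕ} {h₁ h₂ h₃ h₄ : List Letter}
    (hx : ⟨j, h₁, h₂, h₃, h₄⟩ ∈ quadruples V D N) {v₁ v₂ v₃ v₄ : List Letter}
    (hv₁ : IsBracket v₁) (hv₂ : IsBracket v₂) (hv₃ : IsBracket v₃) (hv₄ : IsBracket v₄) :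
    fourConj h₁ h₂ h₃ h₄ v₁ v₂ v₃ v₄ ∈
      sphere (8 * D * N + (v₁.length + v₂.length + v₃.length + v₄.length)) := by
  obtain ⟨⟨j₁, j₂, j₃⟩, k₁, k₂, k₃, k₄⟩ := mem_quadruples hx
  have d₁ := mem_conjugators (by positivity) k₁
  have d₂ := mem_conjugators (by positivity) k₂
  have d₃ := mem_conjugators (by positivity) k₃
  have d₄ := mem_conjugators (Nat.mul_pos hD (by omega)) k₄
  have r₁ := isReduced_conjWord hv₁ d₁.1 d₁.2.2.2.2
  have r₂ := isReduced_conjWord hv₂ d₂.1 d₂.2.2.2.2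
  have r₃ := isReduced_conjWord hv₃ d₃.1 d₃.2.2.2.2
  have r₄ := isReduced_conjWord hv₄ d₄.1 d₄.2.2.2.2
  have e₃ := head?_conjWord (v := v₃) d₃.2.2.1
  have e₂ := head?_conjWord (v := v₂) d₂.2.2.1
  refine mem_sphere.2 ⟨?_, ?_⟩
  · refine isReduced_conjWord_append (t := (1, true)) r₁ (isReduced_conjWord_append
      (t := (0, true)) r₂ (isReduced_conjWord_append (t := (1, true)) r₃ r₄ d₃.2.2.1
        (head?_conjWord d₄.2.2.1) (by decide)) d₂.2.2.1 ?_ (by decide)) d₁.2.2.1 ?_ (by decide)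
    · rw [List.head?_append, e₃]; rfl
    · rw [List.head?_append, e₂]; rfl
  · simp only [fourConj, List.length_append, length_conjWord, d₁.2.1, d₂.2.1, d₃.2.1, d₄.2.1]
    have : D * (j.1 + 1) + D * (j.2.1 + 1) + D * (j.2.2 + 1) +
        D * (4 * N - (j.1 + 1) - (j.2.1 + 1) - (j.2.2 + 1)) = 4 * (D * N) := by
      rw [← Nat.mul_add, ← Nat.mul_add, ← Nat.mul_add, mul_left_comm]
      congr 1; omega
    rw [mul_assoc 8]
    omega

/-- The leading conjugate is decoded three times. The last conjugator is then read off directly,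
since its length is determined by the others. -/
theorem fourConj_injOn {N : ℕ} (hD : 0 < D) (hVD : ∀ v ∈ V, v.length < D)
    {v₁ v₂ v₃ v₄ : List Letter} (hv₁ : v₁ ∈ V) (hv₂ : v₂ ∈ V) (hv₃ : v₃ ∈ V) :
    Set.InjOn (fun x : (_ : ℕ × ℕ × ℕ) × List Letter × List Letter × List Letter × List Letter =>
      fourConj x.2.1 x.2.2.1 x.2.2.2.1 x.2.2.2.2 v₁ v₂ v₃ v₄) (quadruples V D N) := by
  rintro ⟨⟨i₁, i₂, i₃⟩, h₁, h₂, h₃, h₄⟩ hx ⟨⟨i₁', i₂', i₃'⟩, h₁', h₂', h₃', h₄'⟩ hx' heq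
  obtain ⟨⟨j₁, j₂, j₃⟩, k₁, k₂, k₃, k₄⟩ := mem_quadruples hx
  obtain ⟨⟨j₁', j₂', j₃'⟩, k₁', k₂', k₃', k₄'⟩ := mem_quadruples hx'
  simp only at j₁ j₂ j₃ k₁ k₂ k₃ k₄ j₁' j₂' j₃' k₁' k₂' k₃' k₄' heq
  have d₁ := mem_conjugators (by positivity) k₁
  have d₂ := mem_conjugators (by positivity) k₂
  have d₃ := mem_conjugators (by positivity) k₃
  have d₄ := mem_conjugators (Nat.mul_pos hD (by omega)) k₄
  have d₁' := mem_conjugators (by positivity) k₁'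
  have d₂' := mem_conjugators (by positivity) k₂'
  have d₃' := mem_conjugators (by positivity) k₃'
  have d₄' := mem_conjugators (Nat.mul_pos hD (by omega)) k₄'
  have dec : ∀ {h h' v r r' : List Letter} {j j' : ℕ}, v ∈ V → ¬ HasConjPrefix V D h →
      ¬ HasConjPrefix V D h' → h.length = D * (j + 1) → h'.length = D * (j' + 1) →
      conjWord h v ++ r = conjWord h' v ++ r' → j = j' ∧ h = h' ∧ r = r' := by
    intro h h' v r r' j j' hv hh hh' hl hl' he
    have := conj_append_inj hv (hVD v hv) hh hh' ⟨_, hl⟩ ⟨_, hl'⟩ (by rw [hl]; positivity)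
      (by rw [hl']; positivity) he
    refine ⟨?_, this⟩
    have h3 : D * (j + 1) = D * (j' + 1) := by rw [← hl, ← hl', this.1]
    have := Nat.eq_of_mul_eq_mul_left hD h3
    omega
  obtain ⟨rfl, rfl, heq₂⟩ := dec hv₁ d₁.2.2.2.1 d₁'.2.2.2.1 d₁.2.1 d₁'.2.1 heq
  obtain ⟨rfl, rfl, heq₃⟩ := dec hv₂ d₂.2.2.2.1 d₂'.2.2.2.1 d₂.2.1 d₂'.2.1 heq₂
  obtain ⟨rfl, rfl, heq₄⟩ := dec hv₃ d₃.2.2.2.1 d₃'.2.2.2.1 d₃.2.1 d₃'.2.1 heq₃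
  have h5 : h₄ = h₄' := by
    have hl : h₄.length = h₄'.length := by rw [d₄.2.1, d₄'.2.1]
    rw [conjWord, conjWord, List.append_assoc, List.append_assoc] at heq₄
    exact (List.append_inj heq₄ hl).1
  subst h5
  rfl

theorem mk_fourConj (h₁ h₂ h₃ h₄ v₁ v₂ v₃ v₄ : List Letter) :
    FreeGroup.mk (fourConj h₁ h₂ h₃ h₄ v₁ v₂ v₃ v₄) =
      FreeGroup.mk h₁ * FreeGroup.mk v₁ * (FreeGroup.mk h₁)⁻¹ *
      (FreeGroup.mk h₂ * FreeGroup.mk v₂ * (FreeGroup.mk h₂)⁻¹) *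
      (FreeGroup.mk h₃ * FreeGroup.mk v₃ * (FreeGroup.mk h₃)⁻¹) *
      (FreeGroup.mk h₄ * FreeGroup.mk v₄ * (FreeGroup.mk h₄)⁻¹) := by
  rw [fourConj, ← FreeGroup.mul_mk, ← FreeGroup.mul_mk, ← FreeGroup.mul_mk]
  simp only [mk_conjWord, mul_assoc]

/-- A nonnegative function on the free group which does not vanish on products of four conjugates
of elements of a fixed finite set has spherical sums which are large. -/
theorem false_of_le_fourConj (hVb : ∀ v ∈ V, IsBracket v) (f : FreeGroup (Fin 2) → ℝ)
    (hf : ∀ g, 0 ≤ f g) {δ C : ℝ} (hδ : 0 < δ)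
    (H : ∀ h₁ h₂ h₃ h₄ : FreeGroup (Fin 2), ∃ v₁ ∈ V, ∃ v₂ ∈ V, ∃ v₃ ∈ V, ∃ v₄ ∈ V,
      δ ≤ f (h₁ * FreeGroup.mk v₁ * h₁⁻¹ * (h₂ * FreeGroup.mk v₂ * h₂⁻¹) *
        (h₃ * FreeGroup.mk v₃ * h₃⁻¹) * (h₄ * FreeGroup.mk v₄ * h₄⁻¹)))
    (hC : ∀ n : ℕ, ∑ L ∈ sphere n, f (FreeGroup.mk L) ≤ C * (2 * (n + 1) * √3 ^ n)) : False := by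
  have h3 : √3 ^ 2 = 3 := Real.sq_sqrt (by norm_num)
  have h31 : 1 ≤ √3 := Real.one_le_sqrt.2 (by norm_num)
  have hC0 : 0 ≤ C := by
    have := (Finset.sum_nonneg fun L _ => hf (FreeGroup.mk L)).trans (hC 0)
    simp at this; linarith
  set R := V.sup List.length with hR
  have hVR : ∀ v ∈ V, v.length ≤ R := fun v hv => Finset.le_sup (f := List.length) hv
  -- D exceeds the length of every v, as decoding requires, and 18·|V| ≤ D ≤ 3^D, as the density
  -- estimate requires.
  set D := max (R + 2) (18 * V.card) with hDdef
  have hD2 : 2 ≤ D := le_trans (by omega) (le_max_left _ _)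
  have hVD : ∀ v ∈ V, v.length < D := fun v hv =>
    lt_of_lt_of_le (by have := hVR v hv; omega) (le_max_left (R + 2) (18 * V.card))
  have hVc : 18 * V.card ≤ 3 ^ D :=
    (le_max_right (R + 2) (18 * V.card)).trans (Nat.lt_pow_self (by norm_num)).le
  set W : Finset (List Letter × List Letter × List Letter × List Letter) := V ×ˢ V ×ˢ V ×ˢ V
  set B : ℝ := W.card * (C * (2 * (8 * D + 4 * R + 1) * √3 ^ (4 * R))) with hB
  have hB0 : 0 ≤ B := by positivity
  -- The number of quadruples is at least N³·3^(4DN)/6⁴, and 6⁴ = 1296.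
  obtain ⟨N, hN⟩ := exists_nat_gt (max 1 (1296 * B / δ))
  have hN1 : (1 : ℝ) < N := (le_max_left _ _).trans_lt hN
  have hNB : 1296 * B / δ < N := (le_max_right _ _).trans_lt hN
  have hlow := card_quadruples_ge hD2 hVc N
  -- Each quadruple carries some choice of the v's with f ≥ δ. Summing over all choices and
  -- exchanging the sums leaves, for fixed v's, distinct words in a single sphere.
  have hup : ((quadruples V D N).card : ℝ) * δ ≤ B * N * 3 ^ (4 * D * N) := by
    calc ((quadruples V D N).card : ℝ) * δ = ∑ x ∈ quadruples V D N, δ := by simp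
      _ ≤ ∑ x ∈ quadruples V D N, ∑ v ∈ W, f (FreeGroup.mk
            (fourConj x.2.1 x.2.2.1 x.2.2.2.1 x.2.2.2.2 v.1 v.2.1 v.2.2.1 v.2.2.2)) := by
          refine Finset.sum_le_sum fun x _ => ?_
          obtain ⟨v₁, hv₁, v₂, hv₂, v₃, hv₃, v₄, hv₄, h⟩ := H (FreeGroup.mk x.2.1)
            (FreeGroup.mk x.2.2.1) (FreeGroup.mk x.2.2.2.1) (FreeGroup.mk x.2.2.2.2)
          rw [← mk_fourConj] at h
          refine h.trans (Finset.single_le_sum (f := fun v => f (FreeGroup.mk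
            (fourConj x.2.1 x.2.2.1 x.2.2.2.1 x.2.2.2.2 v.1 v.2.1 v.2.2.1 v.2.2.2)))
            (a := (v₁, v₂, v₃, v₄)) (fun _ _ => hf _) ?_)
          simp [W, hv₁, hv₂, hv₃, hv₄]
      _ = ∑ v ∈ W, ∑ x ∈ quadruples V D N, f (FreeGroup.mk
            (fourConj x.2.1 x.2.2.1 x.2.2.2.1 x.2.2.2.2 v.1 v.2.1 v.2.2.1 v.2.2.2)) :=
          Finset.sum_comm
      _ ≤ ∑ v ∈ W, C * (2 * (8 * D + 4 * R + 1) * √3 ^ (4 * R)) * N * 3 ^ (4 * D * N) := by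
          refine Finset.sum_le_sum fun ⟨v₁, v₂, v₃, v₄⟩ hv => ?_
          simp only [W, Finset.mem_product] at hv
          obtain ⟨hv₁, hv₂, hv₃, hv₄⟩ := hv
          simp only
          set l := v₁.length + v₂.length + v₃.length + v₄.length with hl
          have hl4 : l ≤ 4 * R := by
            have := hVR _ hv₁; have := hVR _ hv₂; have := hVR _ hv₃; have := hVR _ hv₄; omega
          have hinj := fourConj_injOn (N := N) (by omega : 0 < D) hVD hv₁ hv₂ hv₃ (v₄ := v₄)
          rw [← Finset.sum_image (f := fun L => f (FreeGroup.mk L)) hinj]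
          refine (Finset.sum_le_sum_of_subset_of_nonneg (t := sphere (8 * D * N + l)) ?_
            (fun _ _ _ => hf _)).trans ((hC _).trans ?_)
          · intro L hL
            obtain ⟨⟨j, h₁, h₂, h₃, h₄⟩, hx, rfl⟩ := Finset.mem_image.1 hL
            exact fourConj_mem_sphere (by omega) hx (hVb _ hv₁) (hVb _ hv₂) (hVb _ hv₃) (hVb _ hv₄)
          · have e1 : √3 ^ (8 * D * N + l) ≤ 3 ^ (4 * D * N) * √3 ^ (4 * R) := by
              rw [pow_add, show 8 * D * N = 2 * (4 * D * N) by ring, pow_mul, h3]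
              gcongr
            have e2 : (((8 * D * N + l : ℕ) : ℝ) + 1) ≤ (8 * D + 4 * R + 1) * N := by
              have : (l : ℝ) ≤ 4 * R := by exact_mod_cast hl4
              push_cast
              nlinarith [Nat.cast_nonneg (α := ℝ) R]
            calc C * (2 * (((8 * D * N + l : ℕ) : ℝ) + 1) * √3 ^ (8 * D * N + l))
                ≤ C * (2 * ((8 * D + 4 * R + 1) * N) * (3 ^ (4 * D * N) * √3 ^ (4 * R))) := by
                  gcongr
              _ = _ := by ring
      _ = B * N * 3 ^ (4 * D * N) := by
          rw [Finset.sum_const, nsmul_eq_mul, hB]; ring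
  have hp : (0 : ℝ) < 3 ^ (4 * D * N) := by positivity
  have h5 : (N / 6 : ℝ) ^ 3 * (3 ^ (4 * D * N) / 6) * δ ≤ B * N * 3 ^ (4 * D * N) :=
    (mul_le_mul_of_nonneg_right hlow hδ.le).trans hup
  have h6 : (N : ℝ) ^ 3 / 1296 * δ ≤ B * N := by
    refine le_of_mul_le_mul_right (a := (3 : ℝ) ^ (4 * D * N)) ?_ hp
    refine (le_of_eq ?_).trans h5
    ring
  rw [div_lt_iff₀ hδ] at hNB
  have h7 : (N : ℝ) ^ 2 * δ ≤ 1296 * B := by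
    have hN0 : (0 : ℝ) < N := by linarith
    refine le_of_mul_le_mul_right (a := (N : ℝ)) ?_ hN0
    nlinarith
  nlinarith

end Growth

/-! ### First letters of reduced words -/

/-- The reduced word of `x` begins with a power of the generator `i`. -/
def BeginsWith (i : Fin 2) (x : FreeGroup (Fin 2)) : Prop := ∃ b, x.toWord.head? = some (i, b)

theorem ne_invLetter_of_fst_ne {s t : Letter} (h : t.1 ≠ s.1) : t ≠ invLetter s := by
  rintro rfl; exact h rfl

theorem toWord_mul_of_forall {x y : FreeGroup (Fin 2)}
    (h : ∀ s ∈ x.toWord.getLast?, ∀ t ∈ y.toWord.head?, t ≠ invLetter s) :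
    (x * y).toWord = x.toWord ++ y.toWord := by
  rw [FreeGroup.toWord_mul]
  exact (isReduced_append.2 ⟨FreeGroup.isReduced_toWord, FreeGroup.isReduced_toWord, h⟩).reduce_eq

theorem getLast?_toWord_of_beginsWith_inv {i : Fin 2} {x : FreeGroup (Fin 2)}
    (h : BeginsWith i x⁻¹) : ∃ b, x.toWord.getLast? = some (i, b) := by
  obtain ⟨b, hb⟩ := h
  rw [FreeGroup.toWord_inv, head?_invRev] at hb
  rcases hg : x.toWord.getLast? with _ | s
  · simp [hg] at hb
  · rw [hg, Option.map_some, Option.some.injEq] at hb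
    exact ⟨!b, by rw [← invLetter_invLetter s, hb]; rfl⟩

theorem toWord_of_zpow (i : Fin 2) (k : ℤ) :
    ∃ b, (FreeGroup.of i ^ k).toWord = List.replicate k.natAbs (i, b) := by
  rcases k with k | k
  · exact ⟨true, by simp⟩
  · refine ⟨false, ?_⟩
    rw [zpow_negSucc, FreeGroup.toWord_inv, FreeGroup.toWord_of_pow]
    simp [FreeGroup.invRev]

theorem getLast?_toWord_of_zpow {i : Fin 2} {k : ℤ} {s : Letter}
    (h : (FreeGroup.of i ^ k).toWord.getLast? = some s) : s.1 = i := by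
  obtain ⟨b, hb⟩ := toWord_of_zpow i k
  rw [hb] at h
  have := List.mem_of_getLast? h
  rw [List.eq_of_mem_replicate this]

theorem head?_toWord_of_zpow {i : Fin 2} {k : ℤ} {s : Letter}
    (h : (FreeGroup.of i ^ k).toWord.head? = some s) : s.1 = i := by
  obtain ⟨b, hb⟩ := toWord_of_zpow i k
  rw [hb] at h
  have := List.mem_of_head? h
  rw [List.eq_of_mem_replicate this]

theorem beginsWith_of_zpow {i : Fin 2} {k : ℤ} (hk : k ≠ 0) :
    BeginsWith i (FreeGroup.of i ^ k) := by
  obtain ⟨b, hb⟩ := toWord_of_zpow i k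
  exact ⟨b, by rw [hb, List.head?_replicate, if_neg (by simpa using hk)]⟩

theorem beginsWith_mul {i : Fin 2} {x y : FreeGroup (Fin 2)} (hx : BeginsWith i x)
    (h : ∀ s ∈ x.toWord.getLast?, ∀ t ∈ y.toWord.head?, t ≠ invLetter s) :
    BeginsWith i (x * y) := by
  obtain ⟨b, hb⟩ := hx
  exact ⟨b, by rw [toWord_mul_of_forall h, List.head?_append, hb]; rfl⟩

theorem beginsWith_zpow_mul {i : Fin 2} {k : ℤ} (hk : k ≠ 0) {x : FreeGroup (Fin 2)}
    (hx : ¬ BeginsWith i x) : BeginsWith i (FreeGroup.of i ^ k * x) := by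
  refine beginsWith_mul (beginsWith_of_zpow hk) fun s hs t ht => ne_invLetter_of_fst_ne ?_
  rw [getLast?_toWord_of_zpow hs]
  rintro rfl
  exact hx ⟨t.2, ht⟩

theorem beginsWith_mul_of_not {i : Fin 2} {g x : FreeGroup (Fin 2)} (hg : BeginsWith i g)
    (hg' : BeginsWith i g⁻¹) (hx : ¬ BeginsWith i x) : BeginsWith i (g * x) := by
  obtain ⟨b, hb⟩ := getLast?_toWord_of_beginsWith_inv hg'
  refine beginsWith_mul hg fun s hs t ht => ne_invLetter_of_fst_ne ?_
  rw [hb, Option.mem_def, Option.some.injEq] at hs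
  subst hs
  rintro rfl
  exact hx ⟨t.2, ht⟩

theorem not_beginsWith_zero_zpow_one_mul {k : ℤ} (hk : k ≠ 0) {x : FreeGroup (Fin 2)}
    (hx : BeginsWith 0 x) : ¬ BeginsWith 0 (FreeGroup.of 1 ^ k * x) := by
  have : ¬ BeginsWith 1 x := by
    rintro ⟨b, hb⟩
    obtain ⟨c, hc⟩ := hx
    rw [hb] at hc
    simp at hc
  obtain ⟨b, hb⟩ := beginsWith_zpow_mul hk this
  rintro ⟨c, hc⟩
  rw [hb] at hc
  simp at hc

theorem mk_eq_zpow_of_forall {i : Fin 2} {L : List Letter} (h : ∀ s ∈ L, s.1 = i) :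
    ∃ k : ℤ, FreeGroup.mk L = FreeGroup.of i ^ k := by
  induction L with
  | nil => exact ⟨0, by simp [← FreeGroup.one_eq_mk]⟩
  | cons s L ih =>
    obtain ⟨k, hk⟩ := ih fun t ht => h t (List.mem_cons_of_mem _ ht)
    obtain ⟨j, b⟩ := s
    obtain rfl : j = i := h _ List.mem_cons_self
    rw [← List.singleton_append, ← FreeGroup.mul_mk, hk]
    rcases b with _ | _
    · refine ⟨-1 + k, ?_⟩
      have : FreeGroup.mk [(j, false)] = (FreeGroup.of j)⁻¹ := by
        rw [FreeGroup.of, FreeGroup.inv_mk]; rfl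
      rw [this, zpow_add, zpow_neg_one]
    · exact ⟨1 + k, by rw [zpow_add, zpow_one]; rfl⟩

/-- Multiplying on the right by a power of the generator changes only the final block of that
generator; the nonempty part before this block keeps the first letter. -/
theorem beginsWith_mul_zpow {i : Fin 2} {x : FreeGroup (Fin 2)} (hx : BeginsWith i x)
    (hx' : ∀ k : ℤ, x ≠ FreeGroup.of i ^ k) (k : ℤ) : BeginsWith i (x * FreeGroup.of i ^ k) := by
  set p : Letter → Bool := fun s => s.1 = i with hp
  have hdec : x.toWord.rdropWhile p ++ x.toWord.rtakeWhile p = x.toWord :=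
    List.rdropWhile_append_rtakeWhile
  obtain ⟨j, hj⟩ := mk_eq_zpow_of_forall (i := i) (L := x.toWord.rtakeWhile p)
    fun s hs => by simpa [hp] using List.mem_rtakeWhile_imp hs
  set P := x.toWord.rdropWhile p with hP
  have hP0 : P ≠ [] := by
    intro h0
    rw [h0, List.nil_append] at hdec
    exact hx' j (by rw [← hj, hdec, FreeGroup.mk_toWord])
  have hlast : ¬ p (P.getLast hP0) := List.rdropWhile_last_not p x.toWord hP0
  have hPr : FreeGroup.IsReduced P :=
    FreeGroup.isReduced_toWord.infix (List.rdropWhile_prefix p _).isInfix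
  have hPw : (FreeGroup.mk P).toWord = P := hPr.reduce_eq
  have hxeq : x * FreeGroup.of i ^ k = FreeGroup.mk P * FreeGroup.of i ^ (j + k) := by
    rw [zpow_add, ← hj, ← mul_assoc, FreeGroup.mul_mk, hdec, FreeGroup.mk_toWord]
  rw [hxeq]
  refine beginsWith_mul ?_ ?_
  · obtain ⟨b, hb⟩ := hx
    refine ⟨b, ?_⟩
    rw [hPw, ← hb, ← hdec, List.head?_append_of_ne_nil _ hP0]
  · intro s hs t ht
    apply ne_invLetter_of_fst_ne
    rw [head?_toWord_of_zpow ht]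
    rw [hPw, List.getLast?_eq_getLast_of_ne_nil hP0, Option.mem_def, Option.some.injEq] at hs
    rw [← hs]
    intro h
    exact hlast (by simp [hp, ← h])

theorem subsingleton_not_beginsWith_zpow_mul (i : Fin 2) (x : FreeGroup (Fin 2)) :
    {M : ℤ | ¬ BeginsWith i (FreeGroup.of i ^ M * x)}.Subsingleton := by
  intro M hM N hN
  by_contra hne
  refine hN ?_
  have := beginsWith_zpow_mul (k := N - M) (sub_ne_zero.2 (Ne.symm hne)) hM
  rwa [← mul_assoc, ← zpow_add, sub_add_cancel] at this

/-- For a nonzero power of the generator no M is exceptional. Otherwise the factor on the right is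
harmless, and at most one M cancels the initial block of x. -/
theorem finite_not_beginsWith_conj (i : Fin 2) {x : FreeGroup (Fin 2)} (hx : x ≠ 1) :
    {M : ℤ | ¬ BeginsWith i (FreeGroup.of i ^ M * x * (FreeGroup.of i ^ M)⁻¹)}.Finite := by
  by_cases h : ∃ k : ℤ, x = FreeGroup.of i ^ k
  · obtain ⟨k, rfl⟩ := h
    have hk : k ≠ 0 := by rintro rfl; simp at hx
    convert Set.finite_empty
    rw [Set.eq_empty_iff_forall_notMem]
    intro M hM
    refine hM ?_
    rw [← zpow_add, ← zpow_neg, ← zpow_add]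
    exact beginsWith_of_zpow (by omega)
  · push Not at h
    refine (subsingleton_not_beginsWith_zpow_mul i x).finite.subset fun M hM hM' => hM ?_
    rw [← zpow_neg]
    refine beginsWith_mul_zpow hM' (fun k hk => h (-M + k) ?_) _
    rw [zpow_add, ← hk, ← mul_assoc, ← zpow_add]
    simp

theorem exists_forall_beginsWith_conj (i : Fin 2) (S : Finset (FreeGroup (Fin 2)))
    (hS : 1 ∉ S) : ∃ t : FreeGroup (Fin 2), ∀ x ∈ S,
      BeginsWith i (t * x * t⁻¹) ∧ BeginsWith i (t * x * t⁻¹)⁻¹ := by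
  have hfin : (⋃ x ∈ S, ({M : ℤ | ¬ BeginsWith i (FreeGroup.of i ^ M * x * (FreeGroup.of i ^ M)⁻¹)}
      ∪ {M : ℤ | ¬ BeginsWith i
        (FreeGroup.of i ^ M * x⁻¹ * (FreeGroup.of i ^ M)⁻¹)})).Finite := by
    refine S.finite_toSet.biUnion fun x hx => ?_
    have hx1 : x ≠ 1 := by rintro rfl; exact hS hx
    exact (finite_not_beginsWith_conj i hx1).union
      (finite_not_beginsWith_conj i (inv_ne_one.2 hx1))
  obtain ⟨M, hM⟩ := hfin.exists_notMem
  refine ⟨FreeGroup.of i ^ M, fun x hx => ?_⟩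
  simp only [Set.mem_iUnion, Set.mem_union, Set.mem_ofPred_eq, not_exists, not_or, not_not] at hM
  have := hM x hx
  refine ⟨this.1, ?_⟩
  rw [conj_inv]
  exact this.2

/-- A conjugation by a power of generator 0 makes all words begin and end with that generator. A
further conjugation by generator 1 then adds a letter at each end without cancellation. -/
theorem exists_forall_isBracket_conj (S : Finset (FreeGroup (Fin 2))) (hS : 1 ∉ S) :
    ∃ t : FreeGroup (Fin 2), ∀ x ∈ S, IsBracket (t * x * t⁻¹).toWord := by
  obtain ⟨t, ht⟩ := exists_forall_beginsWith_conj 0 S hS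
  refine ⟨FreeGroup.of 1 * t, fun x hx => ?_⟩
  obtain ⟨⟨b, hb⟩, h2⟩ := ht x hx
  obtain ⟨c, hc⟩ := getLast?_toWord_of_beginsWith_inv h2
  set y := t * x * t⁻¹
  have e1 : (FreeGroup.of (1 : Fin 2) * y).toWord = [(1, true)] ++ y.toWord := by
    rw [toWord_mul_of_forall, FreeGroup.toWord_of]
    intro s hs u hu
    rw [FreeGroup.toWord_of] at hs
    rw [hb] at hu
    simp only [List.getLast?_singleton, Option.mem_def, Option.some.injEq] at hs hu
    subst hs hu
    exact ne_invLetter_of_fst_ne (by simp)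
  have ei : ((FreeGroup.of (1 : Fin 2))⁻¹).toWord = [(1, false)] := by
    rw [FreeGroup.toWord_inv, FreeGroup.toWord_of]; rfl
  have hy : y.toWord ≠ [] := by intro h; rw [h] at hb; simp at hb
  have e2 : (FreeGroup.of (1 : Fin 2) * y * (FreeGroup.of (1 : Fin 2))⁻¹).toWord =
      [(1, true)] ++ y.toWord ++ [(1, false)] := by
    rw [toWord_mul_of_forall, e1, ei]
    intro s hs u hu
    rw [e1, List.getLast?_append_of_ne_nil _ hy, hc] at hs
    rw [ei] at hu
    simp only [List.head?_cons, Option.mem_def, Option.some.injEq] at hs hu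
    subst hs hu
    exact ne_invLetter_of_fst_ne (by simp)
  have e3 : FreeGroup.of 1 * t * x * (FreeGroup.of 1 * t)⁻¹ =
      FreeGroup.of (1 : Fin 2) * y * (FreeGroup.of (1 : Fin 2))⁻¹ := by simp only [y]; group
  rw [e3]
  refine ⟨FreeGroup.isReduced_toWord, ?_, ?_⟩
  · rw [e2]; simp
  · rw [e2, List.getLast?_append_of_ne_nil _ (by simp)]; simp

/-! ### Tracial states and almost central averages -/

section Trace

variable {A : Type*} [Ring A] [StarRing A] [Algebra ℂ A] [StarModule ℂ A]

/-- A tracial state on a complex star algebra. -/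
structure IsTracialState (τ : A →ₗ[ℂ] ℂ) : Prop where
  map_one : τ 1 = 1
  nonneg : ∀ x, 0 ≤ τ (star x * x)
  tracial : ∀ x y, τ (x * y) = τ (y * x)

namespace IsTracialState

variable {τ : A →ₗ[ℂ] ℂ} (hτ : IsTracialState τ)

include hτ in
-- Polarisation: τ is real on (x+1)*(x+1) and on (x+i)*(x+i), which settles the imaginary and the
-- real part respectively.
theorem map_star (x : A) : τ (star x) = conj (τ x) := by
  have him : ∀ y, (τ (star y * y)).im = 0 := fun y => (Complex.nonneg_iff.1 (hτ.nonneg y)).2.symm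
  have e1 := him (x + 1)
  have e2 := him (x + Complex.I • 1)
  have ex := him x
  have e0 := him 1
  simp only [star_add, star_one, add_mul, mul_add, mul_one, one_mul, map_add, Complex.add_im,
    star_smul, smul_mul_assoc, mul_smul_comm, map_smul, smul_add, smul_smul, smul_eq_mul] at e1 e2 e0
  simp only [ex, hτ.map_one, Complex.one_im, Complex.star_def, Complex.conj_I, Complex.mul_im,
    Complex.neg_re, Complex.neg_im, Complex.I_re, Complex.I_im, Complex.one_re] at e1 e2
  apply Complex.ext
  · rw [Complex.conj_re]; linarith
  · rw [Complex.conj_im]; linarith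

/-- The semi-inner product of a tracial state. -/
@[reducible] def core : PreInnerProductSpace.Core ℂ A where
  inner x y := τ (star x * y)
  conj_inner_symm x y := by
    change conj (τ (star y * x)) = τ (star x * y)
    rw [← hτ.map_star]; simp
  re_inner_nonneg x := (Complex.nonneg_iff.1 (hτ.nonneg x)).1
  add_left x y z := by simp [add_mul]
  smul_left x y r := by simp

end IsTracialState

/-- The `2`-norm of a tracial state. -/
def tnorm (τ : A →ₗ[ℂ] ℂ) (x : A) : ℝ := √(τ (star x * x)).re

theorem tnorm_nonneg (τ : A →ₗ[ℂ] ℂ) (x : A) : 0 ≤ tnorm τ x := Real.sqrt_nonneg _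

namespace IsTracialState

variable {τ : A →ₗ[ℂ] ℂ} (hτ : IsTracialState τ)

include hτ

theorem tnorm_sq (x : A) : tnorm τ x ^ 2 = (τ (star x * x)).re :=
  Real.sq_sqrt (Complex.nonneg_iff.1 (hτ.nonneg x)).1

theorem ofReal_tnorm_sq (x : A) : ((tnorm τ x ^ 2 : ℝ) : ℂ) = τ (star x * x) := by
  rw [hτ.tnorm_sq]
  exact Complex.ext rfl (by simpa using (Complex.nonneg_iff.1 (hτ.nonneg x)).2)

theorem norm_map_star_mul_le (x y : A) : ‖τ (star x * y)‖ ≤ tnorm τ x * tnorm τ y :=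
  letI := hτ.core
  InnerProductSpace.Core.norm_inner_le_norm x y

theorem tnorm_add_le (x y : A) : tnorm τ (x + y) ≤ tnorm τ x + tnorm τ y :=
  letI := hτ.core
  letI := InnerProductSpace.Core.toSeminormedAddCommGroup (𝕜 := ℂ) (F := A)
  norm_add_le x y

theorem tnorm_smul (r : ℂ) (x : A) : tnorm τ (r • x) = ‖r‖ * tnorm τ x :=
  letI := hτ.core
  letI := InnerProductSpace.Core.toSeminormedAddCommGroup (𝕜 := ℂ) (F := A)
  letI := InnerProductSpace.Core.toNormedSpace (𝕜 := ℂ) (F := A)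
  norm_smul r x

theorem tnorm_parallelogram (x y : A) :
    tnorm τ (x + y) ^ 2 + tnorm τ (x - y) ^ 2 = 2 * (tnorm τ x ^ 2 + tnorm τ y ^ 2) := by
  simp only [hτ.tnorm_sq, star_add, star_sub, add_mul, mul_add, sub_mul, mul_sub, map_add, map_sub,
    Complex.add_re, Complex.sub_re]
  ring

theorem sum_norm_sq_le {ι : Type*} (s : Finset ι) (u : ι → A)
    (hu : ∀ i, τ (star (u i) * u i) = 1) (hu' : ∀ i j, i ≠ j → τ (star (u i) * u j) = 0) (x : A) :
    ∑ i ∈ s, ‖τ (star (u i) * x)‖ ^ 2 ≤ (τ (star x * x)).re := by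
  letI := hτ.core
  letI := InnerProductSpace.Core.toSeminormedAddCommGroup (𝕜 := ℂ) (F := A)
  letI := InnerProductSpace.ofCore hτ.core
  have horth : Orthonormal ℂ u := by
    classical
    refine ⟨fun i => ?_, fun i j hij => hu' i j hij⟩
    change √(τ (star (u i) * u i)).re = 1
    rw [hu]; simp
  rw [← hτ.tnorm_sq]
  exact horth.sum_inner_products_le x

theorem tnorm_star (x : A) : tnorm τ (star x) = tnorm τ x := by
  rw [tnorm, tnorm, hτ.tracial, star_star]

theorem norm_map_mul_le (x y : A) : ‖τ (x * y)‖ ≤ tnorm τ x * tnorm τ y := by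
  have := hτ.norm_map_star_mul_le (star x) y
  rwa [star_star, hτ.tnorm_star] at this

theorem tnorm_one : tnorm τ 1 = 1 := by simp [tnorm, hτ.map_one]

theorem norm_map_le (x : A) : ‖τ x‖ ≤ tnorm τ x := by
  simpa [hτ.tnorm_one] using hτ.norm_map_mul_le x 1

end IsTracialState

/-- Multiplication by `x`, on either side, does not increase the `2`-norm. -/
def IsTraceContraction (τ : A →ₗ[ℂ] ℂ) (x : A) : Prop :=
  (∀ y, tnorm τ (x * y) ≤ tnorm τ y) ∧ ∀ y, tnorm τ (y * x) ≤ tnorm τ y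

namespace IsTraceContraction

variable {τ : A →ₗ[ℂ] ℂ} {x y : A}

theorem mul (hx : IsTraceContraction τ x) (hy : IsTraceContraction τ y) :
    IsTraceContraction τ (x * y) :=
  ⟨fun z => by rw [mul_assoc]; exact (hx.1 _).trans (hy.1 _),
    fun z => by rw [← mul_assoc]; exact (hy.2 _).trans (hx.2 _)⟩

theorem star (hτ : IsTracialState τ) (hx : IsTraceContraction τ x) :
    IsTraceContraction τ (star x) :=
  ⟨fun z => by rw [← hτ.tnorm_star, star_mul, star_star, ← hτ.tnorm_star z]; exact hx.2 _,
    fun z => by rw [← hτ.tnorm_star, star_mul, star_star, ← hτ.tnorm_star z]; exact hx.1 _⟩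

theorem tnorm_le_one (hτ : IsTracialState τ) (hx : IsTraceContraction τ x) : tnorm τ x ≤ 1 := by
  simpa [hτ.tnorm_one] using hx.1 1

/-- This is the perturbation estimate: replacing one factor of a product of contractions by another
costs at most the 2-norm of the difference under the trace. -/
theorem norm_map_mul_mul_le (hτ : IsTracialState τ) (hx : IsTraceContraction τ x)
    (hy : IsTraceContraction τ y) (d : A) : ‖τ (x * d * y)‖ ≤ tnorm τ d := by
  rw [hτ.tracial, ← mul_assoc]
  refine (hτ.norm_map_mul_le _ _).trans ?_
  have := (hy.mul hx).tnorm_le_one hτ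
  nlinarith [tnorm_nonneg τ d]

end IsTraceContraction

theorem isTraceContraction_of_unitary {τ : A →ₗ[ℂ] ℂ} (hτ : IsTracialState τ) {u : A}
    (h1 : star u * u = 1) (h2 : u * star u = 1) : IsTraceContraction τ u := by
  have key : ∀ v : A, star v * v = 1 → ∀ y, tnorm τ (v * y) ≤ tnorm τ y := by
    intro v hv y
    rw [tnorm, tnorm, star_mul, mul_assoc, ← mul_assoc (star v), hv, one_mul]
  refine ⟨key u h1, fun y => ?_⟩
  rw [← hτ.tnorm_star, star_mul, ← hτ.tnorm_star y]
  exact key _ (by rwa [star_star]) _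

theorem convex_isTraceContraction {τ : A →ₗ[ℂ] ℂ} (hτ : IsTracialState τ) :
    Convex ℝ {x | IsTraceContraction τ x} := by
  intro x hx y hy a b ha hb hab
  have hsm : ∀ (r : ℝ) (z : A), 0 ≤ r → tnorm τ (r • z) = r * tnorm τ z := by
    intro r z hr
    rw [← Complex.coe_smul, hτ.tnorm_smul, Complex.norm_real, Real.norm_of_nonneg hr]
  refine ⟨fun z => ?_, fun z => ?_⟩
  · rw [add_mul, smul_mul_assoc, smul_mul_assoc]
    refine (hτ.tnorm_add_le _ _).trans ?_
    rw [hsm _ _ ha, hsm _ _ hb]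
    have h1 := mul_le_mul_of_nonneg_left (hx.1 z) ha
    have h2 := mul_le_mul_of_nonneg_left (hy.1 z) hb
    calc _ ≤ a * tnorm τ z + b * tnorm τ z := add_le_add h1 h2
      _ = tnorm τ z := by rw [← add_mul, hab, one_mul]
  · rw [mul_add, mul_smul_comm, mul_smul_comm]
    refine (hτ.tnorm_add_le _ _).trans ?_
    rw [hsm _ _ ha, hsm _ _ hb]
    have h1 := mul_le_mul_of_nonneg_left (hx.2 z) ha
    have h2 := mul_le_mul_of_nonneg_left (hy.2 z) hb
    calc _ ≤ a * tnorm τ z + b * tnorm τ z := add_le_add h1 h2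
      _ = tnorm τ z := by rw [← add_mul, hab, one_mul]

/-! ### Almost central averages of conjugates -/

section Average

variable {G : Type*} [Group G] (U : G →* A) (hU : ∀ g, star (U g) = U g⁻¹) {τ : A →ₗ[ℂ] ℂ}
  (hτ : IsTracialState τ)

/-- The convex hull of the conjugates of `U w`. -/
def conjHull (w : G) : Set A := convexHull ℝ (Set.range fun g => U (g * w * g⁻¹))

variable {U}

theorem conj_mem_conjHull {w : G} {a : A} (ha : a ∈ conjHull U w) (h : G) :
    U h * a * U h⁻¹ ∈ conjHull U w := by
  have himg := (LinearMap.mulLeft ℝ (U h) ∘ₗ LinearMap.mulRight ℝ (U h⁻¹)).image_convexHull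
    (Set.range fun g => U (g * w * g⁻¹))
  have h1 : U h * a * U h⁻¹ ∈ (LinearMap.mulLeft ℝ (U h) ∘ₗ LinearMap.mulRight ℝ (U h⁻¹)) ''
      convexHull ℝ (Set.range fun g => U (g * w * g⁻¹)) := ⟨a, ha, by simp [mul_assoc]⟩
  rw [himg] at h1
  refine convexHull_mono ?_ h1
  rintro _ ⟨_, ⟨g, rfl⟩, rfl⟩
  refine ⟨h * g, ?_⟩
  simp [mul_assoc]

include hU hτ

theorem isTraceContraction_map (g : G) : IsTraceContraction τ (U g) :=
  isTraceContraction_of_unitary hτ (by rw [hU, ← map_mul]; simp) (by rw [hU, ← map_mul]; simp)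

theorem isTraceContraction_of_mem_conjHull {w : G} {a : A} (ha : a ∈ conjHull U w) :
    IsTraceContraction τ a := by
  have hsub : (Set.range fun g => U (g * w * g⁻¹)) ⊆ {x | IsTraceContraction τ x} := by
    rintro _ ⟨g, rfl⟩
    exact isTraceContraction_map hU hτ _
  exact convexHull_min hsub (convex_isTraceContraction hτ) ha

omit hU in
theorem map_eq_of_mem_conjHull {w : G} {a : A} (ha : a ∈ conjHull U w) : τ a = τ (U w) := by
  have hconv : Convex ℝ {x | τ x = τ (U w)} := by
    intro x hx y hy a b _ _ hab
    change τ (a • x + b • y) = _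
    rw [map_add, ← Complex.coe_smul, ← Complex.coe_smul, map_smul, map_smul, hx, hy, ← add_smul,
      ← Complex.ofReal_add, hab]
    simp
  refine convexHull_min ?_ hconv ha
  rintro _ ⟨g, rfl⟩
  change τ (U (g * w * g⁻¹)) = _
  rw [map_mul, hτ.tracial, ← map_mul]
  congr 2; group

/-- A nearly shortest a in the convex hull is nearly fixed by conjugation. Its conjugate b has no
larger norm and the midpoint lies in the hull, so the parallelogram law gives ‖b - a‖² ≤ 4(‖a‖² -
inf); hence the tolerance ε²/4. No completion is needed. -/
theorem exists_almost_central (w : G) {ε : ℝ} (hε : 0 < ε) :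
    ∃ a ∈ conjHull U w, ∀ h, tnorm τ (U h * a * U h⁻¹ - a) ≤ ε := by
  set S := (fun a => tnorm τ a ^ 2) '' conjHull U w with hS
  have hne : S.Nonempty := ⟨_, U w, subset_convexHull _ _ ⟨1, by simp⟩, rfl⟩
  have hbdd : BddBelow S := ⟨0, by rintro _ ⟨a, -, rfl⟩; exact sq_nonneg _⟩
  obtain ⟨_, ⟨a, ha, rfl⟩, hlt⟩ := Real.lt_sInf_add_pos hne (ε := ε ^ 2 / 4) (by positivity)
  refine ⟨a, ha, fun h => ?_⟩
  have hb := conj_mem_conjHull ha h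
  set b := U h * a * U h⁻¹
  have hbn : tnorm τ b ≤ tnorm τ a :=
    ((isTraceContraction_map hU hτ _).2 _).trans ((isTraceContraction_map hU hτ _).1 _)
  have hmid : (1 / 2 : ℝ) • a + (1 / 2 : ℝ) • b ∈ conjHull U w :=
    convex_convexHull ℝ _ ha hb (by norm_num) (by norm_num) (by norm_num)
  have hinf : sInf S ≤ tnorm τ ((1 / 2 : ℝ) • a + (1 / 2 : ℝ) • b) ^ 2 := csInf_le hbdd ⟨_, hmid, rfl⟩
  have e : (1 / 2 : ℝ) • a + (1 / 2 : ℝ) • b = ((1 / 2 : ℝ) : ℂ) • (b + a) := by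
    rw [Complex.coe_smul, smul_add, add_comm]
  rw [e, hτ.tnorm_smul, Complex.norm_real, Real.norm_of_nonneg (by norm_num), mul_pow] at hinf
  have hpar := hτ.tnorm_parallelogram b a
  have hbn2 : tnorm τ b ^ 2 ≤ tnorm τ a ^ 2 := by gcongr; exact tnorm_nonneg _ _
  refine abs_le_of_sq_le_sq' ?_ hε.le |>.2
  linarith

/-- Without the conjugations, τ(aa*aa*) = ‖aa*‖₂² ≥ τ(aa*)² = ‖a‖₂⁴ ≥ |τ(a)|⁴. Each of the four
conjugations costs at most an eighth of |τ(u_w)|⁴. -/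
theorem norm_pow_four_div_two_le (w : G) {a : A} (ha : a ∈ conjHull U w)
    (hc : ∀ h, tnorm τ (U h * a * U h⁻¹ - a) ≤ ‖τ (U w)‖ ^ 4 / 8) (h₁ h₂ h₃ h₄ : G) :
    ‖τ (U w)‖ ^ 4 / 2 ≤ ‖τ ((U h₁ * a * U h₁⁻¹) * star (U h₂ * a * U h₂⁻¹) *
      (U h₃ * a * U h₃⁻¹) * star (U h₄ * a * U h₄⁻¹))‖ := by
  set ε := ‖τ (U w)‖ ^ 4 / 8
  have hK : ∀ h, IsTraceContraction τ (U h * a * U h⁻¹) := fun h =>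
    isTraceContraction_of_mem_conjHull hU hτ (conj_mem_conjHull ha h)
  have hKa : IsTraceContraction τ a := isTraceContraction_of_mem_conjHull hU hτ ha
  have hK1 : IsTraceContraction τ (1 : A) := by simpa using isTraceContraction_map hU hτ 1
  set a₁ := U h₁ * a * U h₁⁻¹
  set a₂ := U h₂ * a * U h₂⁻¹
  set a₃ := U h₃ * a * U h₃⁻¹
  set a₄ := U h₄ * a * U h₄⁻¹
  have main : ‖τ (U w)‖ ^ 4 ≤ ‖τ (a * star a * a * star a)‖ := by
    set p := a * star a
    have hp : star p = p := by simp [p]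
    have h1 : a * star a * a * star a = star p * p := by rw [hp]; simp [p, mul_assoc]
    rw [h1, ← hτ.ofReal_tnorm_sq, Complex.norm_real, Real.norm_of_nonneg (sq_nonneg _)]
    have h2 : tnorm τ a ^ 2 ≤ tnorm τ p := by
      refine le_trans ?_ (hτ.norm_map_le p)
      rw [← hτ.tnorm_star a]
      have := hτ.ofReal_tnorm_sq (star a)
      rw [star_star] at this
      rw [← this, Complex.norm_real]
      exact le_abs_self _
    have h3 : ‖τ (U w)‖ ≤ tnorm τ a := by
      rw [← map_eq_of_mem_conjHull hτ ha]; exact hτ.norm_map_le a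
    calc ‖τ (U w)‖ ^ 4 ≤ tnorm τ a ^ 4 := by gcongr
      _ = (tnorm τ a ^ 2) ^ 2 := by ring
      _ ≤ tnorm τ p ^ 2 := by gcongr
  have hstar : ∀ h, tnorm τ (star (U h * a * U h⁻¹) - star a) ≤ ε := by
    intro h
    rw [← star_sub, hτ.tnorm_star]; exact hc h
  have d1 : ‖τ (1 * (a₁ - a) * (star a₂ * a₃ * star a₄))‖ ≤ ε :=
    (hK1.norm_map_mul_mul_le hτ ((((hK h₂).star hτ).mul (hK h₃)).mul ((hK h₄).star hτ)) _).trans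
      (hc h₁)
  have d2 : ‖τ (a * (star a₂ - star a) * (a₃ * star a₄))‖ ≤ ε :=
    (hKa.norm_map_mul_mul_le hτ ((hK h₃).mul ((hK h₄).star hτ)) _).trans (hstar h₂)
  have d3 : ‖τ ((a * star a) * (a₃ - a) * star a₄)‖ ≤ ε :=
    ((hKa.mul (hKa.star hτ)).norm_map_mul_mul_le hτ ((hK h₄).star hτ) _).trans (hc h₃)
  have d4 : ‖τ ((a * star a * a) * (star a₄ - star a) * 1)‖ ≤ ε :=
    (((hKa.mul (hKa.star hτ)).mul hKa).norm_map_mul_mul_le hτ hK1 _).trans (hstar h₄)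
  have htel : a * star a * a * star a = a₁ * star a₂ * a₃ * star a₄ -
      (1 * (a₁ - a) * (star a₂ * a₃ * star a₄) + a * (star a₂ - star a) * (a₃ * star a₄) +
        (a * star a) * (a₃ - a) * star a₄ + (a * star a * a) * (star a₄ - star a) * 1) := by
    noncomm_ring
  rw [htel, map_sub, map_add, map_add, map_add] at main
  have h5 := norm_sub_le (τ (a₁ * star a₂ * a₃ * star a₄))
    (τ (1 * (a₁ - a) * (star a₂ * a₃ * star a₄)) + τ (a * (star a₂ - star a) * (a₃ * star a₄)) +
        τ ((a * star a) * (a₃ - a) * star a₄) + τ ((a * star a * a) * (star a₄ - star a) * 1))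
  have h6 := norm_add₄_le (a := τ (1 * (a₁ - a) * (star a₂ * a₃ * star a₄)))
    (b := τ (a * (star a₂ - star a) * (a₃ * star a₄)))
    (c := τ ((a * star a) * (a₃ - a) * star a₄))
    (d := τ ((a * star a * a) * (star a₄ - star a) * 1))
  have h7 : 8 * ε = ‖τ (U w)‖ ^ 4 := by simp only [ε]; ring
  linarith

-- The norm of a linear functional is convex, so over a convex hull it is dominated by its value at
-- a generator.
omit hU hτ in
theorem exists_norm_le_of_mem_convexHull {S : Set A} {a : A} (ha : a ∈ convexHull ℝ S) (φ : A →ₗ[ℝ] ℂ) :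
    ∃ y ∈ S, ‖φ a‖ ≤ ‖φ y‖ :=
  ConvexOn.exists_ge_of_mem_convexHull
    (((convexOn_norm (convex_univ (𝕜 := ℝ))).comp_linearMap φ).subset (Set.subset_univ _)
      (convex_convexHull ℝ S)) (subset_convexHull ℝ S) ha

/-- If the trace does not vanish on `w`, it is bounded below on many products of conjugates. -/
theorem exists_finset_le_norm_fourConj {w : G} (hw : w ≠ 1) (hτw : τ (U w) ≠ 0) :
    ∃ V : Finset G, 1 ∉ V ∧ ∃ δ : ℝ, 0 < δ ∧ ∀ h₁ h₂ h₃ h₄ : G, ∃ v₁ ∈ V, ∃ v₂ ∈ V, ∃ v₃ ∈ V,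
      ∃ v₄ ∈ V, δ ≤ ‖τ (U (h₁ * v₁ * h₁⁻¹ * (h₂ * v₂ * h₂⁻¹) * (h₃ * v₃ * h₃⁻¹) *
        (h₄ * v₄ * h₄⁻¹)))‖ := by
  classical
  have hpos : 0 < ‖τ (U w)‖ := norm_pos_iff.2 hτw
  obtain ⟨a, ha, hc⟩ := exists_almost_central hU hτ w (ε := ‖τ (U w)‖ ^ 4 / 8) (by positivity)
  have ha' := ha
  rw [conjHull, convexHull_eq_union_convexHull_finite_subsets] at ha'
  simp only [Set.mem_iUnion] at ha'
  obtain ⟨t, ht, hat⟩ := ha'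
  obtain ⟨Y, rfl⟩ : ∃ Y : Finset G, Y.image (fun g => U (g * w * g⁻¹)) = t := by
    rw [← Set.image_univ, Finset.subset_set_image_iff] at ht
    obtain ⟨Y, -, hY⟩ := ht
    exact ⟨Y, hY⟩
  -- The average uses finitely many conjugates of w. The starred factors produce conjugates of w⁻¹,
  -- so both kinds enter V.
  refine ⟨Y.image (fun g => g * w * g⁻¹) ∪ Y.image (fun g => g * w⁻¹ * g⁻¹), ?_, ‖τ (U w)‖ ^ 4 / 2,
    by positivity, fun h₁ h₂ h₃ h₄ => ?_⟩
  · simp only [Finset.mem_union, Finset.mem_image, not_or, not_exists, not_and]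
    refine ⟨fun g _ h => hw ?_, fun g _ h => hw ?_⟩
    · rwa [conj_eq_one_iff] at h
    · rwa [conj_eq_one_iff, inv_eq_one] at h
  have hfin := norm_pow_four_div_two_le hU hτ w ha hc h₁ h₂ h₃ h₄
  have hlin : ∀ p q : A, ∃ y ∈ Y, ‖τ (p * a * q)‖ ≤ ‖τ (p * U (y * w * y⁻¹) * q)‖ := by
    intro p q
    obtain ⟨_, hy, hle⟩ := exists_norm_le_of_mem_convexHull hat
      ((τ.restrictScalars ℝ) ∘ₗ LinearMap.mulRight ℝ q ∘ₗ LinearMap.mulLeft ℝ p)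
    obtain ⟨y, hy', rfl⟩ := Finset.mem_image.1 hy
    exact ⟨y, hy', by simpa using hle⟩
  have hstar : ∀ p q : A, ∃ y ∈ Y,
      ‖τ (p * star a * q)‖ ≤ ‖τ (p * star (U (y * w * y⁻¹)) * q)‖ := by
    intro p q
    obtain ⟨y, hy, hle⟩ := hlin (star q) (star p)
    refine ⟨y, hy, ?_⟩
    have e : ∀ z : A, ‖τ (p * star z * q)‖ = ‖τ (star q * z * star p)‖ := by
      intro z
      rw [← RCLike.norm_conj, ← hτ.map_star]
      simp [mul_assoc]
    rwa [e, e]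
  -- The four averages are replaced by single conjugates one after another, with the earlier choices
  -- kept fixed and without decreasing the modulus of the trace.
  obtain ⟨y₁, hy₁, l₁⟩ := hlin (U h₁) (U h₁⁻¹ * star (U h₂ * a * U h₂⁻¹) *
      (U h₃ * a * U h₃⁻¹) * star (U h₄ * a * U h₄⁻¹))
  obtain ⟨y₂, hy₂, l₂⟩ := hstar ((U h₁ * U (y₁ * w * y₁⁻¹) * U h₁⁻¹) * star (U h₂⁻¹))
    (star (U h₂) * (U h₃ * a * U h₃⁻¹) * star (U h₄ * a * U h₄⁻¹))
  obtain ⟨y₃, hy₃, l₃⟩ := hlin ((U h₁ * U (y₁ * w * y₁⁻¹) * U h₁⁻¹) *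
    star (U h₂ * U (y₂ * w * y₂⁻¹) * U h₂⁻¹) * U h₃) (U h₃⁻¹ * star (U h₄ * a * U h₄⁻¹))
  obtain ⟨y₄, hy₄, l₄⟩ := hstar ((U h₁ * U (y₁ * w * y₁⁻¹) * U h₁⁻¹) *
    star (U h₂ * U (y₂ * w * y₂⁻¹) * U h₂⁻¹) * (U h₃ * U (y₃ * w * y₃⁻¹) * U h₃⁻¹) * star (U h₄⁻¹))
    (star (U h₄))
  have mem₁ : ∀ y ∈ Y, y * w * y⁻¹ ∈ Y.image (fun g => g * w * g⁻¹) ∪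
      Y.image (fun g => g * w⁻¹ * g⁻¹) := fun y hy =>
    Finset.mem_union_left _ (Finset.mem_image_of_mem (fun g => g * w * g⁻¹) hy)
  have mem₂ : ∀ y ∈ Y, y * w⁻¹ * y⁻¹ ∈ Y.image (fun g => g * w * g⁻¹) ∪
      Y.image (fun g => g * w⁻¹ * g⁻¹) := fun y hy =>
    Finset.mem_union_right _ (Finset.mem_image_of_mem (fun g => g * w⁻¹ * g⁻¹) hy)
  refine ⟨_, mem₁ _ hy₁, _, mem₂ _ hy₂, _, mem₁ _ hy₃, _, mem₂ _ hy₄, ?_⟩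
  simp only [star_mul, hU, inv_inv, mul_assoc, mul_inv_rev] at hfin l₁ l₂ l₃ l₄
  simp only [map_mul, mul_assoc] at hfin l₁ l₂ l₃ l₄ ⊢
  exact hfin.trans (l₁.trans (l₂.trans (l₃.trans l₄)))

end Average

end Trace

/-! ### Operators on the tensor product -/

section TensorOps

variable {H K : Type*} [NormedAddCommGroup H] [InnerProductSpace ℂ H] [CompleteSpace H]
  [NormedAddCommGroup K] [InnerProductSpace ℂ K] [CompleteSpace K]

/-- The elementary tensor of two vectors in the Hilbert space tensor product. -/
def elemVec (a : H) (b : K) : HilbertTensor H K := ((a ⊗ₜ[ℂ] b : H ⊗[ℂ] K) : HilbertTensor H K)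

theorem tensorOp_elemVec (x : H →L[ℂ] H) (y : K →L[ℂ] K) (a : H) (b : K) :
    tensorOp x y (elemVec a b) = elemVec (x a) (y b) := by
  change (TensorProduct.mapL x y).completion ((a ⊗ₜ[ℂ] b : H ⊗[ℂ] K) : HilbertTensor H K) = _
  rw [ContinuousLinearMap.completion_apply_coe]
  rfl

theorem inner_elemVec (a a' : H) (b b' : K) :
    inner ℂ (elemVec a b) (elemVec a' b') = inner ℂ a a' * inner ℂ b b' := by
  rw [elemVec, elemVec, UniformSpace.Completion.inner_coe, TensorProduct.inner_tmul]

theorem norm_elemVec (a : H) (b : K) : ‖elemVec a b‖ = ‖a‖ * ‖b‖ := by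
  rw [elemVec, UniformSpace.Completion.norm_coe, TensorProduct.norm_tmul]

theorem closure_span_elemVec :
    (Submodule.span ℂ (Set.range fun p : H × K => elemVec p.1 p.2)).topologicalClosure = ⊤ := by
  rw [eq_top_iff]
  intro x _
  have hd := UniformSpace.Completion.denseRange_coe (α := H ⊗[ℂ] K) x
  refine closure_mono ?_ hd
  rintro _ ⟨t, rfl⟩
  induction t using TensorProduct.induction_on with
  | zero => rw [UniformSpace.Completion.coe_zero]; exact Submodule.zero_mem _
  | tmul a b => exact Submodule.subset_span ⟨(a, b), rfl⟩
  | add s t hs ht => rw [UniformSpace.Completion.coe_add]; exact Submodule.add_mem _ hs ht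

theorem clm_ext_elemVec {f g : HilbertTensor H K →L[ℂ] HilbertTensor H K}
    (h : ∀ a b, f (elemVec a b) = g (elemVec a b)) : f = g := by
  refine ContinuousLinearMap.ext_on
    (s := Set.range fun p : H × K => elemVec p.1 p.2) ?_ ?_
  · exact Submodule.dense_iff_topologicalClosure_eq_top.2 closure_span_elemVec
  · rintro _ ⟨p, rfl⟩; exact h _ _

theorem eq_of_forall_inner_elemVec {v w : HilbertTensor H K}
    (h : ∀ a b, inner ℂ (elemVec a b) v = inner ℂ (elemVec a b) w) : v = w := by
  have : innerSL ℂ v = innerSL ℂ w := by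
    refine ContinuousLinearMap.ext_on
      (s := Set.range fun p : H × K => elemVec p.1 p.2) ?_ ?_
    · exact Submodule.dense_iff_topologicalClosure_eq_top.2 closure_span_elemVec
    · rintro _ ⟨p, rfl⟩
      rw [innerSL_apply_apply, innerSL_apply_apply, ← inner_conj_symm, h, inner_conj_symm]
  exact (innerSL_inj (𝕜 := ℂ)).1 this

theorem tensorOp_mul (x x' : H →L[ℂ] H) (y y' : K →L[ℂ] K) :
    tensorOp x y * tensorOp x' y' = tensorOp (x * x') (y * y') :=
  clm_ext_elemVec fun a b => by simp [tensorOp_elemVec]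

theorem tensorOp_one : tensorOp (1 : H →L[ℂ] H) (1 : K →L[ℂ] K) = 1 :=
  clm_ext_elemVec fun a b => by simp [tensorOp_elemVec]

theorem star_tensorOp (x : H →L[ℂ] H) (y : K →L[ℂ] K) :
    star (tensorOp x y) = tensorOp (star x) (star y) := by
  refine clm_ext_elemVec fun a b => eq_of_forall_inner_elemVec fun a' b' => ?_
  rw [ContinuousLinearMap.star_eq_adjoint, ContinuousLinearMap.adjoint_inner_right,
    tensorOp_elemVec, tensorOp_elemVec, inner_elemVec, inner_elemVec,
    ContinuousLinearMap.star_eq_adjoint, ContinuousLinearMap.star_eq_adjoint,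
    ContinuousLinearMap.adjoint_inner_right, ContinuousLinearMap.adjoint_inner_right]

theorem transpose_toDual (x : H →L[ℂ] H) (a : H) :
    transpose x (InnerProductSpace.toDual ℂ H a) = InnerProductSpace.toDual ℂ H (star x a) := by
  ext b
  change inner ℂ a (x b) = inner ℂ (star x a) b
  rw [ContinuousLinearMap.star_eq_adjoint, ContinuousLinearMap.adjoint_inner_left]

theorem inner_toDual_toDual (a b : H) :
    inner ℂ (InnerProductSpace.toDual ℂ H a) (InnerProductSpace.toDual ℂ H b) = inner ℂ b a := by
  change inner ℂ ((InnerProductSpace.toDual ℂ H).symm _) ((InnerProductSpace.toDual ℂ H).symm _) = _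
  simp

theorem transpose_mul (x y : H →L[ℂ] H) : transpose (x * y) = transpose y * transpose x := rfl

theorem transpose_one : transpose (1 : H →L[ℂ] H) = 1 := rfl

theorem star_transpose (x : H →L[ℂ] H) : star (transpose x) = transpose (star x) := by
  ext1 f
  obtain ⟨a, rfl⟩ := (InnerProductSpace.toDual ℂ H).surjective f
  refine ext_inner_left ℂ fun f => ?_
  obtain ⟨b, rfl⟩ := (InnerProductSpace.toDual ℂ H).surjective f
  rw [ContinuousLinearMap.star_eq_adjoint, ContinuousLinearMap.adjoint_inner_right,
    transpose_toDual, transpose_toDual, inner_toDual_toDual, inner_toDual_toDual, star_star,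
    ContinuousLinearMap.star_eq_adjoint, ContinuousLinearMap.adjoint_inner_right]

/-- The representation `g ↦ u g ⊗ (u g⁻¹)^op`. -/
def doubleRep {G : Type*} [Group G] (u : G →* (H →L[ℂ] H)) :
    G →* (HilbertTensor H (StrongDual ℂ H) →L[ℂ] HilbertTensor H (StrongDual ℂ H)) where
  toFun g := tensorOp (u g) (transpose (u g⁻¹))
  map_one' := by simp [transpose_one, tensorOp_one]
  map_mul' g h := by rw [tensorOp_mul, ← transpose_mul, mul_inv_rev, map_mul, map_mul]

theorem doubleRep_apply {G : Type*} [Group G] (u : G →* (H →L[ℂ] H)) (g : G) :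
    doubleRep u g = tensorOp (u g) (transpose (u g⁻¹)) := rfl

theorem star_doubleRep {G : Type*} [Group G] (u : G →* (H →L[ℂ] H))
    (hu : ∀ g, star (u g) = u g⁻¹) (g : G) : star (doubleRep u g) = doubleRep u g⁻¹ := by
  rw [doubleRep_apply, doubleRep_apply, star_tensorOp, star_transpose, hu, hu]

end TensorOps

/-! ### The product functional of the trace on the tensor product -/

section Functional

variable {H : Type*} [NormedAddCommGroup H] [InnerProductSpace ℂ H] [CompleteSpace H]

theorem summable_norm_mul_norm {E : Type*} [SeminormedAddCommGroup E] {ξ η : ℕ → E}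
    (hξ : Summable fun n => ‖ξ n‖ ^ 2)
    (hη : Summable fun n => ‖η n‖ ^ 2) : Summable fun n => ‖ξ n‖ * ‖η n‖ := by
  refine Summable.of_nonneg_of_le (fun n => by positivity) (fun n => ?_) (hξ.add hη)
  nlinarith [sq_nonneg (‖ξ n‖ - ‖η n‖), sq_nonneg ‖ξ n‖, sq_nonneg ‖η n‖]

theorem exists_clm_hasSum {X ι : Type*} [NormedAddCommGroup X] [NormedSpace ℂ X]
    (F : ι → X →L[ℂ] ℂ) (h : Summable fun p => ‖F p‖) :
    ∃ Φ : X →L[ℂ] ℂ, ∀ x, HasSum (fun p => F p x) (Φ x) :=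
  ⟨∑' p, F p, fun x => (ContinuousLinearMap.apply ℂ ℂ x).hasSum h.of_norm.hasSum⟩

/-- The vector functional `X ↦ ⟪a, X b⟫`. -/
def vectorFunctional {E : Type*} [NormedAddCommGroup E] [InnerProductSpace ℂ E] (a b : E) :
    (E →L[ℂ] E) →L[ℂ] ℂ :=
  LinearMap.mkContinuous
    { toFun := fun X => inner ℂ a (X b)
      map_add' := fun X Y => by rw [_root_.add_apply, inner_add_right]
      map_smul' := fun c X => by
        rw [_root_.smul_apply, inner_smul_right]; rfl } (‖a‖ * ‖b‖) (fun X => by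
    change ‖inner ℂ a (X b)‖ ≤ _
    refine (norm_inner_le_norm _ _).trans ?_
    calc _ ≤ ‖a‖ * (‖X‖ * ‖b‖) := by gcongr; exact X.le_opNorm _
      _ = _ := by ring)

theorem norm_vectorFunctional_le {E : Type*} [NormedAddCommGroup E] [InnerProductSpace ℂ E]
    (a b : E) : ‖vectorFunctional a b‖ ≤ ‖a‖ * ‖b‖ :=
  LinearMap.mkContinuous_norm_le _ (by positivity) _

theorem exists_functional_hasSum {E : Type*} [NormedAddCommGroup E] [InnerProductSpace ℂ E]
    {ι : Type*} (α β : ι → E) (h : Summable fun p => ‖α p‖ * ‖β p‖) :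
    ∃ Φ : (E →L[ℂ] E) →L[ℂ] ℂ,
      ∀ X : E →L[ℂ] E, HasSum (fun p => inner ℂ (α p) (X (β p))) (Φ X) :=
  exists_clm_hasSum (fun p => vectorFunctional (α p) (β p))
    (h.of_nonneg_of_le (fun _ => norm_nonneg _) fun _ => norm_vectorFunctional_le _ _)

theorem summable_norm_inner {E : Type*} [NormedAddCommGroup E] [InnerProductSpace ℂ E] {α β : ℕ → E}
    (h : Summable fun n => ‖α n‖ * ‖β n‖) (z : E →L[ℂ] E) :
    Summable fun n => ‖inner ℂ (α n) (z (β n))‖ := by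
  refine Summable.of_nonneg_of_le (fun _ => norm_nonneg _) (fun n => ?_) (h.mul_left ‖z‖)
  refine (norm_inner_le_norm _ _).trans ?_
  calc _ ≤ ‖α n‖ * (‖z‖ * ‖β n‖) := by gcongr; exact z.le_opNorm _
    _ = _ := by ring

theorem summable_norm_elemVec {K : Type*} [NormedAddCommGroup K] [InnerProductSpace ℂ K]
    [CompleteSpace K] {ξ η : ℕ → H} {ξ' η' : ℕ → K} (hs : Summable fun n => ‖ξ n‖ * ‖η n‖)
    (hs' : Summable fun n => ‖ξ' n‖ * ‖η' n‖) :
    Summable fun p : ℕ × ℕ => ‖elemVec (ξ p.1) (ξ' p.2)‖ * ‖elemVec (η p.1) (η' p.2)‖ := by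
  have h := hs.mul_of_nonneg hs' (fun n => mul_nonneg (norm_nonneg _) (norm_nonneg _))
    (fun n => mul_nonneg (norm_nonneg _) (norm_nonneg _))
  have he : ∀ p : ℕ × ℕ, ‖elemVec (ξ p.1) (ξ' p.2)‖ * ‖elemVec (η p.1) (η' p.2)‖ =
      ‖ξ p.1‖ * ‖η p.1‖ * (‖ξ' p.2‖ * ‖η' p.2‖) := fun p => by
    rw [norm_elemVec, norm_elemVec, mul_mul_mul_comm]
  rw [funext he]
  exact h

theorem hasSum_mul_of_summable_norm {f g : ℕ → ℂ} {s t : ℂ} (hf : HasSum f s) (hg : HasSum g t)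
    (hf' : Summable fun n => ‖f n‖) (hg' : Summable fun n => ‖g n‖) :
    HasSum (fun p : ℕ × ℕ => f p.1 * g p.2) (s * t) := by
  have h : Summable fun p : ℕ × ℕ => f p.1 * g p.2 := summable_mul_of_summable_norm hf' hg'
  have h' := HasSum.mul hf hg h
  exact h'

theorem hasSum_inner_elemVec {K : Type*} [NormedAddCommGroup K] [InnerProductSpace ℂ K]
    [CompleteSpace K] {ξ η : ℕ → H} {ξ' η' : ℕ → K} (x : H →L[ℂ] H) (y : K →L[ℂ] K) {s t : ℂ}
    (hx : HasSum (fun n => inner ℂ (ξ n) (x (η n))) s)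
    (hy : HasSum (fun n => inner ℂ (ξ' n) (y (η' n))) t)
    (hx' : Summable fun n => ‖inner ℂ (ξ n) (x (η n))‖)
    (hy' : Summable fun n => ‖inner ℂ (ξ' n) (y (η' n))‖) :
    HasSum (fun p : ℕ × ℕ => inner ℂ (elemVec (ξ p.1) (ξ' p.2))
      (tensorOp x y (elemVec (η p.1) (η' p.2)))) (s * t) := by
  have he : ∀ p : ℕ × ℕ, inner ℂ (elemVec (ξ p.1) (ξ' p.2))
      (tensorOp x y (elemVec (η p.1) (η' p.2))) =
      inner ℂ (ξ p.1) (x (η p.1)) * inner ℂ (ξ' p.2) (y (η' p.2)) := fun p => by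
    rw [tensorOp_elemVec, inner_elemVec]
  rw [funext he]
  have h := hasSum_mul_of_summable_norm hx hy hx' hy'
  exact h

theorem exists_functional_tensorOp {K : Type*} [NormedAddCommGroup K] [InnerProductSpace ℂ K]
    [CompleteSpace K] {ξ η : ℕ → H} {ξ' η' : ℕ → K} (hξ : Summable fun n => ‖ξ n‖ ^ 2)
    (hη : Summable fun n => ‖η n‖ ^ 2) (hξ' : Summable fun n => ‖ξ' n‖ ^ 2)
    (hη' : Summable fun n => ‖η' n‖ ^ 2) :
    ∃ Φ : (HilbertTensor H K →L[ℂ] HilbertTensor H K) →L[ℂ] ℂ,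
      ∀ (x : H →L[ℂ] H) (y : K →L[ℂ] K) (s t : ℂ),
        HasSum (fun n => inner ℂ (ξ n) (x (η n))) s →
        HasSum (fun n => inner ℂ (ξ' n) (y (η' n))) t → Φ (tensorOp x y) = s * t := by
  have hs := summable_norm_mul_norm hξ hη
  have hs' := summable_norm_mul_norm hξ' hη'
  obtain ⟨Φ, hΦ⟩ := exists_functional_hasSum
    (fun p : ℕ × ℕ => elemVec (ξ p.1) (ξ' p.2)) (fun p : ℕ × ℕ => elemVec (η p.1) (η' p.2)) 
    (summable_norm_elemVec hs hs')
  exact ⟨Φ, fun x y s t h1 h2 => (hΦ (tensorOp x y)).unique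
    (hasSum_inner_elemVec x y h1 h2 (summable_norm_inner hs x) (summable_norm_inner hs' y))⟩

/-- Normality gives τ as a sum of vector functionals, so τ ⊗ τ^op is an absolutely convergent double
sum of them. On the dual space ξ and η exchange roles, because the Riesz map is antilinear. -/
theorem exists_functional_doubleRep {M : VonNeumannAlgebra H} {τ : M.toStarSubalgebra →ₗ[ℂ] ℂ}
    (hτ : IsNormalFaithfulTracialState M τ) :
    ∃ Φ : (HilbertTensor H (StrongDual ℂ H) →L[ℂ] HilbertTensor H (StrongDual ℂ H)) →L[ℂ] ℂ,
      ∀ x y : M.toStarSubalgebra,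
        Φ (tensorOp (x : H →L[ℂ] H) (transpose (y : H →L[ℂ] H))) = τ x * τ y := by
  obtain ⟨ξ, η, hξ, hη, hsum⟩ := hτ.normal
  have hd : ∀ {α : ℕ → H}, (Summable fun n => ‖α n‖ ^ 2) →
      Summable fun n => ‖InnerProductSpace.toDual ℂ H (α n)‖ ^ 2 := fun h => by
    simpa only [LinearIsometryEquiv.norm_map] using h
  obtain ⟨Φ, hΦ⟩ := exists_functional_tensorOp hξ hη (hd hη) (hd hξ)
  refine ⟨Φ, fun x y => hΦ _ _ _ _ (hsum x) ?_⟩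
  have h3 : ∀ n, inner ℂ (InnerProductSpace.toDual ℂ H (η n))
      (transpose (y : H →L[ℂ] H) (InnerProductSpace.toDual ℂ H (ξ n))) =
      inner ℂ (ξ n) ((y : H →L[ℂ] H) (η n)) := by
    intro n
    rw [transpose_toDual, inner_toDual_toDual,
      ContinuousLinearMap.star_eq_adjoint, ContinuousLinearMap.adjoint_inner_left]
  rw [funext h3]
  exact hsum y

end Functional

/-! ### The tensor norm as the norm of a spherical sum -/

section TensorNorm

variable {H : Type*} [NormedAddCommGroup H] [InnerProductSpace ℂ H] [CompleteSpace H]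
  (M : VonNeumannAlgebra H)

/-- The representation of the free group given by two unitaries of `M`. -/
def unitaryRep (u : Fin 2 → unitary M.toStarSubalgebra) :
    FreeGroup (Fin 2) →* M.toStarSubalgebra :=
  (unitary M.toStarSubalgebra).subtype.comp (FreeGroup.lift u)

/-- The representation of the free group on `H` given by two unitaries of `M`. -/
def unitaryRepOp (u : Fin 2 → unitary M.toStarSubalgebra) :
    FreeGroup (Fin 2) →* (H →L[ℂ] H) :=
  (M.toStarSubalgebra.subtype : M.toStarSubalgebra →* (H →L[ℂ] H)).comp (unitaryRep M u)

variable {M}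

theorem coe_unitaryRep (u : Fin 2 → unitary M.toStarSubalgebra) (g : FreeGroup (Fin 2)) :
    ((unitaryRep M u g : M.toStarSubalgebra) : H →L[ℂ] H) = unitaryRepOp M u g := rfl

theorem unitaryRep_of (u : Fin 2 → unitary M.toStarSubalgebra) (i : Fin 2) :
    unitaryRep M u (FreeGroup.of i) = u i := by
  simp [unitaryRep]

theorem star_unitaryRep (u : Fin 2 → unitary M.toStarSubalgebra) (g : FreeGroup (Fin 2)) :
    star (unitaryRep M u g) = unitaryRep M u g⁻¹ := by
  simp only [unitaryRep, MonoidHom.comp_apply, map_inv]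
  rfl

theorem star_unitaryRepOp (u : Fin 2 → unitary M.toStarSubalgebra) (g : FreeGroup (Fin 2)) :
    star (unitaryRepOp M u g) = unitaryRepOp M u g⁻¹ :=
  congrArg Subtype.val (star_unitaryRep u g)

theorem coe_elemTensor_star_op (x y : M.toStarSubalgebra) :
    ((elemTensor x (star (op y)) : (vnTensor M (opposite M)).toStarSubalgebra) :
      HilbertTensor H (StrongDual ℂ H) →L[ℂ] HilbertTensor H (StrongDual ℂ H)) =
    tensorOp (x : H →L[ℂ] H) (transpose (star (y : H →L[ℂ] H))) := by
  rw [← star_transpose]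
  rfl

theorem coe_elemTensor_op (x y : M.toStarSubalgebra) :
    ((elemTensor x (op y) : (vnTensor M (opposite M)).toStarSubalgebra) :
      HilbertTensor H (StrongDual ℂ H) →L[ℂ] HilbertTensor H (StrongDual ℂ H)) =
    tensorOp (x : H →L[ℂ] H) (transpose (y : H →L[ℂ] H)) := rfl

theorem norm_eq_of_coe_eq {E : Type*} [NormedAddCommGroup E] [InnerProductSpace ℂ E]
    [CompleteSpace E] {N : VonNeumannAlgebra E} {ι : Type*} (s : Finset ι)
    (z w : ι → N.toStarSubalgebra) (Z W : ι → E →L[ℂ] E) (hz : ∀ i, (z i : E →L[ℂ] E) = Z i)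
    (hw : ∀ i, (w i : E →L[ℂ] E) = W i) :
    ‖∑ i ∈ s, (z i + w i)‖ = ‖∑ i ∈ s, (Z i + W i)‖ := by
  have : ((∑ i ∈ s, (z i + w i) : N.toStarSubalgebra) : E →L[ℂ] E) = ∑ i ∈ s, (Z i + W i) := by
    rw [AddSubmonoidClass.coe_finsetSum]
    exact Finset.sum_congr rfl fun i _ => by rw [← hz, ← hw]; rfl
  rw [← this]
  rfl

theorem sphereSum_one_eq {A : Type*} [Semiring A] (π : FreeGroup (Fin 2) →* A) :
    sphereSum π 1 = ∑ i, (π (FreeGroup.of i) + π (FreeGroup.of i)⁻¹) := by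
  rw [sphereSum_succ, Fintype.sum_prod_type]
  simp only [coneSum_zero, Fintype.sum_bool]
  rfl

theorem tensorNorm_eq (u : Fin 2 → unitary M.toStarSubalgebra) :
    tensorNorm M u = ‖sphereSum (doubleRep (unitaryRepOp M u)) 1‖ := by
  have h3 : ∀ i, unitaryRepOp M u (FreeGroup.of i) = ((u i : M.toStarSubalgebra) : H →L[ℂ] H) :=
    fun i => congrArg Subtype.val (unitaryRep_of u i)
  have h4 : ∀ i, unitaryRepOp M u (FreeGroup.of i)⁻¹ =
      star ((u i : M.toStarSubalgebra) : H →L[ℂ] H) := fun i => by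
    rw [← star_unitaryRepOp, h3]
  rw [sphereSum_one_eq]
  refine norm_eq_of_coe_eq _ _ _ _ _ (fun i => ?_) (fun i => ?_)
  · rw [coe_elemTensor_star_op, doubleRep_apply, h3, h4]
  · rw [coe_elemTensor_op, doubleRep_apply, inv_inv, h3, h4]
    rfl

end TensorNorm

/-! ### Bessel families -/

section Bessel

variable {E : Type*} [NormedAddCommGroup E] [InnerProductSpace ℂ E] {ι : Type*}

/-- The family `θ` satisfies the Bessel inequality with constant `C`. -/
def IsBessel (θ : ι → E) (C : ℝ) : Prop :=
  ∀ (s : Finset ι) (k : E), ∑ i ∈ s, ‖inner ℂ (θ i) k‖ ^ 2 ≤ (C * ‖k‖) ^ 2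

theorem IsBessel.memℓp {θ : ι → E} {C : ℝ} (h : IsBessel θ C) (k : E) :
    Memℓp (fun i => inner ℂ (θ i) k : ι → ℂ) 2 := by
  refine memℓp_gen' (C := (C * ‖k‖) ^ 2) fun s => ?_
  simpa using h s k

/-- The coefficient map of a Bessel family. -/
def IsBessel.coeff {θ : ι → E} {C : ℝ} (h : IsBessel θ C) : E →L[ℂ] lp (fun _ : ι => ℂ) 2 :=
  LinearMap.mkContinuous
    { toFun := fun k => ⟨fun i => inner ℂ (θ i) k, h.memℓp k⟩
      map_add' := fun k k' => by ext i; exact inner_add_right _ _ _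
      map_smul' := fun c k => by ext i; exact inner_smul_right _ _ _ } |C| (fun k => by
    refine lp.norm_le_of_forall_sum_le (by norm_num) (by positivity) fun s => ?_
    have := h s k
    rw [← sq_abs, abs_mul, abs_norm] at this
    simpa using this)

theorem IsBessel.coeff_apply {θ : ι → E} {C : ℝ} (h : IsBessel θ C) (k : E) (i : ι) :
    h.coeff k i = inner ℂ (θ i) k := rfl

/-- The vectors θ i lie in the closure of the range of L, so k may be projected onto it. There the
inequality follows by continuity. -/
theorem isBessel_of_range [CompleteSpace E] {V : Type*} [AddCommGroup V] [Module ℂ V]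
    (L : V →ₗ[ℂ] E) {θ : ι → E} (hθ : ∀ i, θ i ∈ (LinearMap.range L).topologicalClosure)
    (h : ∀ (s : Finset ι) (v : V), ∑ i ∈ s, ‖inner ℂ (θ i) (L v)‖ ^ 2 ≤ ‖L v‖ ^ 2) :
    IsBessel θ 1 := by
  intro s k
  rw [one_mul]
  set Q := (LinearMap.range L).topologicalClosure with hQ
  haveI : CompleteSpace Q := (Submodule.isClosed_topologicalClosure _).completeSpace_coe
  have hcl : ∀ q ∈ Q, ∑ i ∈ s, ‖inner ℂ (θ i) q‖ ^ 2 ≤ ‖q‖ ^ 2 := by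
    intro q hq
    have hclosed : IsClosed {q : E | ∑ i ∈ s, ‖inner ℂ (θ i) q‖ ^ 2 ≤ ‖q‖ ^ 2} :=
      isClosed_le (by fun_prop) (by fun_prop)
    refine closure_minimal ?_ hclosed hq
    rintro _ ⟨v, rfl⟩
    exact h s v
  have hP : ∀ i, inner ℂ (θ i) k = inner ℂ (θ i) (Q.starProjection k) := fun i => by
    rw [← Submodule.inner_starProjection_left_eq_right, Submodule.starProjection_eq_self_iff.2 (hθ i)]
  simp only [hP]
  refine (hcl _ (Submodule.starProjection_apply_mem _ _)).trans ?_
  gcongr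
  exact Submodule.norm_starProjection_apply_le _ _

/-- The bound lets τ descend to a bounded functional on the range of L; Hahn–Banach and Riesz
represent it. The projection onto the closure places θ there without changing the values. -/
theorem exists_inner_eq_of_norm_le [CompleteSpace E] {V : Type*} [AddCommGroup V] [Module ℂ V]
    (L : V →ₗ[ℂ] E) (τ : V →ₗ[ℂ] ℂ) (h : ∀ v, ‖τ v‖ ≤ ‖L v‖) :
    ∃ θ ∈ (LinearMap.range L).topologicalClosure, ∀ v, inner ℂ θ (L v) = τ v := by
  set Q := (LinearMap.range L).topologicalClosure with hQ
  haveI : CompleteSpace Q := (Submodule.isClosed_topologicalClosure _).completeSpace_coe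
  have hker : LinearMap.ker L ≤ LinearMap.ker τ := fun v hv => by
    have := h v
    rw [LinearMap.mem_ker.1 hv, norm_zero] at this
    exact norm_le_zero_iff.1 this
  let f : LinearMap.range L →ₗ[ℂ] ℂ :=
    ((LinearMap.ker L).liftQ τ hker).comp L.quotKerEquivRange.symm.toLinearMap
  have hf : ∀ v, f ⟨L v, v, rfl⟩ = τ v := fun v => by
    change (LinearMap.ker L).liftQ τ hker (L.quotKerEquivRange.symm ⟨L v, v, rfl⟩) = τ v
    rw [L.quotKerEquivRange_symm_apply_image v ⟨v, rfl⟩]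
    rfl
  let F : StrongDual ℂ (LinearMap.range L) := f.mkContinuous 1 (by
    rintro ⟨_, v, rfl⟩
    rw [hf, one_mul]
    exact h v)
  obtain ⟨g, hg, -⟩ := exists_extension_norm_eq (LinearMap.range L) F
  refine ⟨Q.starProjection ((InnerProductSpace.toDual ℂ E).symm g),
    Submodule.starProjection_apply_mem _ _, fun v => ?_⟩
  have hv : L v ∈ Q := Submodule.le_topologicalClosure _ ⟨v, rfl⟩
  rw [Submodule.inner_starProjection_left_eq_right, Submodule.starProjection_eq_self_iff.2 hv,
    InnerProductSpace.toDual_symm_apply]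
  exact (hg ⟨L v, v, rfl⟩).trans (hf v)

end Bessel

/-! ### Trace vectors -/

section TraceVectors

variable {H : Type*} [NormedAddCommGroup H] [InnerProductSpace ℂ H] [CompleteSpace H]

variable (H) in
/-- Square summable sequences of vectors of `H`. -/
abbrev SeqSpace : Type _ := lp (fun _ : ℕ => H) 2

/-- The diagonal action of an operator on sequences. -/
def diag (x : H →L[ℂ] H) : SeqSpace H →L[ℂ] SeqSpace H :=
  lp.mapCLM 2 (fun _ => x) (norm_nonneg x) (fun _ => le_rfl)

theorem diag_apply (x : H →L[ℂ] H) (v : SeqSpace H) (n : ℕ) : diag x v n = x (v n) := rfl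

theorem inner_diag_left (x : H →L[ℂ] H) (v w : SeqSpace H) :
    inner ℂ (diag x v) w = inner ℂ v (diag (star x) w) := by
  rw [lp.inner_eq_tsum, lp.inner_eq_tsum]
  refine tsum_congr fun n => ?_
  rw [diag_apply, diag_apply, ContinuousLinearMap.star_eq_adjoint,
    ContinuousLinearMap.adjoint_inner_right]

theorem re_inner_le_norm_half_add_sq {E : Type*} [NormedAddCommGroup E] [InnerProductSpace ℂ E]
    (p q : E) : (inner ℂ p q).re ≤ ‖(2⁻¹ : ℂ) • (p + q)‖ ^ 2 := by
  have h1 := norm_add_sq (𝕜 := ℂ) p q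
  have h2 := norm_sub_sq (𝕜 := ℂ) p q
  have h3 : ‖(2⁻¹ : ℂ) • (p + q)‖ ^ 2 = ‖p + q‖ ^ 2 / 4 := by
    rw [norm_smul, mul_pow]; norm_num; ring
  rw [h3]
  simp only [RCLike.re_to_complex] at h1 h2
  nlinarith [sq_nonneg ‖p - q‖]

variable {M : VonNeumannAlgebra H} {τ : M.toStarSubalgebra →ₗ[ℂ] ℂ}

theorem IsNormalFaithfulTracialState.isTracialState (hτ : IsNormalFaithfulTracialState M τ) :
    IsTracialState τ := ⟨hτ.map_one, hτ.nonneg, hτ.tracial⟩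

/-- Applying the elements of `M` to a sequence of vectors. -/
def orbitMap (M : VonNeumannAlgebra H) (ψ : SeqSpace H) : M.toStarSubalgebra →ₗ[ℂ] SeqSpace H where
  toFun y := diag (y : H →L[ℂ] H) ψ
  map_add' _ _ := rfl
  map_smul' _ _ := rfl

theorem orbitMap_apply (ψ : SeqSpace H) (y : M.toStarSubalgebra) :
    orbitMap M ψ y = diag (y : H →L[ℂ] H) ψ := rfl

theorem diag_mem_closure_range_orbitMap (ψ : SeqSpace H) (x : M.toStarSubalgebra) {θ : SeqSpace H}
    (hθ : θ ∈ (LinearMap.range (orbitMap M ψ)).topologicalClosure) :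
    diag (x : H →L[ℂ] H) θ ∈ (LinearMap.range (orbitMap M ψ)).topologicalClosure := by
  refine map_mem_closure (diag (x : H →L[ℂ] H)).continuous hθ ?_
  rintro _ ⟨y, rfl⟩
  exact ⟨x * y, rfl⟩

/-- If τ is given by sequences ξ and η, then τ(y*y) = Re⟨yξ, yη⟩ ≤ ‖y(ξ+η)/2‖², so ψ = (ξ+η)/2
works. -/
theorem IsNormalFaithfulTracialState.exists_dominating (hτ : IsNormalFaithfulTracialState M τ) :
    ∃ ψ : SeqSpace H, ∀ y, (τ (star y * y)).re ≤ ‖orbitMap M ψ y‖ ^ 2 := by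
  obtain ⟨ξ, η, hξ, hη, hsum⟩ := hτ.normal
  let ξ' : SeqSpace H := ⟨ξ, memℓp_gen (by simpa using hξ)⟩
  let η' : SeqSpace H := ⟨η, memℓp_gen (by simpa using hη)⟩
  refine ⟨(2⁻¹ : ℂ) • (ξ' + η'), fun y => ?_⟩
  have h1 : τ (star y * y) = inner ℂ (diag (y : H →L[ℂ] H) ξ') (diag (y : H →L[ℂ] H) η') := by
    have h2 : inner ℂ (diag (y : H →L[ℂ] H) ξ') (diag (y : H →L[ℂ] H) η') =
        inner ℂ ξ' (diag ((star y * y : M.toStarSubalgebra) : H →L[ℂ] H) η') :=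
      inner_diag_left _ _ _
    have h3 := lp.hasSum_inner (𝕜 := ℂ) ξ' (diag ((star y * y : M.toStarSubalgebra) : H →L[ℂ] H) η')
    have h4 := hsum (star y * y)
    rw [h2]
    exact h4.unique h3
  rw [h1, orbitMap_apply, map_smul, map_add]
  exact re_inner_le_norm_half_add_sq _ _

theorem IsNormalFaithfulTracialState.exists_traceVectors (hτ : IsNormalFaithfulTracialState M τ) :
    ∃ ψ : SeqSpace H, ∃ θ ∈ (LinearMap.range (orbitMap M ψ)).topologicalClosure,
      (∀ y, inner ℂ θ (orbitMap M ψ y) = τ y) ∧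
      ∀ y, (τ (star y * y)).re ≤ ‖orbitMap M ψ y‖ ^ 2 := by
  obtain ⟨ψ, hψ⟩ := hτ.exists_dominating
  obtain ⟨θ, hθ, h⟩ := exists_inner_eq_of_norm_le (orbitMap M ψ) τ fun y => by
    have h1 := hτ.isTracialState.norm_map_le y
    refine h1.trans ?_
    rw [← Real.sqrt_sq (norm_nonneg (orbitMap M ψ y))]
    exact Real.sqrt_le_sqrt (hψ y)
  exact ⟨ψ, θ, hθ, h, hψ⟩

variable {G : Type*} [Group G] {u : G →* M.toStarSubalgebra}

/-- Against yψ the coefficients of u_g θ are τ(u_g* y). The u_g are orthonormal for the trace, so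
Bessel bounds their square sum by τ(y*y) ≤ ‖yψ‖². -/
theorem isBessel_diag (hτ : IsNormalFaithfulTracialState M τ) (hu : ∀ g, star (u g) = u g⁻¹)
    (h0 : ∀ g, g ≠ 1 → τ (u g) = 0) {ψ θ : SeqSpace H}
    (hθ : θ ∈ (LinearMap.range (orbitMap M ψ)).topologicalClosure)
    (h : ∀ y, inner ℂ θ (orbitMap M ψ y) = τ y)
    (hψ : ∀ y, (τ (star y * y)).re ≤ ‖orbitMap M ψ y‖ ^ 2) :
    IsBessel (fun g => diag (u g : H →L[ℂ] H) θ) 1 := by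
  refine isBessel_of_range (orbitMap M ψ) (fun g => diag_mem_closure_range_orbitMap _ _ hθ) ?_
  intro s y
  have h1 : ∀ g, inner ℂ (diag (u g : H →L[ℂ] H) θ) (orbitMap M ψ y) = τ (star (u g) * y) := by
    intro g
    rw [inner_diag_left, ← h]
    rfl
  simp only [h1]
  refine (hτ.isTracialState.sum_norm_sq_le s u (fun g => ?_) (fun g g' hg => ?_) y).trans (hψ y)
  · rw [hu, ← map_mul, inv_mul_cancel, map_one, hτ.map_one]
  · rw [hu, ← map_mul]
    exact h0 _ fun h' => hg (inv_mul_eq_one.1 h')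

/-- Vectors with square summable coefficients. -/
def boundedVectors (u : G → H →L[ℂ] H) : Set H := {x | ∃ C, IsBessel (fun g => u g x) C}

theorem isBessel_apply {θ : SeqSpace H} {v : G → H →L[ℂ] H} {C : ℝ}
    (h : IsBessel (fun g => diag (v g) θ) C) (n : ℕ) : IsBessel (fun g => v g (θ n)) C := by
  intro s k
  have := h s (lp.single 2 n k)
  simpa only [lp.inner_single_right, diag_apply, lp.norm_single (p := 2) (by norm_num)] using this

/-- Operators of the commutant preserve the Bessel property; this is how the few vectors θ n yield a
total set. -/
theorem IsBessel.of_commute {v : G → H →L[ℂ] H} {C : ℝ} {x : H} (h : IsBessel (fun g => v g x) C)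
    {a : H →L[ℂ] H} (ha : ∀ g, v g * a = a * v g) :
    IsBessel (fun g => v g (a x)) (|C| * ‖star a‖) := by
  intro s k
  have h1 : ∀ g, inner ℂ (v g (a x)) k = inner ℂ (v g x) (star a k) := fun g => by
    rw [ContinuousLinearMap.star_eq_adjoint, ContinuousLinearMap.adjoint_inner_right]
    exact congrArg (inner ℂ · k) (congrArg (fun z : H →L[ℂ] H => z x) (ha g))
  simp only [h1]
  refine (h s _).trans ?_
  rw [← sq_abs, abs_mul, abs_norm, mul_assoc]
  gcongr
  exact (star a).le_opNorm k

theorem exists_mem_boundedVectors (hτ : IsNormalFaithfulTracialState M τ)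
    (hu : ∀ g, star (u g) = u g⁻¹) (h0 : ∀ g, g ≠ 1 → τ (u g) = 0) :
    ∃ ψ θ : SeqSpace H, (∀ y : M.toStarSubalgebra, inner ℂ θ (orbitMap M ψ y) = τ y) ∧
      IsBessel (fun g => diag (u g : H →L[ℂ] H) θ) 1 := by
  obtain ⟨ψ, θ, hθ, h, hψ⟩ := hτ.exists_traceVectors
  exact ⟨ψ, θ, h, isBessel_diag hτ hu h0 hθ h hψ⟩

/-- The projection e onto the closed span of M'θ lies in M'' = M and fixes θ, so τ(1 - e) = 0.
Faithfulness gives e = 1, that is, M'θ is total. -/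
theorem eq_zero_of_forall_inner_commutant (hτ : IsNormalFaithfulTracialState M τ)
    {ψ θ : SeqSpace H} (h : ∀ y : M.toStarSubalgebra, inner ℂ θ (orbitMap M ψ y) = τ y) {v : H}
    (hv : ∀ a ∈ M.commutant, ∀ n, inner ℂ (a (θ n)) v = 0) : v = 0 := by
  let S : Submodule ℂ H := (Submodule.span ℂ {x | ∃ a ∈ M.commutant, ∃ n, x = a (θ n)})
  let Q := S.topologicalClosure
  haveI : CompleteSpace Q := (Submodule.isClosed_topologicalClosure _).completeSpace_coe
  let e := Q.starProjection
  have he : IsStarProjection e := isStarProjection_starProjection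
  have heM : e ∈ M := by
    rw [VonNeumannAlgebra.IsStarProjection.mem_iff he]
    intro y hy
    have hr : (e : H →L[ℂ] H).range = Q := Submodule.range_starProjection Q
    rw [hr, Module.End.mem_invtSubmodule]
    intro q hq
    rw [Submodule.mem_comap]
    refine map_mem_closure y.continuous hq ?_
    intro x hx
    induction hx using Submodule.span_induction with
    | mem x hx =>
      obtain ⟨a, ha, n, rfl⟩ := hx
      exact Submodule.subset_span ⟨y * a, mul_mem hy ha, n, rfl⟩
    | zero => rw [map_zero]; exact Submodule.zero_mem _
    | add x y _ _ hx hy => rw [map_add]; exact Submodule.add_mem _ hx hy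
    | smul c x _ hx => rw [map_smul]; exact Submodule.smul_mem _ _ hx
  let e' : M.toStarSubalgebra := ⟨e, heM⟩
  have hs : star e' = e' := Subtype.ext he.isSelfAdjoint
  have hi : e' * e' = e' := Subtype.ext he.isIdempotentElem
  have heθ : diag e θ = θ := by
    ext n
    rw [diag_apply]
    refine Submodule.starProjection_eq_self_iff.2 (Submodule.le_topologicalClosure _ ?_)
    exact Submodule.subset_span ⟨1, one_mem _, n, rfl⟩
  have hτe : τ (star (1 - e') * (1 - e')) = 0 := by
    have h1 : star (1 - e') * (1 - e') = 1 - e' := by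
      rw [star_sub, star_one, hs, mul_sub, sub_mul, sub_mul, hi]; simp
    have h2 : τ e' = τ 1 := by
      rw [← h, ← h, orbitMap_apply, orbitMap_apply]
      change inner ℂ θ (diag e ψ) = inner ℂ θ ψ
      have h3 : inner ℂ (diag e θ) ψ = inner ℂ θ (diag (star e) ψ) := inner_diag_left _ _ _
      rw [heθ, he.isSelfAdjoint.star_eq] at h3
      exact h3.symm
    rw [h1, map_sub, h2, sub_self]
  have h1 : e' = 1 := (sub_eq_zero.1 (hτ.faithful _ hτe)).symm
  have hvQ : v ∈ Q := by
    have : e v = v := congrArg (fun z : M.toStarSubalgebra => (z : H →L[ℂ] H) v) h1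
    exact Submodule.starProjection_eq_self_iff.1 this
  have hort : ∀ x ∈ Q, inner ℂ x v = 0 := by
    intro x hx
    have hclosed : IsClosed {x : H | inner ℂ x v = 0} := isClosed_eq (by fun_prop) continuous_const
    refine closure_minimal ?_ hclosed hx
    intro x hx
    change inner ℂ x v = 0
    induction hx using Submodule.span_induction with
    | mem x hx => obtain ⟨a, ha, n, rfl⟩ := hx; exact hv a ha n
    | zero => rw [inner_zero_left]
    | add x y _ _ hx hy => rw [inner_add_left, hx, hy, add_zero]
    | smul c x _ hx => rw [inner_smul_left, hx, mul_zero]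
  exact inner_self_eq_zero.1 (hort v hvQ)

theorem eq_zero_of_forall_boundedVectors (hτ : IsNormalFaithfulTracialState M τ)
    (hu : ∀ g, star (u g) = u g⁻¹) (h0 : ∀ g, g ≠ 1 → τ (u g) = 0) {v : H}
    (hv : ∀ x ∈ boundedVectors (fun g => (u g : H →L[ℂ] H)), inner ℂ x v = 0) : v = 0 := by
  obtain ⟨ψ, θ, h, hB⟩ := exists_mem_boundedVectors hτ hu h0
  refine eq_zero_of_forall_inner_commutant hτ h fun a ha n => hv _ ?_
  exact ⟨_, (isBessel_apply hB n).of_commute fun g =>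
    VonNeumannAlgebra.mem_commutant_iff.1 ha _ (u g).2⟩

/-- The coefficient map of the whole sequence θ sends u_g ψ to δ_g, because ⟨u_h θ, u_g ψ⟩ = τ(u_h⁻¹
u_g). By linearity and continuity it is governed by the coefficient maps of the entries θ n. -/
theorem eq_zero_of_forall_inner_coeff (hτ : IsNormalFaithfulTracialState M τ)
    (hu : ∀ g, star (u g) = u g⁻¹) (h0 : ∀ g, g ≠ 1 → τ (u g) = 0) {f : ellTwo G}
    (hf : ∀ (x : H) (C : ℝ) (hx : IsBessel (fun g => (u g : H →L[ℂ] H) x) C) (v : H),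
      inner ℂ f (hx.coeff v) = 0) : f = 0 := by
  classical
  obtain ⟨ψ, θ, h, hB⟩ := exists_mem_boundedVectors hτ hu h0
  have hz : (innerSL ℂ f).comp hB.coeff = 0 := by
    refine lp.ext_continuousLinearMap (p := 2) (by norm_num) fun n => ?_
    ext v
    have h1 : hB.coeff (lp.single 2 n v) = (isBessel_apply hB n).coeff v := by
      ext g
      rw [IsBessel.coeff_apply, IsBessel.coeff_apply, lp.inner_single_right, diag_apply]
    change inner ℂ f (hB.coeff (lp.single 2 n v)) = 0
    rw [h1]
    exact hf _ _ _ v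
  ext g
  have h2 : hB.coeff (orbitMap M ψ (u g)) = lp.single 2 g (1 : ℂ) := by
    ext g'
    rw [IsBessel.coeff_apply, inner_diag_left]
    have h3 : diag (star (u g' : H →L[ℂ] H)) (orbitMap M ψ (u g)) =
        orbitMap M ψ (star (u g') * u g) := rfl
    rw [h3, h, hu, ← map_mul, lp.single_apply]
    by_cases hg : g' = g
    · subst hg; simp [hτ.map_one]
    · rw [h0 _ fun h' => hg (inv_mul_eq_one.1 h')]
      simp [hg]
  have h4 : inner ℂ f (lp.single 2 g (1 : ℂ)) = (0 : ℂ) := by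
    rw [← h2]
    exact congrArg (fun F : SeqSpace H →L[ℂ] ℂ => F (orbitMap M ψ (u g))) hz
  rw [lp.inner_single_right] at h4
  simpa using h4

end TraceVectors

/-! ### The upper bound for the norm -/

section LogConvexity

variable {E : Type*} [NormedAddCommGroup E] [InnerProductSpace ℂ E] [CompleteSpace E]

/-- By log-convexity of n ↦ ‖Tⁿζ‖ the successive ratios never fall below r = ‖Tζ‖/‖ζ‖, so ‖Tⁿζ‖
grows at least like rⁿ. The hypothesis at even exponents allows growth at most like ρⁿ. The constant
C disappears in the limit. -/
theorem norm_apply_le_of_norm_inner_pow_le {T : E →L[ℂ] E} (hT : IsSelfAdjoint T) {ζ : E}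
    {C ρ : ℝ} (hρ : 0 < ρ) (h : ∀ n, ‖inner ℂ ζ ((T ^ n) ζ)‖ ≤ C * ρ ^ n) :
    ‖T ζ‖ ≤ ρ * ‖ζ‖ := by
  by_contra! hlt
  have hsym : ∀ x y : E, inner ℂ (T x) y = inner ℂ x (T y) := fun x y => by
    rw [← ContinuousLinearMap.adjoint_inner_right, ← ContinuousLinearMap.star_eq_adjoint,
      hT.star_eq]
  have hpow : ∀ n x, (T ^ (n + 1)) x = T ((T ^ n) x) := fun n x => by
    rw [pow_succ']; rfl
  have hζ : 0 < ‖ζ‖ := by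
    rcases (norm_nonneg ζ).eq_or_lt with h0 | h0
    · rw [norm_eq_zero.1 h0.symm] at hlt; simp at hlt
    · exact h0
  set r := ‖T ζ‖ / ‖ζ‖ with hr
  have hrρ : ρ < r := by rw [hr, lt_div_iff₀ hζ]; exact hlt
  have hr0 : 0 < r := hρ.trans hrρ
  have hstep : ∀ n, 0 < ‖(T ^ n) ζ‖ ∧ r * ‖(T ^ n) ζ‖ ≤ ‖(T ^ (n + 1)) ζ‖ := by
    intro n
    induction n with
    | zero =>
      refine ⟨by simpa using hζ, ?_⟩
      rw [hpow, pow_zero, one_apply_eq_self, hr, div_mul_cancel₀ _ hζ.ne']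
    | succ n ih =>
      have hpos : 0 < ‖(T ^ (n + 1)) ζ‖ := (mul_pos hr0 ih.1).trans_le ih.2
      refine ⟨hpos, ?_⟩
      -- Cauchy–Schwarz with T self-adjoint: the log-convexity.
      have hcs : ‖(T ^ (n + 1)) ζ‖ * ‖(T ^ (n + 1)) ζ‖ ≤ ‖(T ^ n) ζ‖ * ‖(T ^ (n + 1 + 1)) ζ‖ := by
        have h1 : ‖(T ^ (n + 1)) ζ‖ * ‖(T ^ (n + 1)) ζ‖ =
            ‖inner ℂ ((T ^ n) ζ) ((T ^ (n + 1 + 1)) ζ)‖ := by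
          rw [hpow (n + 1), ← hsym, ← hpow, inner_self_eq_norm_sq_to_K]
          simp [sq]
        rw [h1]
        exact norm_inner_le_norm _ _
      have h2 : ‖(T ^ n) ζ‖ * (r * ‖(T ^ (n + 1)) ζ‖) ≤
          ‖(T ^ n) ζ‖ * ‖(T ^ (n + 1 + 1)) ζ‖ := by
        refine le_trans ?_ hcs
        have := mul_le_mul_of_nonneg_right ih.2 hpos.le
        linarith
      exact le_of_mul_le_mul_left h2 ih.1
  have hlow : ∀ n, r ^ n * ‖ζ‖ ≤ ‖(T ^ n) ζ‖ := by
    intro n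
    induction n with
    | zero => simp
    | succ n ih =>
      refine le_trans ?_ (hstep n).2
      rw [pow_succ', mul_assoc]
      gcongr
  have hinner : ∀ n (x y : E), inner ℂ ((T ^ n) x) y = inner ℂ x ((T ^ n) y) := fun n x y => by
    have hTn : star (T ^ n) = T ^ n := (hT.pow n).star_eq
    rw [← ContinuousLinearMap.adjoint_inner_right, ← ContinuousLinearMap.star_eq_adjoint, hTn]
  have hup : ∀ n, (r ^ n * ‖ζ‖) ^ 2 ≤ C * (ρ ^ n) ^ 2 := by
    intro n
    have h1 : ‖(T ^ n) ζ‖ ^ 2 = ‖inner ℂ ζ ((T ^ (n + n)) ζ)‖ := by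
      have : (T ^ (n + n)) ζ = (T ^ n) ((T ^ n) ζ) := by rw [pow_add]; rfl
      rw [this, ← hinner, inner_self_eq_norm_sq_to_K]
      simp
    calc (r ^ n * ‖ζ‖) ^ 2 ≤ ‖(T ^ n) ζ‖ ^ 2 := by gcongr; exact hlow n
      _ ≤ C * ρ ^ (n + n) := h1 ▸ h _
      _ = _ := by rw [← two_mul, mul_comm 2 n, pow_mul]
  have hq : 1 < (r / ρ) ^ 2 := by
    have : 1 < r / ρ := (one_lt_div hρ).2 hrρ
    nlinarith
  obtain ⟨n, hn⟩ := pow_unbounded_of_one_lt (C / ‖ζ‖ ^ 2) hq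
  have h3 := hup n
  rw [div_lt_iff₀ (by positivity), ← pow_mul, mul_comm 2 n, pow_mul, div_pow, div_pow,
    div_mul_eq_mul_div, lt_div_iff₀ (by positivity), ← mul_pow] at hn
  linarith

theorem norm_inner_pow_sphereSum_le {π : FreeGroup (Fin 2) →* (E →L[ℂ] E)} {ζ : E} {C : ℝ}
    (h : ∀ n, ‖inner ℂ ζ (sphereSum π n ζ)‖ ≤ C) (n : ℕ) :
    ‖inner ℂ ζ ((sphereSum π 1 ^ n) ζ)‖ ≤ 2 * C * (2 * √3) ^ n := by
  have hC : 0 ≤ C := (norm_nonneg _).trans (h 0)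
  have h3 : √3 * √3 = 3 := Real.mul_self_sqrt (by norm_num)
  have h31 : 1 ≤ √3 := Real.one_le_sqrt.2 (by norm_num)
  -- The weights 3/4 and √3ᵏ (k ≥ 1) are a supersolution of the recursion for eigenvalue 2√3:
  -- equality holds for k ≥ 1, where 3 + 4·(3/4) = 6 decides the value 3/4, and at 0 one has √3 ≤
  -- (3/4)·2√3. The factor 2C covers the start, since C ≤ 2C·(3/4).
  have key : ∀ n, ‖inner ℂ ζ ((sphereSum π 1 ^ n * sphereSum π 0) ζ)‖
        ≤ 2 * C * (2 * √3) ^ n * (3 / 4) ∧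
      ∀ k, ‖inner ℂ ζ ((sphereSum π 1 ^ n * sphereSum π (k + 1)) ζ)‖
        ≤ 2 * C * (2 * √3) ^ n * √3 ^ (k + 1) := by
    intro n
    induction n with
    | zero =>
      refine ⟨?_, fun k => ?_⟩
      · rw [pow_zero, one_mul]; have := h 0; linarith
      · rw [pow_zero, one_mul]
        have h1 := h (k + 1)
        have h2 : 1 ≤ √3 ^ (k + 1) := one_le_pow₀ h31
        nlinarith
    | succ n ih =>
      have hD : 0 ≤ 2 * C * (2 * √3) ^ n := by positivity
      have hadd : ∀ (A B X : E →L[ℂ] E) (c : ℝ), 0 ≤ c →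
          ‖inner ℂ ζ ((X * (A + (c : ℂ) • B)) ζ)‖ ≤
            ‖inner ℂ ζ ((X * A) ζ)‖ + c * ‖inner ℂ ζ ((X * B) ζ)‖ := by
        intro A B X c hc
        rw [mul_add, _root_.add_apply, inner_add_right, mul_smul_comm, _root_.smul_apply,
          inner_smul_right]
        refine (norm_add_le _ _).trans ?_
        rw [norm_mul, Complex.norm_real, Real.norm_of_nonneg hc]
      refine ⟨?_, fun k => ?_⟩
      · rw [pow_succ, mul_assoc, sphereSum_zero, mul_one]
        have := ih.2 0
        rw [zero_add, pow_one] at this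
        rw [pow_succ]
        nlinarith [mul_nonneg hD (Real.sqrt_nonneg 3)]
      · cases k with
        | zero =>
          have e : sphereSum π 1 * sphereSum π (0 + 1) =
              sphereSum π 2 + ((4 : ℝ) : ℂ) • sphereSum π 0 := by
            rw [zero_add, sphereSum_one_mul_one, sphereSum_zero]
            congr 1
            rw [← Algebra.algebraMap_eq_smul_one, Complex.ofReal_ofNat, map_ofNat]
          rw [pow_succ, mul_assoc, e]
          refine (hadd _ _ _ 4 (by norm_num)).trans ?_
          have h1 := ih.1
          have h2 := ih.2 1
          have h4 : √3 ^ (1 + 1) = 3 := by rw [pow_succ, pow_one, h3]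
          rw [h4] at h2
          rw [pow_succ, zero_add, pow_one]
          nlinarith
        | succ k =>
          have e : sphereSum π 1 * sphereSum π (k + 1 + 1) =
              sphereSum π (k + 3) + ((3 : ℝ) : ℂ) • sphereSum π (k + 1) := by
            rw [show k + 1 + 1 = k + 2 from rfl, sphereSum_one_mul_add_two]
            congr 1
            rw [Algebra.smul_def, Complex.ofReal_ofNat, map_ofNat]
          rw [pow_succ, mul_assoc, e]
          refine (hadd _ _ _ 3 (by norm_num)).trans ?_
          have h1 := ih.2 k
          have h2 := ih.2 (k + 2)
          have h4 : √3 ^ (k + 2 + 1) = 3 * √3 ^ (k + 1) := by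
            rw [show k + 2 + 1 = (k + 1) + 1 + 1 from rfl, pow_succ, pow_succ _ (k + 1), mul_assoc,
              h3, mul_comm]
          have h5 : √3 ^ (k + 1 + 1) = √3 * √3 ^ (k + 1) := by rw [pow_succ, mul_comm]
          rw [h4] at h2
          rw [h5, pow_succ]
          have h6 : 2 * C * ((2 * √3) ^ n * (2 * √3)) * (√3 * √3 ^ (k + 1)) =
              6 * (2 * C * (2 * √3) ^ n * √3 ^ (k + 1)) := by
            linear_combination (2 * C * (2 * √3) ^ n * √3 ^ (k + 1) * 2) * h3
          rw [h6]
          linarith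
  have := (key n).1
  rw [sphereSum_zero, mul_one] at this
  have hD : 0 ≤ 2 * C * (2 * √3) ^ n := by positivity
  linarith

theorem norm_inner_sphereSum_le {π : FreeGroup (Fin 2) →* (E →L[ℂ] E)} {ζ : E}
    (h : Summable fun g => ‖inner ℂ ζ (π g ζ)‖) (n : ℕ) :
    ‖inner ℂ ζ (sphereSum π n ζ)‖ ≤ ∑' g, ‖inner ℂ ζ (π g ζ)‖ := by
  have hinj : Set.InjOn (FreeGroup.mk (α := Fin 2)) (sphere n : Set (List Letter)) := by
    intro L hL L' hL' he
    have h1 := (mem_sphere.1 (Finset.mem_coe.1 hL)).1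
    have h2 := (mem_sphere.1 (Finset.mem_coe.1 hL')).1
    have := congrArg FreeGroup.toWord he
    rwa [FreeGroup.toWord_mk, FreeGroup.toWord_mk, h1.reduce_eq, h2.reduce_eq] at this
  rw [sphereSum, _root_.sum_apply, inner_sum]
  refine (norm_sum_le _ _).trans ?_
  rw [← Finset.sum_image (f := fun g => ‖inner ℂ ζ (π g ζ)‖) hinj]
  exact h.sum_le_tsum _ fun _ _ => norm_nonneg _

/-- Absolutely summable coefficients bound ⟨ζ, S_n ζ⟩ independently of n. The constant depends on ζ,
but the resulting bound on ‖Tζ‖ does not, so it passes to the closure. -/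
theorem norm_sphereSum_one_le {π : FreeGroup (Fin 2) →* (E →L[ℂ] E)}
    (hπ : ∀ g, star (π g) = π g⁻¹) {S : Submodule ℂ E} (hS : Dense (S : Set E))
    (h : ∀ ζ ∈ S, Summable fun g => ‖inner ℂ ζ (π g ζ)‖) : ‖sphereSum π 1‖ ≤ 2 * √3 := by
  refine ContinuousLinearMap.opNorm_le_bound _ (by positivity) fun x => ?_
  have hcl : IsClosed {x : E | ‖sphereSum π 1 x‖ ≤ 2 * √3 * ‖x‖} :=
    isClosed_le (by fun_prop) (by fun_prop)
  refine closure_minimal ?_ hcl (hS x)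
  intro ζ hζ
  exact norm_apply_le_of_norm_inner_pow_le (isSelfAdjoint_sphereSum_one π hπ) (by positivity)
    (norm_inner_pow_sphereSum_le (norm_inner_sphereSum_le (h ζ hζ)))

end LogConvexity

/-! ### The upper bound for the doubled representation -/

section DoubleRep

variable {H K : Type*} [NormedAddCommGroup H] [InnerProductSpace ℂ H] [CompleteSpace H]
  [NormedAddCommGroup K] [InnerProductSpace ℂ K] [CompleteSpace K]

theorem elemVec_add_left (a a' : H) (b : K) :
    elemVec (a + a') b = elemVec a b + elemVec a' b := by
  rw [elemVec, TensorProduct.add_tmul, UniformSpace.Completion.coe_add]; rfl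

theorem elemVec_add_right (a : H) (b b' : K) :
    elemVec a (b + b') = elemVec a b + elemVec a b' := by
  rw [elemVec, TensorProduct.tmul_add, UniformSpace.Completion.coe_add]; rfl

theorem elemVec_smul_left (c : ℂ) (a : H) (b : K) : elemVec (c • a) b = c • elemVec a b := by
  rw [elemVec, ← TensorProduct.smul_tmul', UniformSpace.Completion.coe_smul]; rfl

theorem elemVec_smul_right (c : ℂ) (a : H) (b : K) : elemVec a (c • b) = c • elemVec a b := by
  rw [elemVec, TensorProduct.tmul_smul, UniformSpace.Completion.coe_smul]; rfl

theorem exists_inner_eq_of_linear {f : H → ℂ} (hadd : ∀ x y, f (x + y) = f x + f y)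
    (hsmul : ∀ (c : ℂ) x, f (c • x) = c * f x) {C : ℝ} (hC : ∀ x, ‖f x‖ ≤ C * ‖x‖) :
    ∃ z, ∀ x, inner ℂ z x = f x := by
  let F : StrongDual ℂ H := LinearMap.mkContinuous ⟨⟨f, hadd⟩, hsmul⟩ C hC
  exact ⟨(InnerProductSpace.toDual ℂ H).symm F, fun x => InnerProductSpace.toDual_symm_apply⟩

theorem dense_span_of_forall_eq_zero {S : Set H} (h : ∀ v, (∀ x ∈ S, inner ℂ x v = 0) → v = 0) :
    Dense (Submodule.span ℂ S : Set H) := by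
  rw [Submodule.dense_iff_topologicalClosure_eq_top, Submodule.topologicalClosure_eq_top_iff,
    Submodule.eq_bot_iff]
  intro v hv
  exact h v fun x hx => Submodule.inner_right_of_mem_orthogonal (Submodule.subset_span hx) hv

/-- Totality is applied in one tensor factor at a time, with the other factor fixed and the
resulting functional represented by a vector. -/
theorem dense_span_elemVec_toDual {S : Set H} (h : ∀ v, (∀ x ∈ S, inner ℂ x v = 0) → v = 0) :
    Dense (Submodule.span ℂ {ζ | ∃ x ∈ S, ∃ y ∈ S,
      ζ = elemVec x (InnerProductSpace.toDual ℂ H y)} : Set (HilbertTensor H (StrongDual ℂ H))) := by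
  refine dense_span_of_forall_eq_zero fun w hw => ?_
  have h1 : ∀ x ∈ S, ∀ y, inner ℂ (elemVec x (InnerProductSpace.toDual ℂ H y)) w = 0 := by
    intro x hx y
    obtain ⟨z, hz⟩ := exists_inner_eq_of_linear
      (f := fun y => inner ℂ (elemVec x (InnerProductSpace.toDual ℂ H y)) w)
      (fun y y' => by rw [map_add, elemVec_add_right, inner_add_left])
      (fun c y => by rw [map_smulₛₗ, elemVec_smul_right, inner_smul_left, Complex.conj_conj])
      (C := ‖x‖ * ‖w‖) (fun y => by
        refine (norm_inner_le_norm _ _).trans (le_of_eq ?_)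
        rw [norm_elemVec, LinearIsometryEquiv.norm_map]; ring)
    have hz0 : z = 0 := h z fun y hy => by
      rw [← inner_conj_symm, hz, hw _ ⟨x, hx, y, hy, rfl⟩, map_zero]
    rw [← hz, hz0, inner_zero_left]
  refine eq_of_forall_inner_elemVec fun x f => ?_
  obtain ⟨y, rfl⟩ := (InnerProductSpace.toDual ℂ H).surjective f
  rw [inner_zero_right]
  obtain ⟨z, hz⟩ := exists_inner_eq_of_linear
    (f := fun x => inner ℂ w (elemVec x (InnerProductSpace.toDual ℂ H y)))
    (fun x x' => by rw [elemVec_add_left, inner_add_right])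
    (fun c x => by rw [elemVec_smul_left, inner_smul_right])
    (C := ‖w‖ * ‖y‖) (fun x => by
      refine (norm_inner_le_norm _ _).trans (le_of_eq ?_)
      rw [norm_elemVec, LinearIsometryEquiv.norm_map]; ring)
  have hz0 : z = 0 := h z fun x hx => by
    rw [← inner_conj_symm, hz, inner_conj_symm, h1 x hx]
  rw [← inner_conj_symm, ← hz, hz0, inner_zero_left, map_zero]

theorem IsBessel.summable {ι : Type*} {θ : ι → H} {C : ℝ} (h : IsBessel θ C) (k : H) :
    Summable fun i => ‖inner ℂ (θ i) k‖ ^ 2 := by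
  have := (memℓp_gen_iff (p := 2) (by norm_num)).1 (h.memℓp k)
  simpa using this

variable {G : Type*} [Group G]

theorem inner_elemVec_doubleRep (u : G →* (H →L[ℂ] H)) (hu : ∀ g, star (u g) = u g⁻¹) (g : G)
    (x y x' y' : H) :
    inner ℂ (elemVec x' (InnerProductSpace.toDual ℂ H y'))
      (doubleRep u g (elemVec x (InnerProductSpace.toDual ℂ H y))) =
      inner ℂ x' (u g x) * inner ℂ (u g y) y' := by
  rw [doubleRep_apply, tensorOp_elemVec, inner_elemVec, transpose_toDual, inner_toDual_toDual, hu,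
    inv_inv]

/-- A coefficient of the doubled representation is a product of two square summable coefficients. -/
theorem summable_norm_inner_doubleRep (u : G →* (H →L[ℂ] H)) (hu : ∀ g, star (u g) = u g⁻¹)
    {x y : H} (hx : x ∈ boundedVectors u) (hy : y ∈ boundedVectors u) (x' y' : H) :
    Summable fun g => ‖inner ℂ (elemVec x' (InnerProductSpace.toDual ℂ H y'))
      (doubleRep u g (elemVec x (InnerProductSpace.toDual ℂ H y)))‖ := by
  obtain ⟨C, hC⟩ := hx
  obtain ⟨D, hD⟩ := hy
  refine Summable.of_nonneg_of_le (fun _ => norm_nonneg _) (fun g => ?_)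
    ((hC.summable x').add (hD.summable y'))
  rw [inner_elemVec_doubleRep u hu, norm_mul, norm_inner_symm]
  nlinarith [sq_nonneg (‖inner ℂ (u g x) x'‖ - ‖inner ℂ (u g y) y'‖),
    sq_nonneg ‖inner ℂ (u g x) x'‖, sq_nonneg ‖inner ℂ (u g y) y'‖]

theorem summable_norm_inner_of_mem_span {E : Type*} [NormedAddCommGroup E] [InnerProductSpace ℂ E]
    {ι : Type*} (A : ι → E →L[ℂ] E) {S : Set E}
    (h : ∀ x ∈ S, ∀ y ∈ S, Summable fun i => ‖inner ℂ y (A i x)‖) {x y : E}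
    (hx : x ∈ Submodule.span ℂ S) (hy : y ∈ Submodule.span ℂ S) :
    Summable fun i => ‖inner ℂ y (A i x)‖ := by
  have h1 : ∀ y ∈ S, Summable fun i => ‖inner ℂ y (A i x)‖ := by
    intro y hy
    induction hx using Submodule.span_induction with
    | mem x hx => exact h x hx y hy
    | zero => simp
    | add x x' _ _ hx hx' =>
      refine Summable.of_nonneg_of_le (fun _ => norm_nonneg _) (fun i => ?_) (hx.add hx')
      rw [map_add, inner_add_right]
      exact norm_add_le _ _
    | smul c x _ hx =>
      refine (hx.mul_left ‖c‖).congr fun i => ?_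
      rw [map_smul, inner_smul_right, norm_mul]
  induction hy using Submodule.span_induction with
  | mem y hy => exact h1 y hy
  | zero => simp
  | add y y' _ _ hy hy' =>
    refine Summable.of_nonneg_of_le (fun _ => norm_nonneg _) (fun i => ?_) (hy.add hy')
    rw [inner_add_left]
    exact norm_add_le _ _
  | smul c y _ hy =>
    refine (hy.mul_left ‖c‖).congr fun i => ?_
    rw [inner_smul_left, norm_mul, RCLike.norm_conj]

theorem norm_sphereSum_doubleRep_le (u : FreeGroup (Fin 2) →* (H →L[ℂ] H))
    (hu : ∀ g, star (u g) = u g⁻¹)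
    (h : ∀ v, (∀ x ∈ boundedVectors u, inner ℂ x v = 0) → v = 0) :
    ‖sphereSum (doubleRep u) 1‖ ≤ 2 * √3 := by
  refine norm_sphereSum_one_le (star_doubleRep u hu) (dense_span_elemVec_toDual h) ?_
  intro ζ hζ
  refine summable_norm_inner_of_mem_span (doubleRep u) ?_ hζ hζ
  rintro _ ⟨x, hx, y, hy, rfl⟩ _ ⟨x', -, y', -, rfl⟩
  exact summable_norm_inner_doubleRep u hu hx hy x' y'

end DoubleRep

/-! ### The left regular representation -/

section LeftRegular

variable {G : Type*} [Group G]

theorem leftRegular_apply (g : G) (f : ellTwo G) (h : G) : leftRegular g f h = f (g⁻¹ * h) := rfl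

theorem leftRegular_one : leftRegular (1 : G) = 1 := by
  ext f h
  rw [leftRegular_apply, inv_one, one_mul]
  rfl

theorem leftRegular_mul (g g' : G) : leftRegular (g * g') = leftRegular g * leftRegular g' := by
  ext f h
  rw [leftRegular_apply, mul_inv_rev, mul_assoc]
  rfl

theorem star_leftRegular (g : G) : star (leftRegular g) = leftRegular g⁻¹ := by
  symm
  rw [ContinuousLinearMap.star_eq_adjoint, ContinuousLinearMap.eq_adjoint_iff]
  intro x y
  rw [lp.inner_eq_tsum, lp.inner_eq_tsum,
    ← (Equiv.mulLeft g).tsum_eq (fun h => inner ℂ (x h) (leftRegular g y h))]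
  refine tsum_congr fun h => ?_
  rw [leftRegular_apply, leftRegular_apply, inv_inv, Equiv.coe_mulLeft, inv_mul_cancel_left]

theorem norm_leftRegular_apply (g : G) (f : ellTwo G) : ‖leftRegular g f‖ = ‖f‖ := by
  have h : inner ℂ (leftRegular g f) (leftRegular g f) = (inner ℂ f f : ℂ) := by
    rw [← ContinuousLinearMap.adjoint_inner_right, ← ContinuousLinearMap.star_eq_adjoint,
      star_leftRegular]
    have : leftRegular g⁻¹ (leftRegular g f) = f := by
      have := leftRegular_mul g⁻¹ g
      rw [inv_mul_cancel, leftRegular_one] at this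
      exact (congrArg (fun z : ellTwo G →L[ℂ] ellTwo G => z f) this).symm
    rw [this]
  rw [inner_self_eq_norm_sq_to_K, inner_self_eq_norm_sq_to_K] at h
  have h' : ‖leftRegular g f‖ ^ 2 = ‖f‖ ^ 2 := by exact_mod_cast h
  exact (sq_eq_sq₀ (norm_nonneg _) (norm_nonneg _)).1 h'

variable (G) in
/-- The left regular representation, with values in the group von Neumann algebra. -/
def leftRegularRep : G →* (groupVN G).toStarSubalgebra where
  toFun g := ⟨leftRegular g, subset_generated _ ⟨g, rfl⟩⟩
  map_one' := Subtype.ext leftRegular_one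
  map_mul' g g' := Subtype.ext (leftRegular_mul g g')

theorem star_leftRegularRep (g : G) : star (leftRegularRep G g) = leftRegularRep G g⁻¹ :=
  Subtype.ext (star_leftRegular g)

/-- Restriction of square summable functions to a set. -/
def restrict (A : Set G) : ellTwo G →L[ℂ] ellTwo G := by
  classical
  exact lp.mapCLM 2 (fun x => if x ∈ A then ContinuousLinearMap.id ℂ ℂ else 0) zero_le_one
    (fun x => by
      split_ifs
      · exact ContinuousLinearMap.norm_id_le
      · simp)

open Classical in
theorem restrict_apply (A : Set G) (f : ellTwo G) (x : G) :
    restrict A f x = if x ∈ A then f x else 0 := by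
  change (if x ∈ A then ContinuousLinearMap.id ℂ ℂ else 0 : ℂ →L[ℂ] ℂ) (f x) = _
  split_ifs <;> rfl

theorem norm_restrict_apply_le (A : Set G) (f : ellTwo G) : ‖restrict A f‖ ≤ ‖f‖ := by
  refine ((restrict A).le_of_opNorm_le (lp.norm_mapCLM_le _ _ zero_le_one _) f).trans ?_
  rw [one_mul]

theorem inner_restrict_of_disjoint {A B : Set G} (h : Disjoint A B) (f f' : ellTwo G) :
    inner ℂ (restrict A f) (restrict B f') = (0 : ℂ) := by
  classical
  rw [lp.inner_eq_tsum]
  refine (tsum_congr fun x => ?_).trans tsum_zero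
  rw [restrict_apply, restrict_apply]
  by_cases hA : x ∈ A
  · rw [if_neg (Set.disjoint_left.1 h hA), inner_zero_right]
  · rw [if_neg hA, inner_zero_left]

theorem inner_restrict_left (A : Set G) (f f' : ellTwo G) :
    inner ℂ (restrict A f) f' = (inner ℂ (restrict A f) (restrict A f') : ℂ) := by
  classical
  rw [lp.inner_eq_tsum, lp.inner_eq_tsum]
  refine tsum_congr fun x => ?_
  rw [restrict_apply, restrict_apply]
  split_ifs <;> simp

theorem norm_sum_sq_of_pairwise {E ι : Type*} [NormedAddCommGroup E] [InnerProductSpace ℂ E]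
    (s : Finset ι) {v : ι → E} (h : ∀ i j, i ≠ j → inner ℂ (v i) (v j) = 0) :
    ‖∑ i ∈ s, v i‖ ^ 2 = ∑ i ∈ s, ‖v i‖ ^ 2 := by
  classical
  have h1 : inner ℂ (∑ i ∈ s, v i) (∑ i ∈ s, v i) = ∑ i ∈ s, inner ℂ (v i) (v i) := by
    rw [sum_inner]
    refine Finset.sum_congr rfl fun i hi => ?_
    rw [inner_sum, Finset.sum_eq_single i (fun j _ hj => h i j hj.symm) (fun h => (h hi).elim)]
  simp only [inner_self_eq_norm_sq_to_K] at h1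
  exact_mod_cast h1

theorem sum_norm_restrict_sq_le {ι : Type*} (s : Finset ι) {A : ι → Set G}
    (hA : ∀ i j, i ≠ j → Disjoint (A i) (A j)) (f : ellTwo G) :
    ∑ i ∈ s, ‖restrict (A i) f‖ ^ 2 ≤ ‖f‖ ^ 2 := by
  have h1 := norm_sum_sq_of_pairwise s (v := fun i => restrict (A i) f)
    fun i j hij => inner_restrict_of_disjoint (hA i j hij) f f
  have h2 : ‖∑ i ∈ s, restrict (A i) f‖ ^ 2 ≤ ‖∑ i ∈ s, restrict (A i) f‖ * ‖f‖ := by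
    have h3 : inner ℂ (∑ i ∈ s, restrict (A i) f) f =
        ((∑ i ∈ s, ‖restrict (A i) f‖ ^ 2 : ℝ) : ℂ) := by
      rw [sum_inner, Complex.ofReal_sum]
      refine Finset.sum_congr rfl fun i _ => ?_
      rw [inner_restrict_left, inner_self_eq_norm_sq_to_K]
      simp
    have h4 := norm_inner_le_norm (𝕜 := ℂ) (∑ i ∈ s, restrict (A i) f) f
    rw [h3, ← h1, Complex.norm_real, Real.norm_of_nonneg (by positivity)] at h4
    exact h4
  rw [← h1]
  have h5 : ‖∑ i ∈ s, restrict (A i) f‖ ≤ ‖f‖ := by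
    rcases (norm_nonneg (∑ i ∈ s, restrict (A i) f)).eq_or_lt with h0 | h0
    · rw [← h0]; exact norm_nonneg _
    · rw [sq] at h2; exact le_of_mul_le_mul_left h2 h0
  gcongr

/-- Powers' estimate: each x i maps the complement of A i into A i, so its operator splits into a
part with range over A i and a part supported on A i. The first parts have orthogonal ranges, the
second orthogonal supports, and each sum has norm at most √n. -/
theorem norm_sum_leftRegular_le {n : ℕ} {A : Fin n → Set G}
    (hA : ∀ i j, i ≠ j → Disjoint (A i) (A j)) {x : Fin n → G}
    (hx : ∀ i, ∀ y, y ∉ A i → x i * y ∈ A i) :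
    ‖∑ i, leftRegular (x i)‖ ≤ 2 * √n := by
  classical
  refine ContinuousLinearMap.opNorm_le_bound _ (by positivity) fun f => ?_
  have hdec : ∀ i, leftRegular (x i) f = restrict (A i) (leftRegular (x i) f) +
      restrict (A i)ᶜ (leftRegular (x i) (restrict (A i) f)) := by
    intro i
    ext y
    rw [lp.coeFn_add, Pi.add_apply, restrict_apply, restrict_apply, leftRegular_apply,
      leftRegular_apply, restrict_apply]
    by_cases hy : y ∈ A i
    · simp [hy]
    · have h1 : (x i)⁻¹ * y ∈ A i := by
        by_contra h
        have := hx i _ h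
        rw [mul_inv_cancel_left] at this
        exact hy this
      simp [hy, h1]
  have hn : √(n : ℝ) ^ 2 = n := Real.sq_sqrt (Nat.cast_nonneg n)
  have h1 : ‖∑ i, restrict (A i) (leftRegular (x i) f)‖ ≤ √n * ‖f‖ := by
    have h2 := norm_sum_sq_of_pairwise Finset.univ
      (v := fun i => restrict (A i) (leftRegular (x i) f))
      fun i j hij => inner_restrict_of_disjoint (hA i j hij) _ _
    refine le_of_sq_le_sq ?_ (by positivity)
    rw [h2, mul_pow, hn]
    calc _ ≤ ∑ _i : Fin n, ‖f‖ ^ 2 := by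
          refine Finset.sum_le_sum fun i _ => ?_
          gcongr
          exact (norm_restrict_apply_le _ _).trans (norm_leftRegular_apply _ _).le
      _ = n * ‖f‖ ^ 2 := by simp
  have h2 : ‖∑ i, restrict (A i)ᶜ (leftRegular (x i) (restrict (A i) f))‖ ≤ √n * ‖f‖ := by
    have h3 : ∀ i, ‖restrict (A i)ᶜ (leftRegular (x i) (restrict (A i) f))‖ ≤
        ‖restrict (A i) f‖ := fun i =>
      (norm_restrict_apply_le _ _).trans (norm_leftRegular_apply _ _).le
    refine ((norm_sum_le _ _).trans (Finset.sum_le_sum fun i _ => h3 i)).trans ?_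
    refine le_of_sq_le_sq ?_ (by positivity)
    -- Cauchy–Schwarz for the n terms, followed by disjointness of the sets A i.
    rw [mul_pow, hn]
    refine (sq_sum_le_card_mul_sum_sq (s := Finset.univ)
      (f := fun i => ‖restrict (A i) f‖)).trans ?_
    rw [Finset.card_univ, Fintype.card_fin]
    gcongr
    exact sum_norm_restrict_sq_le _ hA f
  rw [_root_.sum_apply, Finset.sum_congr rfl fun i _ => hdec i, Finset.sum_add_distrib]
  refine (norm_add_le _ _).trans ?_
  linarith

end LeftRegular

/-! ### Averaging of conjugates in the free group -/

section Powers

/-- Let a and b be the generators 0 and 1. The sets of words bⁱy with y beginning with a letter a^±1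
are pairwise disjoint. Since x begins and ends with such a letter, its conjugate by bⁱ maps the
complement of the i-th set into that set. -/
theorem norm_sum_leftRegular_conj_le {x : FreeGroup (Fin 2)} (hx : BeginsWith 0 x)
    (hx' : BeginsWith 0 x⁻¹) (n : ℕ) :
    ‖∑ i : Fin n, leftRegular (FreeGroup.of 1 ^ ((i : ℕ) : ℤ) * x *
      (FreeGroup.of 1 ^ ((i : ℕ) : ℤ))⁻¹)‖ ≤ 2 * √n := by
  refine norm_sum_leftRegular_le
    (A := fun i => {y | BeginsWith 0 ((FreeGroup.of 1 ^ ((i : ℕ) : ℤ))⁻¹ * y)}) ?_ ?_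
  · intro i j hij
    rw [Set.disjoint_left]
    intro y hy hy'
    have hk : ((i : ℕ) : ℤ) - ((j : ℕ) : ℤ) ≠ 0 := fun h => hij (Fin.ext (by omega))
    have := not_beginsWith_zero_zpow_one_mul hk hy
    rw [zpow_sub, ← mul_assoc, ((Commute.refl (FreeGroup.of (1 : Fin 2))).zpow_zpow _ _
      |>.inv_right).eq, mul_inv_cancel_right] at this
    exact this hy'
  · intro i y hy
    change BeginsWith 0 _
    rw [mul_assoc, mul_assoc, inv_mul_cancel_left]
    exact beginsWith_mul_of_not hx hx' hy

end Powers

/-! ### Uniqueness of the trace on the image of L(F₂) -/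

section Embedding

variable {H K : Type*} [NormedAddCommGroup H] [InnerProductSpace ℂ H] [CompleteSpace H]
  [NormedAddCommGroup K] [InnerProductSpace ℂ K] [CompleteSpace K]

theorem isClosed_vonNeumannAlgebra (N : VonNeumannAlgebra K) :
    IsClosed (N.toStarSubalgebra : Set (K →L[ℂ] K)) := by
  rw [VonNeumannAlgebra.coe_toStarSubalgebra, ← N.centralizer_centralizer]
  exact Set.isClosed_centralizer _

theorem norm_starAlgHom_apply_le {N : VonNeumannAlgebra K}
    (φ : N.toStarSubalgebra →⋆ₐ[ℂ] (H →L[ℂ] H)) (x : N.toStarSubalgebra) :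
    ‖φ x‖ ≤ ‖(x : K →L[ℂ] K)‖ := by
  letI := StarSubalgebra.cstarAlgebra N.toStarSubalgebra
    (h_closed := isClosed_vonNeumannAlgebra N)
  exact NonUnitalStarAlgHom.norm_apply_le φ x

theorem IsNormalFaithfulTracialState.exists_bound {M : VonNeumannAlgebra H}
    {τ : M.toStarSubalgebra →ₗ[ℂ] ℂ} (hτ : IsNormalFaithfulTracialState M τ) :
    ∃ C, 0 ≤ C ∧ ∀ x : M.toStarSubalgebra, ‖τ x‖ ≤ C * ‖(x : H →L[ℂ] H)‖ := by
  obtain ⟨ξ, η, hξ, hη, hsum⟩ := hτ.normal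
  obtain ⟨Φ, hΦ⟩ := exists_functional_hasSum ξ η (summable_norm_mul_norm hξ hη)
  refine ⟨‖Φ‖, norm_nonneg _, fun x => ?_⟩
  have h1 := hΦ (x : H →L[ℂ] H)
  rw [(hsum x).unique h1]
  exact Φ.le_opNorm _

/-- Θ is only a star homomorphism, so it contracts norms but is not given to preserve a trace. The
trace of a sum of n conjugates of g is n·τ(u_g), while its norm is at most 2√n. -/
theorem map_eq_zero_of_embedding {M : VonNeumannAlgebra H} {τ : M.toStarSubalgebra →ₗ[ℂ] ℂ}
    (hτ : IsNormalFaithfulTracialState M τ)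
    (Θ : (groupVN (FreeGroup (Fin 2))).toStarSubalgebra →⋆ₐ[ℂ] M.toStarSubalgebra)
    {g : FreeGroup (Fin 2)} (hg : g ≠ 1) : τ (Θ (leftRegularRep _ g)) = 0 := by
  set u : FreeGroup (Fin 2) →* M.toStarSubalgebra :=
    (Θ : _ →* M.toStarSubalgebra).comp (leftRegularRep (FreeGroup (Fin 2))) with hu
  have hconj : ∀ t x, τ (u (t * x * t⁻¹)) = τ (u x) := fun t x => by
    rw [map_mul, hτ.tracial, ← map_mul, inv_mul_cancel_left]
  obtain ⟨t, ht⟩ := exists_forall_beginsWith_conj 0 {g} (by simpa using hg.symm)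
  obtain ⟨h1, h2⟩ := ht g (Finset.mem_singleton_self g)
  obtain ⟨C, hC0, hC⟩ := hτ.exists_bound
  have key : ∀ n : ℕ, n * ‖τ (u g)‖ ≤ C * (2 * √n) := by
    intro n
    set x : Fin n → FreeGroup (Fin 2) := fun i =>
      FreeGroup.of 1 ^ ((i : ℕ) : ℤ) * (t * g * t⁻¹) * (FreeGroup.of 1 ^ ((i : ℕ) : ℤ))⁻¹ with hx
    have e1 : τ (∑ i, u (x i)) = n * τ (u g) := by
      rw [map_sum, Finset.sum_congr rfl fun i _ => (hconj _ _).trans (hconj t g)]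
      simp
    have e2 : (∑ i, u (x i)) = Θ (∑ i, leftRegularRep _ (x i)) := (map_sum Θ _ _).symm
    have e3 : ((∑ i, leftRegularRep _ (x i) :
        (groupVN (FreeGroup (Fin 2))).toStarSubalgebra) : ellTwo _ →L[ℂ] ellTwo _) =
        ∑ i, leftRegular (x i) := by
      rw [AddSubmonoidClass.coe_finsetSum]; rfl
    have e4 := norm_starAlgHom_apply_le (M.toStarSubalgebra.subtype.comp Θ)
      (∑ i, leftRegularRep _ (x i))
    rw [e3] at e4
    have e5 := hC (∑ i, u (x i))
    rw [e1, norm_mul, Complex.norm_natCast] at e5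
    refine e5.trans (mul_le_mul_of_nonneg_left ?_ hC0)
    rw [e2]
    exact e4.trans (norm_sum_leftRegular_conj_le h1 h2 n)
  change τ (u g) = 0
  by_contra hne
  have hpos : 0 < ‖τ (u g)‖ := norm_pos_iff.2 hne
  obtain ⟨m, hm⟩ := exists_nat_gt (2 * C / ‖τ (u g)‖)
  -- At n = m² the square root is m.
  have hm' := key (m ^ 2)
  rw [Nat.cast_pow, Real.sqrt_sq (Nat.cast_nonneg m)] at hm'
  rw [div_lt_iff₀ hpos] at hm
  have hm0 : (0 : ℝ) < m := by
    rcases (Nat.cast_nonneg m : (0 : ℝ) ≤ m).eq_or_lt with h0 | h0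
    · rw [← h0] at hm; linarith
    · exact h0
  nlinarith

end Embedding

/-! ### Isomorphisms of generated algebras from intertwiners -/

section Intertwiners

variable {E F : Type*} [NormedAddCommGroup E] [InnerProductSpace ℂ E] [CompleteSpace E]
  [NormedAddCommGroup F] [InnerProductSpace ℂ F] [CompleteSpace F]

theorem exists_clm_of_inner_eq {ι : Type*} {x : ι → E} {x' : ι → F}
    (h : ∀ i j, inner ℂ (x' i) (x' j) = inner ℂ (x i) (x j))
    (hx : Dense (Submodule.span ℂ (Set.range x) : Set E)) : ∃ z : E →L[ℂ] F, ∀ i, z (x i) = x' i := by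
  have hn : ∀ a, ‖Finsupp.linearCombination ℂ x' a‖ = ‖Finsupp.linearCombination ℂ x a‖ := by
    intro a
    have h1 : inner ℂ (Finsupp.linearCombination ℂ x' a) (Finsupp.linearCombination ℂ x' a) =
        inner ℂ (Finsupp.linearCombination ℂ x a) (Finsupp.linearCombination ℂ x a) := by
      simp only [Finsupp.linearCombination_apply, Finsupp.sum, sum_inner, inner_sum,
        inner_smul_left, inner_smul_right, h]
    rw [inner_self_eq_norm_sq_to_K, inner_self_eq_norm_sq_to_K] at h1
    have h' : ‖Finsupp.linearCombination ℂ x' a‖ ^ 2 =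
        ‖Finsupp.linearCombination ℂ x a‖ ^ 2 := by exact_mod_cast h1
    exact (sq_eq_sq₀ (norm_nonneg _) (norm_nonneg _)).1 h'
  have hd : DenseRange (Finsupp.linearCombination ℂ x) := by
    rw [← Finsupp.range_linearCombination] at hx
    exact hx
  refine ⟨(Finsupp.linearCombination ℂ x').extendOfNorm (Finsupp.linearCombination ℂ x),
    fun i => ?_⟩
  have h2 := LinearMap.extendOfNorm_eq (f := Finsupp.linearCombination ℂ x') hd
    ⟨1, fun a => by rw [one_mul, hn]⟩ (Finsupp.single i 1)
  simpa using h2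

variable {G : Type*} [Group G] {v : G → E →L[ℂ] E} {w : G → F →L[ℂ] F}

theorem mem_generated_range_iff (hv : ∀ g, star (v g) = v g⁻¹) {y : E →L[ℂ] E} :
    y ∈ generated (Set.range v) ↔ ∀ c : E →L[ℂ] E, (∀ g, v g * c = c * v g) → c * y = y * c := by
  change y ∈ StarSubalgebra.centralizer ℂ
    (StarSubalgebra.centralizer ℂ (Set.range v) : Set (E →L[ℂ] E)) ↔ _
  have hc : ∀ c : E →L[ℂ] E, c ∈ StarSubalgebra.centralizer ℂ (Set.range v) ↔
      ∀ g, v g * c = c * v g := by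
    intro c
    rw [StarSubalgebra.mem_centralizer_iff]
    constructor
    · exact fun h g => (h _ ⟨g, rfl⟩).1
    · rintro h _ ⟨g, rfl⟩
      exact ⟨h g, by rw [hv]; exact h _⟩
  rw [StarSubalgebra.mem_centralizer_iff]
  constructor
  · exact fun h c hcc => (h c ((hc c).2 hcc)).1
  · intro h c hcc
    exact ⟨h c ((hc c).1 hcc), h _ ((hc _).1 (star_mem hcc))⟩

/-- `B` intertwines the families `v` and `w`. -/
def Intertwines (v : G → E →L[ℂ] E) (w : G → F →L[ℂ] F) (B : E →L[ℂ] F) : Prop :=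
  ∀ g, B.comp (v g) = (w g).comp B

theorem Intertwines.adjoint (hv : ∀ g, star (v g) = v g⁻¹) (hw : ∀ g, star (w g) = w g⁻¹)
    {B : E →L[ℂ] F} (hB : Intertwines v w B) :
    Intertwines w v (ContinuousLinearMap.adjoint B) := by
  intro g
  have h := congrArg ContinuousLinearMap.adjoint (hB g⁻¹)
  rw [ContinuousLinearMap.adjoint_comp, ContinuousLinearMap.adjoint_comp,
    ← ContinuousLinearMap.star_eq_adjoint (v _), ← ContinuousLinearMap.star_eq_adjoint (w _),
    hv, hw, inv_inv] at h
  exact h.symm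

/-- The operators `y` and `z` correspond to each other through all intertwiners. -/
def Transfers (v : G → E →L[ℂ] E) (w : G → F →L[ℂ] F) (y : E →L[ℂ] E) (z : F →L[ℂ] F) : Prop :=
  ∀ B, Intertwines v w B → z.comp B = B.comp y

/-- The ranges of the intertwiners span a dense subspace. -/
def RangesTotal (v : G → E →L[ℂ] E) (w : G → F →L[ℂ] F) : Prop :=
  ∀ f : F, (∀ B, Intertwines v w B → ∀ x, inner ℂ f (B x) = 0) → f = 0

theorem RangesTotal.ext (h : RangesTotal v w) {z z' : F →L[ℂ] F}
    (hz : ∀ B, Intertwines v w B → z.comp B = z'.comp B) : z = z' := by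
  rw [← star_inj]
  ext1 f
  refine sub_eq_zero.1 (h _ fun B hB x => ?_)
  have := congrArg (fun A : E →L[ℂ] F => inner ℂ f (A x)) (hz B hB)
  rw [inner_sub_left, ContinuousLinearMap.star_eq_adjoint, ContinuousLinearMap.star_eq_adjoint,
    ContinuousLinearMap.adjoint_inner_left, ContinuousLinearMap.adjoint_inner_left]
  exact sub_eq_zero.2 this

theorem RangesTotal.dense (h : RangesTotal v w) :
    Dense (Submodule.span ℂ (Set.range
      fun p : {B : E →L[ℂ] F // Intertwines v w B} × E => p.1.1 p.2) : Set F) := by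
  refine dense_span_of_forall_eq_zero fun f hf => h f fun B hB x => ?_
  rw [← inner_conj_symm, hf _ ⟨(⟨B, hB⟩, x), rfl⟩, map_zero]

/-- The operator B*B' commutes with all v g, hence with everything they generate. -/
theorem commute_adjoint_comp (hv : ∀ g, star (v g) = v g⁻¹) (hw : ∀ g, star (w g) = w g⁻¹)
    {y : E →L[ℂ] E} (hy : y ∈ generated (Set.range v)) {B B' : E →L[ℂ] F}
    (hB : Intertwines v w B) (hB' : Intertwines v w B') :
    ((ContinuousLinearMap.adjoint B).comp B') * y = y * (ContinuousLinearMap.adjoint B).comp B' := by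
  refine (mem_generated_range_iff hv).1 hy _ fun g => ?_
  have h1 := hB.adjoint hv hw g
  have h2 := hB' g
  change (v g).comp ((ContinuousLinearMap.adjoint B).comp B') =
    ((ContinuousLinearMap.adjoint B).comp B').comp (v g)
  rw [← ContinuousLinearMap.comp_assoc, ← h1, ContinuousLinearMap.comp_assoc, ← h2,
    ContinuousLinearMap.comp_assoc]

theorem inner_comp_apply (hv : ∀ g, star (v g) = v g⁻¹) (hw : ∀ g, star (w g) = w g⁻¹)
    {y : E →L[ℂ] E} (hy : y ∈ generated (Set.range v)) {B B' : E →L[ℂ] F}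
    (hB : Intertwines v w B) (hB' : Intertwines v w B') (a a' : E) :
    inner ℂ (B a) (B' (y a')) = inner ℂ (B (star y a)) (B' a') := by
  rw [← ContinuousLinearMap.adjoint_inner_right, ← ContinuousLinearMap.adjoint_inner_right B]
  have h := congrArg (fun A : E →L[ℂ] E => inner ℂ a (A a')) (commute_adjoint_comp hv hw hy hB hB')
  rw [ContinuousLinearMap.star_eq_adjoint, ContinuousLinearMap.adjoint_inner_left]
  exact h

/-- The assignment B a ↦ B (y a) preserves inner products because y*y = 1 commutes past B*B'; it
extends since the vectors B a are total. -/
theorem exists_transfers_of_unitary (hv : ∀ g, star (v g) = v g⁻¹) (hw : ∀ g, star (w g) = w g⁻¹)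
    (h : RangesTotal v w) {y : E →L[ℂ] E} (hy : y ∈ generated (Set.range v))
    (hyy : star y * y = 1) : ∃ z : F →L[ℂ] F, Transfers v w y z := by
  obtain ⟨z, hz⟩ := exists_clm_of_inner_eq
    (x := fun p : {B : E →L[ℂ] F // Intertwines v w B} × E => p.1.1 p.2)
    (x' := fun p : {B : E →L[ℂ] F // Intertwines v w B} × E => p.1.1 (y p.2)) (by
      rintro ⟨⟨B, hB⟩, a⟩ ⟨⟨B', hB'⟩, a'⟩
      change inner ℂ (B (y a)) (B' (y a')) = inner ℂ (B a) (B' a')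
      rw [inner_comp_apply hv hw hy hB hB']
      have : star y (y a) = a := congrArg (fun A : E →L[ℂ] E => A a) hyy
      rw [this]) h.dense
  refine ⟨z, fun B hB => ?_⟩
  ext a
  exact hz (⟨B, hB⟩, a)

/-- The relation is linear, and a C*-algebra is spanned by its unitaries. -/
theorem exists_transfers (hv : ∀ g, star (v g) = v g⁻¹) (hw : ∀ g, star (w g) = w g⁻¹)
    (h : RangesTotal v w) {y : E →L[ℂ] E} (hy : y ∈ generated (Set.range v)) :
    ∃ z : F →L[ℂ] F, Transfers v w y z := by
  letI := StarSubalgebra.cstarAlgebra (generated (Set.range v)).toStarSubalgebra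
    (h_closed := isClosed_vonNeumannAlgebra _)
  have hspan := CStarAlgebra.span_unitary (generated (Set.range v)).toStarSubalgebra
  have hmem : (⟨y, hy⟩ : (generated (Set.range v)).toStarSubalgebra) ∈
      Submodule.span ℂ (unitary (generated (Set.range v)).toStarSubalgebra : Set _) := by
    rw [hspan]; trivial
  have key : ∀ y' : (generated (Set.range v)).toStarSubalgebra,
      y' ∈ Submodule.span ℂ (unitary (generated (Set.range v)).toStarSubalgebra : Set _) →
      ∃ z : F →L[ℂ] F, Transfers v w (y' : E →L[ℂ] E) z := by
    intro y' hy'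
    induction hy' using Submodule.span_induction with
    | mem x hx =>
      exact exists_transfers_of_unitary hv hw h x.2
        (congrArg Subtype.val (Unitary.star_mul_self_of_mem hx))
    | zero => exact ⟨0, fun B _ => by simp⟩
    | add x x' _ _ hx hx' =>
      obtain ⟨z, hz⟩ := hx
      obtain ⟨z', hz'⟩ := hx'
      refine ⟨z + z', fun B hB => ?_⟩
      rw [ContinuousLinearMap.add_comp, hz B hB, hz' B hB, ← ContinuousLinearMap.comp_add]
      rfl
    | smul c x _ hx =>
      obtain ⟨z, hz⟩ := hx
      refine ⟨c • z, fun B hB => ?_⟩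
      rw [ContinuousLinearMap.smul_comp, hz B hB, ← ContinuousLinearMap.comp_smul]
      rfl
  exact key _ hmem

/-- If c commutes with all w g, then cB is again an intertwiner, so czB = cBy = zcB. Totality of the
ranges gives cz = zc. -/
theorem Transfers.mem_generated (hw : ∀ g, star (w g) = w g⁻¹) (h : RangesTotal v w)
    {y : E →L[ℂ] E} {z : F →L[ℂ] F} (hz : Transfers v w y z) : z ∈ generated (Set.range w) := by
  refine (mem_generated_range_iff hw).2 fun c hc => h.ext fun B hB => ?_
  have hcB : Intertwines v w (c.comp B) := fun g => by
    rw [ContinuousLinearMap.comp_assoc, hB g, ← ContinuousLinearMap.comp_assoc,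
      ← ContinuousLinearMap.comp_assoc]
    exact congrArg (fun A : F →L[ℂ] F => A.comp B) (hc g).symm
  change c.comp (z.comp B) = z.comp (c.comp B)
  rw [hz B hB, hz _ hcB, ContinuousLinearMap.comp_assoc]

theorem Transfers.unique (h : RangesTotal v w) {y : E →L[ℂ] E} {z z' : F →L[ℂ] F}
    (hz : Transfers v w y z) (hz' : Transfers v w y z') : z = z' :=
  h.ext fun B hB => (hz B hB).trans (hz' B hB).symm

theorem Transfers.add {y y' : E →L[ℂ] E} {z z' : F →L[ℂ] F}
    (hz : Transfers v w y z) (hz' : Transfers v w y' z') : Transfers v w (y + y') (z + z') :=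
  fun B hB => by
    rw [ContinuousLinearMap.add_comp, hz B hB, hz' B hB, ← ContinuousLinearMap.comp_add]

theorem Transfers.smul {y : E →L[ℂ] E} {z : F →L[ℂ] F} (hz : Transfers v w y z) (c : ℂ) :
    Transfers v w (c • y) (c • z) := fun B hB => by
  rw [ContinuousLinearMap.smul_comp, hz B hB, ← ContinuousLinearMap.comp_smul]

theorem Transfers.mul {y y' : E →L[ℂ] E} {z z' : F →L[ℂ] F}
    (hz : Transfers v w y z) (hz' : Transfers v w y' z') : Transfers v w (y * y') (z * z') :=
  fun B hB => by
    change z.comp (z'.comp B) = (B.comp y).comp y'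
    rw [hz' B hB, ← hz B hB, ContinuousLinearMap.comp_assoc]

theorem Transfers.star_right (hv : ∀ g, star (v g) = v g⁻¹) (hw : ∀ g, star (w g) = w g⁻¹)
    (h : RangesTotal v w) {y : E →L[ℂ] E} (hy : y ∈ generated (Set.range v)) {z : F →L[ℂ] F}
    (hz : Transfers v w y z) : Transfers v w (star y) (star z) := by
  intro B hB
  ext a
  refine sub_eq_zero.1 (h _ fun B' hB' a' => ?_)
  rw [inner_sub_left, sub_eq_zero]
  change inner ℂ (star z (B a)) (B' a') = inner ℂ (B (star y a)) (B' a')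
  rw [← inner_comp_apply hv hw hy hB hB', ContinuousLinearMap.star_eq_adjoint,
    ContinuousLinearMap.adjoint_inner_left]
  exact congrArg (fun A : E →L[ℂ] F => inner ℂ (B a) (A a')) (hz B' hB')

theorem Transfers.swap (hv : ∀ g, star (v g) = v g⁻¹) (hw : ∀ g, star (w g) = w g⁻¹)
    (h : RangesTotal v w) {y : E →L[ℂ] E} (hy : y ∈ generated (Set.range v)) {z : F →L[ℂ] F}
    (hz : Transfers v w y z) : Transfers w v z y := by
  intro B hB
  have h1 := congrArg ContinuousLinearMap.adjoint
    (hz.star_right hv hw h hy _ (hB.adjoint hw hv))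
  rw [ContinuousLinearMap.adjoint_comp, ContinuousLinearMap.adjoint_comp,
    ContinuousLinearMap.adjoint_adjoint, ContinuousLinearMap.star_eq_adjoint,
    ContinuousLinearMap.star_eq_adjoint, ContinuousLinearMap.adjoint_adjoint,
    ContinuousLinearMap.adjoint_adjoint] at h1
  exact h1.symm

theorem exists_transfers_left (hv : ∀ g, star (v g) = v g⁻¹) (hw : ∀ g, star (w g) = w g⁻¹)
    (h' : RangesTotal w v) {z : F →L[ℂ] F} (hz : z ∈ generated (Set.range w)) :
    ∃ y ∈ generated (Set.range v), Transfers v w y z := by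
  obtain ⟨y, hy⟩ := exists_transfers hw hv h' hz
  exact ⟨y, hy.mem_generated hv h', hy.swap hw hv h' hz⟩

/-- This is quasi-equivalence: totality of ranges in one direction makes y ↦ z a well defined star
homomorphism, and in the other direction makes it bijective. -/
theorem nonempty_starAlgEquiv_generated (hv : ∀ g, star (v g) = v g⁻¹)
    (hw : ∀ g, star (w g) = w g⁻¹) (h : RangesTotal v w) (h' : RangesTotal w v) :
    Nonempty ((generated (Set.range v)).toStarSubalgebra ≃⋆ₐ[ℂ]
      (generated (Set.range w)).toStarSubalgebra) := by
  choose φ hφ using fun y : (generated (Set.range v)).toStarSubalgebra =>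
    exists_transfers hv hw h y.2
  let f : (generated (Set.range v)).toStarSubalgebra → (generated (Set.range w)).toStarSubalgebra :=
    fun y => ⟨φ y, (hφ y).mem_generated hw h⟩
  have huniq : ∀ (y : (generated (Set.range v)).toStarSubalgebra) (z : (generated (Set.range w)).toStarSubalgebra),
      Transfers v w (y : E →L[ℂ] E) (z : F →L[ℂ] F) → f y = z :=
    fun y z hz => Subtype.ext ((hφ y).unique h hz)
  let e : (generated (Set.range v)).toStarSubalgebra →⋆ₐ[ℂ]
      (generated (Set.range w)).toStarSubalgebra :=
    { toFun := f
      map_one' := huniq 1 1 fun B _ => rfl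
      map_mul' := fun y y' => huniq (y * y') (f y * f y') ((hφ y).mul (hφ y'))
      map_zero' := huniq 0 0 fun B _ => by
        change (0 : F →L[ℂ] F).comp B = B.comp (0 : E →L[ℂ] E)
        simp
      map_add' := fun y y' => huniq (y + y') (f y + f y') ((hφ y).add (hφ y'))
      commutes' := fun c => huniq (algebraMap ℂ _ c) (algebraMap ℂ _ c) (by
        have h1 : Transfers v w (1 : E →L[ℂ] E) (1 : F →L[ℂ] F) := fun B _ => rfl
        have := h1.smul c
        rw [← Algebra.algebraMap_eq_smul_one, ← Algebra.algebraMap_eq_smul_one] at this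
        exact this)
      map_star' := fun y => huniq (star y) (star (f y)) ((hφ y).star_right hv hw h y.2) }
  refine ⟨StarAlgEquiv.ofBijective e ⟨?_, ?_⟩⟩
  · intro y y' hyy
    have h1 := (hφ y).swap hv hw h y.2
    have h2 := (hφ y').swap hv hw h y'.2
    have h3 : φ y = φ y' := congrArg Subtype.val hyy
    rw [h3] at h1
    exact Subtype.ext (h1.unique h' h2)
  · intro z
    obtain ⟨y, hy, hyz⟩ := exists_transfers_left hv hw h' z.2
    exact ⟨⟨y, hy⟩, huniq _ _ hyz⟩

end Intertwiners

/-! ### Unitaries of a finite von Neumann algebra -/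

section Main

variable {H : Type*} [NormedAddCommGroup H] [InnerProductSpace ℂ H] [CompleteSpace H]
  {M : VonNeumannAlgebra H} {τ : M.toStarSubalgebra →ₗ[ℂ] ℂ}

theorem generated_range_le {G : Type*} [Group G] {u : G →* M.toStarSubalgebra}
    (hu : ∀ g, star (u g) = u g⁻¹) :
    generated (Set.range fun g => (u g : H →L[ℂ] H)) ≤ M := by
  intro y hy
  rw [← M.commutant_commutant, VonNeumannAlgebra.mem_commutant_iff]
  intro c hc
  exact (mem_generated_range_iff (v := fun g => (u g : H →L[ℂ] H))
    (fun g => congrArg Subtype.val (hu g))).1 hy c fun g =>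
      VonNeumannAlgebra.mem_commutant_iff.1 hc _ (u g).2

theorem intertwines_coeff {G : Type*} [Group G] {v : G →* (H →L[ℂ] H)}
    (hv : ∀ g, star (v g) = v g⁻¹) {x : H} {C : ℝ} (hx : IsBessel (fun g => v g x) C) :
    Intertwines v leftRegular hx.coeff := by
  intro h
  ext a g
  change inner ℂ (v g x) (v h a) = inner ℂ (v (h⁻¹ * g) x) a
  rw [map_mul, ← hv, ContinuousLinearMap.star_eq_adjoint]
  exact (ContinuousLinearMap.adjoint_inner_left _ _ _).symm

theorem embeds_of_forall_trace_eq_zero (hτ : IsNormalFaithfulTracialState M τ) {G : Type*}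
    [Group G] {u : G →* M.toStarSubalgebra} (hu : ∀ g, star (u g) = u g⁻¹)
    (h0 : ∀ g, g ≠ 1 → τ (u g) = 0) : Embeds (groupVN G) M := by
  classical
  set v : G →* (H →L[ℂ] H) := (M.toStarSubalgebra.subtype : _ →* (H →L[ℂ] H)).comp u with hvdef
  have hv : ∀ g, star (v g) = v g⁻¹ := fun g => congrArg Subtype.val (hu g)
  refine ⟨generated (Set.range v), generated_range_le hu, ?_⟩
  refine nonempty_starAlgEquiv_generated star_leftRegular hv ?_ ?_
  · intro f hf
    refine eq_zero_of_forall_boundedVectors hτ hu h0 ?_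
    rintro x ⟨C, hx⟩
    -- The adjoint of the coefficient map of x sends δ_1 to x, so its range contains the given
    -- bounded vector.
    have h1 := hf _ ((intertwines_coeff hv hx).adjoint hv star_leftRegular) (lp.single 2 1 1)
    rw [ContinuousLinearMap.adjoint_inner_right, lp.inner_single_right] at h1
    change inner ℂ (inner ℂ (v 1 x) f) (1 : ℂ) = 0 at h1
    rw [map_one] at h1
    have h2 : conj (inner ℂ x f) = (0 : ℂ) := by simpa using h1
    exact (map_eq_zero _).1 h2
  · intro f hf
    exact eq_zero_of_forall_inner_coeff hτ hu h0 fun x C hx a =>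
      hf _ (intertwines_coeff hv hx) a

theorem two_sqrt_three_le_norm_of_functional {E : Type*} [NormedAddCommGroup E]
    [InnerProductSpace ℂ E] [CompleteSpace E] {π : FreeGroup (Fin 2) →* (E →L[ℂ] E)}
    (hπ : ∀ g, star (π g) = π g⁻¹) {Φ : (E →L[ℂ] E) →L[ℂ] ℂ} {f : FreeGroup (Fin 2) → ℝ}
    (hf : ∀ g, 0 ≤ f g) (hΦ : ∀ g, Φ (π g) = f g) (h1 : f 1 = 1) : 2 * √3 ≤ ‖sphereSum π 1‖ :=
  two_sqrt_three_le_norm π hπ Φ f hf hΦ h1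

theorem exists_sum_sphere_le_of_functional {E : Type*} [NormedAddCommGroup E]
    [InnerProductSpace ℂ E] [CompleteSpace E] {π : FreeGroup (Fin 2) →* (E →L[ℂ] E)}
    (hπ : ∀ g, star (π g) = π g⁻¹) {Φ : (E →L[ℂ] E) →L[ℂ] ℂ} {f : FreeGroup (Fin 2) → ℝ}
    (hf : ∀ g, 0 ≤ f g) (hΦ : ∀ g, Φ (π g) = f g) (hT : ‖sphereSum π 1‖ ≤ 2 * √3) :
    ∃ C : ℝ, ∀ n : ℕ, ∑ L ∈ sphere n, f (FreeGroup.mk L) ≤ C * (2 * (n + 1) * √3 ^ n) :=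
  ⟨‖Φ‖, sum_sphere_le_of_norm_le π hπ Φ f hf hΦ hT⟩

theorem exists_functional_unitaryRep (hτ : IsNormalFaithfulTracialState M τ)
    (u : Fin 2 → unitary M.toStarSubalgebra) :
    ∃ Φ : (HilbertTensor H (StrongDual ℂ H) →L[ℂ] HilbertTensor H (StrongDual ℂ H)) →L[ℂ] ℂ,
      ∀ g, Φ (doubleRep (unitaryRepOp M u) g) = ((‖τ (unitaryRep M u g)‖ ^ 2 : ℝ) : ℂ) := by
  obtain ⟨Φ, hΦ⟩ := exists_functional_doubleRep hτ
  refine ⟨Φ, fun g => ?_⟩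
  rw [doubleRep_apply, ← coe_unitaryRep, ← coe_unitaryRep, hΦ, ← star_unitaryRep,
    hτ.isTracialState.map_star, Complex.mul_conj, Complex.normSq_eq_norm_sq]

theorem two_sqrt_three_le_tensorNorm (hτ : IsNormalFaithfulTracialState M τ)
    (u : Fin 2 → unitary M.toStarSubalgebra) : 2 * √3 ≤ tensorNorm M u := by
  obtain ⟨Φ, hΦ⟩ := exists_functional_unitaryRep hτ u
  have h1 : ‖τ (unitaryRep M u 1)‖ ^ 2 = 1 := by
    rw [map_one, hτ.map_one, norm_one, one_pow]
  rw [tensorNorm_eq]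
  exact two_sqrt_three_le_norm_of_functional (star_doubleRep _ (star_unitaryRepOp u))
    (f := fun g => ‖τ (unitaryRep M u g)‖ ^ 2) (fun g => sq_nonneg _) hΦ h1

theorem exists_sum_sphere_trace_le (hτ : IsNormalFaithfulTracialState M τ)
    {u : Fin 2 → unitary M.toStarSubalgebra} (hu : tensorNorm M u ≤ 2 * √3) :
    ∃ C : ℝ, ∀ n : ℕ, ∑ L ∈ sphere n, ‖τ (unitaryRep M u (FreeGroup.mk L))‖ ^ 2 ≤
      C * (2 * (n + 1) * √3 ^ n) := by
  obtain ⟨Φ, hΦ⟩ := exists_functional_unitaryRep hτ u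
  rw [tensorNorm_eq] at hu
  exact exists_sum_sphere_le_of_functional (star_doubleRep _ (star_unitaryRepOp u))
    (f := fun g => ‖τ (unitaryRep M u g)‖ ^ 2) (fun g => sq_nonneg _) hΦ hu

theorem trace_unitaryRep_eq_zero (hτ : IsNormalFaithfulTracialState M τ)
    {u : Fin 2 → unitary M.toStarSubalgebra} (hu : tensorNorm M u ≤ 2 * √3)
    {w : FreeGroup (Fin 2)} (hw : w ≠ 1) : τ (unitaryRep M u w) = 0 := by
  classical
  by_contra hne
  obtain ⟨C, hC⟩ := exists_sum_sphere_trace_le hτ hu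
  obtain ⟨V, hV, δ, hδ, H4⟩ := exists_finset_le_norm_fourConj (star_unitaryRep u)
    hτ.isTracialState hw hne
  obtain ⟨t, ht⟩ := exists_forall_isBracket_conj V hV
  refine false_of_le_fourConj (V := V.image fun x => (t * x * t⁻¹).toWord) ?_
    (fun g => ‖τ (unitaryRep M u g)‖ ^ 2) (fun g => by positivity) (δ := δ ^ 2) (by positivity)
    ?_ hC
  · intro v hv
    obtain ⟨x, hx, rfl⟩ := Finset.mem_image.1 hv
    exact ht x hx
  · intro h₁ h₂ h₃ h₄
    -- Conjugation by t turns V into brackets; it is absorbed by using h_i t as conjugators.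
    obtain ⟨v₁, hv₁, v₂, hv₂, v₃, hv₃, v₄, hv₄, h⟩ := H4 (h₁ * t) (h₂ * t) (h₃ * t) (h₄ * t)
    refine ⟨_, Finset.mem_image_of_mem _ hv₁, _, Finset.mem_image_of_mem _ hv₂, _,
      Finset.mem_image_of_mem _ hv₃, _, Finset.mem_image_of_mem _ hv₄, ?_⟩
    have hconj : ∀ x v : FreeGroup (Fin 2),
        x * (t * v * t⁻¹) * x⁻¹ = x * t * v * (x * t)⁻¹ := fun x v => by group
    simp only [FreeGroup.mk_toWord, hconj]
    gcongr

theorem exists_tensorNorm_le_of_embeds (hτ : IsNormalFaithfulTracialState M τ)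
    (h : Embeds (groupVN (FreeGroup (Fin 2))) M) :
    ∃ u : Fin 2 → unitary M.toStarSubalgebra, tensorNorm M u ≤ 2 * √3 := by
  obtain ⟨P, hP, ⟨Θ⟩⟩ := h
  have hP' : P.toStarSubalgebra ≤ M.toStarSubalgebra := hP
  let Ψ : (groupVN (FreeGroup (Fin 2))).toStarSubalgebra →⋆ₐ[ℂ] M.toStarSubalgebra :=
    (StarSubalgebra.inclusion hP').comp (Θ : _ →⋆ₐ[ℂ] P.toStarSubalgebra)
  have hstar : ∀ g, star (Ψ (leftRegularRep _ g)) = Ψ (leftRegularRep _ g⁻¹) := fun g => by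
    rw [← map_star, star_leftRegularRep]
  let ρ : FreeGroup (Fin 2) →* M.toStarSubalgebra :=
    (Ψ : _ →* M.toStarSubalgebra).comp (leftRegularRep (FreeGroup (Fin 2)))
  let u : Fin 2 → unitary M.toStarSubalgebra := fun i => ⟨ρ (FreeGroup.of i), by
    rw [Unitary.mem_iff]
    constructor
    · rw [show star (ρ (FreeGroup.of i)) = ρ (FreeGroup.of i)⁻¹ from hstar _, ← map_mul,
        inv_mul_cancel, map_one]
    · rw [show star (ρ (FreeGroup.of i)) = ρ (FreeGroup.of i)⁻¹ from hstar _, ← map_mul,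
        mul_inv_cancel, map_one]⟩
  have hu : unitaryRep M u = ρ := FreeGroup.ext_hom _ _ fun i => unitaryRep_of u i
  have h0 : ∀ g, g ≠ 1 → τ (unitaryRep M u g) = 0 := fun g hg => by
    rw [hu]
    exact map_eq_zero_of_embedding hτ Ψ hg
  refine ⟨u, ?_⟩
  rw [tensorNorm_eq]
  exact norm_sphereSum_doubleRep_le _ (star_unitaryRepOp u) fun v hv =>
    eq_zero_of_forall_boundedVectors hτ (star_unitaryRep u) h0 hv

end Main

end FreeEmbedding

end

theorem mainTheorem2 {H : Type*} [NormedAddCommGroup H] [InnerProductSpace ℂ H] [CompleteSpace H]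
    (M : VonNeumannAlgebra H) (τ : M.toStarSubalgebra →ₗ[ℂ] ℂ)
    (hτ : FreeEmbedding.IsNormalFaithfulTracialState M τ) :
    FreeEmbedding.Embeds (FreeEmbedding.groupVN (FreeGroup (Fin 2))) M ↔
      (⨅ u : Fin 2 → unitary M.toStarSubalgebra, FreeEmbedding.tensorNorm M u) = 2 * √3 ∧
        ∃ u : Fin 2 → unitary M.toStarSubalgebra,
          FreeEmbedding.tensorNorm M u =
            ⨅ v : Fin 2 → unitary M.toStarSubalgebra, FreeEmbedding.tensorNorm M v := by
  constructor
  · intro h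
    obtain ⟨u, hu⟩ := FreeEmbedding.exists_tensorNorm_le_of_embeds hτ h
    have hlow := FreeEmbedding.two_sqrt_three_le_tensorNorm hτ
    have hinf : (⨅ u : Fin 2 → unitary M.toStarSubalgebra, FreeEmbedding.tensorNorm M u) =
        2 * √3 :=
      le_antisymm ((ciInf_le ⟨_, Set.forall_mem_range.2 hlow⟩ u).trans hu) (le_ciInf hlow)
    exact ⟨hinf, u, by rw [hinf]; exact le_antisymm hu (hlow u)⟩
  · rintro ⟨hinf, u, hu⟩
    exact FreeEmbedding.embeds_of_forall_trace_eq_zero hτ (FreeEmbedding.star_unitaryRep u)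
      fun g hg => FreeEmbedding.trace_unitaryRep_eq_zero hτ (hu.trans hinf).le hg
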